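/- **Theorem 4 (Subsequence Indexing).** Consider a deterministic word RAM whose words have $w$ bits, whose memory is addressed by words, and on which loading or storing a word, reading an input character, comparing two words, and arithmetic, bitwise and shift operations on words each take one step; space is counted in memory words. There are two fixed programs, a preprocessing program and a query program, and constants $c$ and $C$ such that the following holds for all integers $2\le\sigma\le n$, every text $T$ of length $n$ over the alphabet $\{0,\dots,\sigma-1\}$ (one character per word), every real $\ell$ with $0\le\ell\le\log_2\log_2\sigma$, and every word size $w\ge c\log_2 n$. Given $T$, $n$, $\sigma$ and $\lceil\ell\rceil$, the preprocessing program builds a data structure for $T$ in time and space (worst case) at most $C\,n\,\sigma^{1/2^{\ell}}$. Afterwards, given any string $Q$ over the same alphabet, of length $m<2^w$ (together with $m$, but without access to $T$ other than through the data structure), the query program correctly answers "is $Q$ a (not necessarily contiguous) subsequence of $T$?" in at most $C\,(m(\ell+1)+1)$ steps, that is, in $O(m(\ell+1))$ time for $m\ge 1$ and $O(1)$ time for $m=0$. The query uses at most $C\,n\,\sigma^{1/2^{\ell}}$ words of memory and leaves the memory unchanged at the end, so any number of queries can be asked. -/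

import Mathlib

/-! A deterministic word RAM with `w`-bit words, programmed by structured programs over
finitely many registers and a memory of `2 ^ w` words addressed by words. -/

namespace WordRAM

/-- The constant-time operations on words. -/
inductive BinOp where
  | add | sub | mul | div | mod | and | or | xor | shl | shr

/-- Arithmetic is modulo `2 ^ w`; division and remainder are unsigned; `shl` and `shr` are the
logical shifts. -/
def BinOp.eval {w : ℕ} : BinOp → BitVec w → BitVec w → BitVec w
  | .add, x, y => x + y
  | .sub, x, y => x - y
  | .mul, x, y => x * y
  | .div, x, y => x / y
  | .mod, x, y => x % y
  | .and, x, y => x &&& y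
  | .or, x, y => x ||| y
  | .xor, x, y => x ^^^ y
  | .shl, x, y => x <<< y
  | .shr, x, y => x >>> y

/-- Constant-time (unsigned) comparisons of words. -/
inductive Cmp where
  | lt | le | eq | ne

def Cmp.Holds {w : ℕ} : Cmp → BitVec w → BitVec w → Prop
  | .lt, x, y => x.toNat < y.toNat
  | .le, x, y => x.toNat ≤ y.toNat
  | .eq, x, y => x = y
  | .ne, x, y => x ≠ y

/-- Programs. The natural numbers `r`, `a`, `b` are names of registers. A program does not depend
on the word size. -/
inductive Prog where
  /-- `r := k`, for a literal `k` (reduced modulo `2 ^ w`) -/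
  | const (r k : ℕ)
  /-- `r := a` -/
  | move (r a : ℕ)
  /-- `r := a o b` -/
  | op (o : BinOp) (r a b : ℕ)
  /-- `r := memory[a]` -/
  | load (r a : ℕ)
  /-- `memory[a] := b` -/
  | store (a b : ℕ)
  /-- `r := input[a]`, where the input is a read-only array of words -/
  | read (r a : ℕ)
  | seq (p q : Prog)
  | cond (e : Cmp) (a b : ℕ) (p q : Prog)
  | loop (e : Cmp) (a b : ℕ) (p : Prog)

/-- The contents of the registers and of the memory. -/
@[ext]
structure State (w : ℕ) where
  regs : ℕ → BitVec w
  mem : BitVec w → BitVec w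

namespace State

variable {w : ℕ}

/-- The state with register `r` set to `x`. -/
def setReg (s : State w) (r : ℕ) (x : BitVec w) : State w :=
  { s with regs := Function.update s.regs r x }

/-- The state with the memory cell at address `a` set to `x`. -/
def setMem (s : State w) (a x : BitVec w) : State w :=
  { s with mem := Function.update s.mem a x }

/-- The state with the given memory in which registers `0, 1, …` hold the arguments and all
other registers hold `0`. -/
def start (args : List ℕ) (mem : BitVec w → BitVec w) : State w where
  regs i := BitVec.ofNat w (args.getD i 0)
  mem := mem

end State

/-- `Exec inp p s s' t a`: on the input array `inp`, the program `p` started in state `s` halts in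
state `s'` after exactly `t` steps, and `a` is the least number such that all the memory addresses
it reads or writes are below `a` (the number of memory words used). Every operation, memory or
input access and every evaluation of a test is one step. Reading the input outside its range
yields `0`. -/
inductive Exec {w : ℕ} (inp : List (BitVec w)) :
    Prog → State w → State w → ℕ → ℕ → Prop where
  | const (r k : ℕ) (s : State w) :
      Exec inp (.const r k) s (s.setReg r (BitVec.ofNat w k)) 1 0
  | move (r a : ℕ) (s : State w) :
      Exec inp (.move r a) s (s.setReg r (s.regs a)) 1 0
  | op (o : BinOp) (r a b : ℕ) (s : State w) :
      Exec inp (.op o r a b) s (s.setReg r (o.eval (s.regs a) (s.regs b))) 1 0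
  | load (r a : ℕ) (s : State w) :
      Exec inp (.load r a) s (s.setReg r (s.mem (s.regs a))) 1 ((s.regs a).toNat + 1)
  | store (a b : ℕ) (s : State w) :
      Exec inp (.store a b) s (s.setMem (s.regs a) (s.regs b)) 1 ((s.regs a).toNat + 1)
  | read (r a : ℕ) (s : State w) :
      Exec inp (.read r a) s (s.setReg r (inp.getD (s.regs a).toNat 0)) 1 0
  | seq {p q : Prog} {s₁ s₂ s₃ : State w} {t₁ t₂ a₁ a₂ : ℕ} :
      Exec inp p s₁ s₂ t₁ a₁ → Exec inp q s₂ s₃ t₂ a₂ →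
      Exec inp (.seq p q) s₁ s₃ (t₁ + t₂) (max a₁ a₂)
  | cond_true {e : Cmp} {a b : ℕ} {p q : Prog} {s s' : State w} {t u : ℕ} :
      e.Holds (s.regs a) (s.regs b) → Exec inp p s s' t u →
      Exec inp (.cond e a b p q) s s' (t + 1) u
  | cond_false {e : Cmp} {a b : ℕ} {p q : Prog} {s s' : State w} {t u : ℕ} :
      ¬ e.Holds (s.regs a) (s.regs b) → Exec inp q s s' t u →
      Exec inp (.cond e a b p q) s s' (t + 1) u
  | loop_exit {e : Cmp} {a b : ℕ} {p : Prog} {s : State w} :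
      ¬ e.Holds (s.regs a) (s.regs b) → Exec inp (.loop e a b p) s s 1 0
  | loop_step {e : Cmp} {a b : ℕ} {p : Prog} {s₁ s₂ s₃ : State w} {t₁ t₂ a₁ a₂ : ℕ} :
      e.Holds (s₁.regs a) (s₁.regs b) → Exec inp p s₁ s₂ t₁ a₁ →
      Exec inp (.loop e a b p) s₂ s₃ t₂ a₂ →
      Exec inp (.loop e a b p) s₁ s₃ (t₁ + t₂ + 1) (max a₁ a₂)

/-- A string over the alphabet `{0, …, σ - 1}` as an array with one character per word. -/
def encode (w : ℕ) {σ : ℕ} (S : List (Fin σ)) : List (BitVec w) :=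
  S.map fun x => BitVec.ofNat w x

end WordRAM

/-- With word size `w`, the pair of programs `build` and `query` indexes the text `T` for
subsequence queries: `build` is given `T`, its length, the alphabet size and the integer parameter
`k`, starts with an empty (all-zero) memory, and takes at most `P` time and space; from then on
`query`, which is given a string `Q` and its length but not `T`, decides (by the value 1 or 0 of
register 0) whether `Q` is a subsequence of `T`, in time at most `R |Q|`, without using more than
`P` words of memory, and leaving the memory as it found it, so that further queries can follow. -/
def IndexesSubsequences (build query : WordRAM.Prog) (w : ℕ) {σ : ℕ} (T : List (Fin σ)) (k : ℕ)
    (P : ℝ) (R : ℕ → ℝ) : Prop :=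
  ∃ (s : WordRAM.State w) (t a : ℕ),
    WordRAM.Exec (WordRAM.encode w T) build
      (WordRAM.State.start [T.length, σ, k] fun _ => 0) s t a ∧
    (t : ℝ) ≤ P ∧ (a : ℝ) ≤ P ∧
    ∀ Q : List (Fin σ), Q.length < 2 ^ w →
      ∃ (s' : WordRAM.State w) (t' a' : ℕ),
        WordRAM.Exec (WordRAM.encode w Q) query
          (WordRAM.State.start [Q.length] s.mem) s' t' a' ∧
        s'.regs 0 = (if Q.Sublist T then 1 else 0) ∧
        s'.mem = s.mem ∧ (t' : ℝ) ≤ R Q.length ∧ (a' : ℝ) ≤ P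

set_option linter.constructorNameAsVariable false

namespace WordRAM

/-- The variables of structured programs. -/
inductive Var where
  | n | sig | k | u | g | lv | m | kap | nb | bu | bg | bm
  | b | c | lo | hi | tau | l | h | mid | cnt | dd | t | s0 | s1 | i | r | v | j | d | col | y
  | om | nk | p | pos | ok | vv | il | ih | stamp | base | idx | z | x | tb | sh | col0 | q
  deriving DecidableEq

/-- The arrays of structured programs. -/
inductive Arr where
  | par | st | first | ps | mark | xs | xv | tree | disp1 | disp2 | key | val | kc | kv | nxt | head | len
  deriving DecidableEq

def Var.code (x : Var) : ℕ := x.ctorIdx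

def Arr.code (q : Arr) : ℕ := q.ctorIdx

theorem Var.code_injective : Function.Injective Var.code := fun x y h => by
  rw [← Var.ofNat_ctorIdx x, ← Var.ofNat_ctorIdx y]; exact congrArg Var.ofNat h

theorem Arr.code_injective : Function.Injective Arr.code := fun x y h => by
  rw [← Arr.ofNat_ctorIdx x, ← Arr.ofNat_ctorIdx y]; exact congrArg Arr.ofNat h

theorem Arr.code_lt (q : Arr) : q.code < 32 := by cases q <;> decide

/-- Expressions over variables, arrays and the input. -/
inductive Ex where
  | var (x : Var)
  | lit (k : ℕ)
  | bin (o : BinOp) (a b : Ex)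
  | get (q : Arr) (i : Ex)
  | inp (i : Ex)

/-- Structured statements; `loop x e p` runs `p` with `x = 0, 1, …, e - 1`. -/
inductive Stmt where
  | set (x : Var) (e : Ex)
  | put (q : Arr) (i e : Ex)
  | seq (p q : Stmt)
  | ite (o : Cmp) (a b : Ex) (p q : Stmt)
  | skip
  | loop (x : Var) (e : Ex) (p : Stmt)

/-- States with natural numbers as values; `t` counts the steps. -/
structure St where
  v : Var → ℕ
  a : Arr → ℕ → ℕ
  t : ℕ

/-- The word size, a bound for the array indices, and the input. -/
structure Env where
  w : ℕ
  amax : ℕ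
  inp : ℕ → ℕ

namespace St

def set (s : St) (x : Var) (k : ℕ) : St := { s with v := Function.update s.v x k }

def put (s : St) (q : Arr) (i k : ℕ) : St :=
  { s with a := Function.update s.a q (Function.update (s.a q) i k) }

def tick (s : St) (k : ℕ) : St := { s with t := s.t + k }

variable (s : St) (x y : Var) (q q' : Arr) (i j k : ℕ)

@[simp] theorem set_v : (s.set x k).v y = if y = x then k else s.v y := by
  simp [set, Function.update_apply]
@[simp] theorem set_a : (s.set x k).a = s.a := rfl
@[simp] theorem set_t : (s.set x k).t = s.t := rfl
@[simp] theorem put_v : (s.put q i k).v = s.v := rfl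
theorem put_a : (s.put q i k).a q' j = if q' = q ∧ j = i then k else s.a q' j := by
  by_cases h : q' = q
  · subst h; by_cases h' : j = i <;> simp [put, h']
  · simp [put, h]
@[simp] theorem put_a_of_ne (h : q' ≠ q) : (s.put q i k).a q' = s.a q' := by
  simp [put, Function.update_of_ne h]
@[simp] theorem put_a_self : (s.put q i k).a q = Function.update (s.a q) i k := by
  simp [put]
@[simp] theorem put_t : (s.put q i k).t = s.t := rfl
@[simp] theorem tick_v : (s.tick k).v = s.v := rfl
@[simp] theorem tick_a : (s.tick k).a = s.a := rfl
@[simp] theorem tick_t : (s.tick k).t = s.t + k := rfl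

end St

/-- The value of an operation on natural numbers, when there is no overflow. -/
def BinOp.nat : BinOp → ℕ → ℕ → ℕ
  | .add, x, y => x + y
  | .sub, x, y => x - y
  | .mul, x, y => x * y
  | .div, x, y => x / y
  | .mod, x, y => x % y
  | .and, x, y => x &&& y
  | .or, x, y => x ||| y
  | .xor, x, y => x ^^^ y
  | .shl, x, y => x * 2 ^ y
  | .shr, x, y => x / 2 ^ y

/-- The condition under which an operation on words agrees with that on natural numbers. -/
def BinOp.Ok (w : ℕ) : BinOp → ℕ → ℕ → Prop
  | .add, x, y => x + y < 2 ^ w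
  | .sub, x, y => y ≤ x
  | .mul, x, y => x * y < 2 ^ w
  | .shl, x, y => x * 2 ^ y < 2 ^ w
  | _, _, _ => True

theorem BinOp.toNat_eval {w : ℕ} (o : BinOp) (x y : BitVec w) (h : o.Ok w x.toNat y.toNat) :
    (o.eval x y).toNat = o.nat x.toNat y.toNat := by
  have hx := x.isLt
  have hy := y.isLt
  cases o <;> simp only [BinOp.Ok, BinOp.eval, BinOp.nat] at h ⊢
  · rw [BitVec.toNat_add, Nat.mod_eq_of_lt h]
  · rw [BitVec.toNat_sub, show 2 ^ w - y.toNat + x.toNat = x.toNat - y.toNat + 2 ^ w by omega,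
      Nat.add_mod_right, Nat.mod_eq_of_lt (by omega)]
  · rw [BitVec.toNat_mul, Nat.mod_eq_of_lt h]
  · simp
  · simp
  · simp
  · simp
  · simp
  · rw [BitVec.shiftLeft_eq', BitVec.toNat_shiftLeft, Nat.shiftLeft_eq, Nat.mod_eq_of_lt h]
  · simp [Nat.shiftRight_eq_div_pow]

def Cmp.nat : Cmp → ℕ → ℕ → Prop
  | .lt, x, y => x < y
  | .le, x, y => x ≤ y
  | .eq, x, y => x = y
  | .ne, x, y => x ≠ y

instance (o : Cmp) (x y : ℕ) : Decidable (o.nat x y) := by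
  cases o <;> simp only [Cmp.nat] <;> infer_instance

theorem Cmp.holds_iff {w : ℕ} (o : Cmp) (x y : BitVec w) :
    o.Holds x y ↔ o.nat x.toNat y.toNat := by
  cases o <;> simp [Cmp.Holds, Cmp.nat, BitVec.toNat_inj]

namespace Ex

def eval (E : Env) (s : St) : Ex → ℕ
  | var x => s.v x
  | lit k => k
  | bin o a b => o.nat (a.eval E s) (b.eval E s)
  | get q i => s.a q (i.eval E s)
  | inp i => E.inp (i.eval E s)

/-- No overflow and no index out of bounds. -/
def Ok (E : Env) (s : St) : Ex → Prop
  | var _ => True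
  | lit k => k < 2 ^ E.w
  | bin o a b => a.Ok E s ∧ b.Ok E s ∧ o.Ok E.w (a.eval E s) (b.eval E s)
  | get _ i => i.Ok E s ∧ i.eval E s < E.amax
  | inp i => i.Ok E s

def cost : Ex → ℕ
  | var _ => 1
  | lit _ => 1
  | bin _ a b => a.cost + b.cost + 1
  | get _ i => i.cost + 5
  | inp i => i.cost + 1

end Ex

namespace Stmt

def run (E : Env) : Stmt → St → St
  | set x e, s => (s.set x (e.eval E s)).tick (e.cost + 1)
  | put q i e, s => (s.put q (i.eval E s) (e.eval E s)).tick (i.cost + e.cost + 5)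
  | seq p q, s => q.run E (p.run E s)
  | ite o a b p q, s =>
    if o.nat (a.eval E s) (b.eval E s) then p.run E (s.tick (a.cost + b.cost + 1))
    else q.run E (s.tick (a.cost + b.cost + 1))
  | skip, s => s.tick 1
  | loop x e p, s =>
    Nat.rec (s.tick (e.cost + 3)) (fun i s' => p.run E ((s'.set x i).tick 4)) (e.eval E s)

def Ok (E : Env) : Stmt → St → Prop
  | set _ e, s => e.Ok E s
  | put _ i e, s => i.Ok E s ∧ e.Ok E s ∧ i.eval E s < E.amax
  | seq p q, s => p.Ok E s ∧ q.Ok E (p.run E s)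
  | ite o a b p q, s => a.Ok E s ∧ b.Ok E s ∧
    if o.nat (a.eval E s) (b.eval E s) then p.Ok E (s.tick (a.cost + b.cost + 1))
    else q.Ok E (s.tick (a.cost + b.cost + 1))
  | skip, _ => True
  | loop x e p, s => e.Ok E s ∧ ∀ i < e.eval E s,
    p.Ok E (((Nat.rec (s.tick (e.cost + 3))
      (fun i s' => p.run E ((s'.set x i).tick 4)) i : St).set x i).tick 4)

/-- The variables that a statement may change. -/
def writes : Stmt → Var → Bool
  | set x _, y => x = y
  | put _ _ _, _ => false
  | seq p q, y => p.writes y || q.writes y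
  | ite _ _ _ p q, y => p.writes y || q.writes y
  | skip, _ => false
  | loop x _ p, y => decide (x = y) || p.writes y

/-- The arrays that a statement may change. -/
def stores : Stmt → Arr → Bool
  | set _ _, _ => false
  | put q _ _, q' => q = q'
  | seq p q, y => p.stores y || q.stores y
  | ite _ _ _ p q, y => p.stores y || q.stores y
  | skip, _ => false
  | loop _ _ p, y => p.stores y

end Stmt

/-- `s'` agrees with `s` on all that `p` leaves alone. -/
structure Frame (p : Stmt) (s s' : St) : Prop where
  v : ∀ x, p.writes x = false → s'.v x = s.v x
  a : ∀ q, p.stores q = false → s'.a q = s.a q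

theorem Stmt.frame_run (E : Env) (p : Stmt) : ∀ s, Frame p s (p.run E s) := by
  induction p with
  | set x e => 
    intro s
    refine ⟨fun y hy => ?_, fun q _ => rfl⟩
    simp only [Stmt.writes, decide_eq_false_iff_not] at hy
    simp [Stmt.run, Ne.symm hy]
  | put q i e =>
    intro s
    refine ⟨fun y hy => rfl, fun q' h => ?_⟩
    simp only [Stmt.stores, decide_eq_false_iff_not] at h
    simp [Stmt.run, Ne.symm h]
  | seq p q hp hq =>
    intro s
    refine ⟨fun y hy => ?_, fun q' h => ?_⟩
    · simp only [Stmt.writes, Bool.or_eq_false_iff] at hy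
      rw [Stmt.run, (hq _).v y hy.2, (hp _).v y hy.1]
    · simp only [Stmt.stores, Bool.or_eq_false_iff] at h
      rw [Stmt.run, (hq _).a _ h.2, (hp _).a _ h.1]
  | ite o a b p q hp hq =>
    intro s
    refine ⟨fun y hy => ?_, fun q' h => ?_⟩
    · simp only [Stmt.writes, Bool.or_eq_false_iff] at hy
      rw [Stmt.run]
      split
      · rw [(hp _).v y hy.1]; rfl
      · rw [(hq _).v y hy.2]; rfl
    · simp only [Stmt.stores, Bool.or_eq_false_iff] at h
      rw [Stmt.run]
      split
      · rw [(hp _).a _ h.1]; rfl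
      · rw [(hq _).a _ h.2]; rfl
  | skip => exact fun s => ⟨fun _ _ => rfl, fun _ _ => rfl⟩
  | loop x e p hp =>
    intro s
    rw [Stmt.run]
    induction e.eval E s with
    | zero => exact ⟨fun _ _ => rfl, fun _ _ => rfl⟩
    | succ i ih =>
      refine ⟨fun y hy => ?_, fun q' h => ?_⟩
      · have := ih.v y hy
        simp only [Stmt.writes, Bool.or_eq_false_iff, decide_eq_false_iff_not] at hy
        rw [← this]
        refine ((hp _).v y hy.2).trans ?_
        simp [Ne.symm hy.1]
      · rw [← ih.a q' h]
        exact (hp _).a q' h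

/-! ### Compilation -/

/-- The register of a variable. -/
def vreg (x : Var) : ℕ := 3 * x.code
/-- The `j`-th register for loop counters and bounds. -/
def hreg (j : ℕ) : ℕ := 3 * j + 1
/-- The `j`-th register for intermediate results. -/
def treg (j : ℕ) : ℕ := 3 * j + 2

/-- The address `32 * i + q`, where `i` is in the intermediate register `j`. -/
def compAddr (q : Arr) (j : ℕ) : Prog :=
  .seq (.const (treg (j + 1)) 32) <| .seq (.op .mul (treg j) (treg j) (treg (j + 1))) <|
    .seq (.const (treg (j + 1)) q.code) (.op .add (treg j) (treg j) (treg (j + 1)))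

def Ex.comp : Ex → ℕ → Prog
  | .var x, j => .move (treg j) (vreg x)
  | .lit k, j => .const (treg j) k
  | .bin o a b, j => .seq (a.comp j) (.seq (b.comp (j + 1))
      (.op o (treg j) (treg j) (treg (j + 1))))
  | .get q i, j => .seq (i.comp j) (.seq (compAddr q j) (.load (treg j) (treg j)))
  | .inp i, j => .seq (i.comp j) (.read (treg j) (treg j))

def Stmt.comp : Stmt → ℕ → Prog
  | .set x e, _ => .seq (e.comp 0) (.move (vreg x) (treg 0))
  | .put q i e, _ => .seq (e.comp 0) (.seq (i.comp 1) (.seq (compAddr q 1)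
      (.store (treg 1) (treg 0))))
  | .seq p q, d => .seq (p.comp d) (q.comp d)
  | .ite o a b p q, d => .seq (a.comp 0) (.seq (b.comp 1)
      (.cond o (treg 0) (treg 1) (p.comp d) (q.comp d)))
  | .skip, _ => .const (treg 0) 0
  | .loop x e p, d => .seq (e.comp 0) (.seq (.move (hreg (2 * d)) (treg 0))
      (.seq (.const (hreg (2 * d + 1)) 0)
        (.loop .lt (hreg (2 * d + 1)) (hreg (2 * d))
          (.seq (.move (vreg x) (hreg (2 * d + 1))) (.seq (p.comp (d + 1))
            (.seq (.const (treg 0) 1)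
              (.op .add (hreg (2 * d + 1)) (hreg (2 * d + 1)) (treg 0))))))))

/-- The words of `σ` represent the numbers of `s`. -/
structure Rep (E : Env) (s : St) (σ : State E.w) : Prop where
  v : ∀ x, (σ.regs (vreg x)).toNat = s.v x
  a : ∀ q i, i < E.amax → (σ.mem (BitVec.ofNat E.w (32 * i + q.code))).toNat = s.a q i

variable {E : Env} {inp : List (BitVec E.w)}

/-- The environment describes the input and its arrays fit into the memory. -/
structure Env.Fits (E : Env) (inp : List (BitVec E.w)) : Prop where
  amax : 32 * E.amax < 2 ^ E.w
  inp : ∀ i < 2 ^ E.w, (inp.getD i 0).toNat = E.inp i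

theorem Exec.cast {w : ℕ} {inp : List (BitVec w)} {p : Prog} {s s' : State w} {t t' a : ℕ}
    (h : Exec inp p s s' t a) (ht : t = t') : Exec inp p s s' t' a := ht ▸ h

theorem Rep.congr {s s' : St} {σ σ' : State E.w} (h : Rep E s σ)
    (hr : ∀ x, σ'.regs (vreg x) = σ.regs (vreg x)) (hm : σ'.mem = σ.mem)
    (hv : s'.v = s.v) (ha : s'.a = s.a) : Rep E s' σ' :=
  ⟨fun x => by rw [hr, hv, h.v], fun q i hi => by rw [hm, ha, h.a q i hi]⟩

theorem State.setReg_regs {w : ℕ} (σ : State w) (r r' : ℕ) (x : BitVec w) :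
    (σ.setReg r x).regs r' = if r' = r then x else σ.regs r' := by
  simp [State.setReg, Function.update_apply]

theorem compAddr_exec (hE : E.Fits inp) (q : Arr) (j i : ℕ) (hi : i < E.amax) (σ : State E.w)
    (hσ : (σ.regs (treg j)).toNat = i) :
    ∃ σ', Exec inp (compAddr q j) σ σ' 4 0 ∧
      σ'.regs (treg j) = BitVec.ofNat E.w (32 * i + q.code) ∧ σ'.mem = σ.mem ∧
      ∀ r, (∀ j' ≥ j, r ≠ treg j') → σ'.regs r = σ.regs r := by
  have hq := q.code_lt
  have h1 := hE.amax
  have hne : treg j ≠ treg (j + 1) := by simp only [treg]; omega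
  refine ⟨_, (Exec.const _ _ _).seq ((Exec.op _ _ _ _ _).seq
    ((Exec.const _ _ _).seq (Exec.op _ _ _ _ _))), ?_, rfl, fun r hr => ?_⟩
  · simp only [State.setReg_regs, hne, hne.symm, if_true, if_false, BinOp.eval]
    apply BitVec.eq_of_toNat_eq
    simp only [BitVec.toNat_add, BitVec.toNat_mul, BitVec.toNat_ofNat, hσ]
    rw [Nat.mod_eq_of_lt (show 32 < 2 ^ E.w by omega), Nat.mod_eq_of_lt
      (show i * 32 < 2 ^ E.w by omega), Nat.mod_eq_of_lt (show q.code < 2 ^ E.w by omega), mul_comm]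
  · simp [State.setReg_regs, hr j le_rfl, hr (j + 1) (by omega)]

theorem Ex.exec_comp (hE : E.Fits inp) (e : Ex) : ∀ (j : ℕ) (s : St) (σ : State E.w),
    Rep E s σ → e.Ok E s → ∃ σ' a, Exec inp (e.comp j) σ σ' e.cost a ∧ a ≤ 32 * E.amax ∧
      (σ'.regs (treg j)).toNat = e.eval E s ∧ σ'.mem = σ.mem ∧
      ∀ r, (∀ j' ≥ j, r ≠ treg j') → σ'.regs r = σ.regs r := by
  induction e with
  | var x =>
    intro j s σ h _
    refine ⟨_, _, Exec.move _ _ _, by omega, ?_, rfl, fun r hr => ?_⟩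
    · simp [State.setReg_regs, Ex.eval, h.v]
    · simp [State.setReg_regs, hr j le_rfl]
  | lit k =>
    intro j s σ h hk
    refine ⟨_, _, Exec.const _ _ _, by omega, ?_, rfl, fun r hr => ?_⟩
    · simp [State.setReg_regs, Ex.eval, Nat.mod_eq_of_lt (show k < 2 ^ E.w from hk)]
    · simp [State.setReg_regs, hr j le_rfl]
  | bin o a b iha ihb =>
    intro j s σ h ⟨oka, okb, oko⟩
    obtain ⟨σ₁, a₁, e₁, l₁, v₁, m₁, f₁⟩ := iha j s σ h oka
    have h' : Rep E s σ₁ := h.congr (fun x => f₁ _ fun j' _ => by simp only [vreg, treg]; omega)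
      m₁ rfl rfl
    obtain ⟨σ₂, a₂, e₂, l₂, v₂, m₂, f₂⟩ := ihb (j + 1) s σ₁ h' okb
    have hx : σ₂.regs (treg j) = σ₁.regs (treg j) :=
      f₂ _ fun j' hj => by simp only [treg]; omega
    refine ⟨_, _, (e₁.seq (e₂.seq (Exec.op o _ _ _ _))).cast (by rw [Ex.cost, add_assoc]),
      by simp [l₁, l₂], ?_, m₂.trans m₁, fun r hr => ?_⟩
    · rw [State.setReg_regs, if_pos rfl, BinOp.toNat_eval, hx, v₁, v₂]
      · rfl
      · rw [hx, v₁, v₂]; exact oko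
    · rw [State.setReg_regs, if_neg (hr j le_rfl), f₂ r fun j' hj => hr j' (by omega), f₁ r hr]
  | get q i ih =>
    intro j s σ h ⟨oki, hi⟩
    obtain ⟨σ₁, a₁, e₁, l₁, v₁, m₁, f₁⟩ := ih j s σ h oki
    obtain ⟨σ₂, e₂, v₂, m₂, f₂⟩ := compAddr_exec hE q j _ hi σ₁ v₁
    have hq := q.code_lt
    have hm := hE.amax
    refine ⟨_, _, (e₁.seq (e₂.seq (Exec.load (treg j) (treg j) _))).cast (by rw [Ex.cost]),
      ?_, ?_, m₂.trans m₁, fun r hr => ?_⟩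
    · rw [v₂, BitVec.toNat_ofNat, Nat.mod_eq_of_lt (by omega)]
      simp only [Nat.zero_max, max_le_iff]
      omega
    · rw [State.setReg_regs, if_pos rfl, v₂, m₂, m₁, h.a q _ hi, Ex.eval]
    · rw [State.setReg_regs, if_neg (hr j le_rfl), f₂ r hr, f₁ r hr]
  | inp i ih =>
    intro j s σ h oki
    obtain ⟨σ₁, a₁, e₁, l₁, v₁, m₁, f₁⟩ := ih j s σ h oki
    refine ⟨_, _, e₁.seq (Exec.read (treg j) (treg j) _), by simpa using l₁, ?_, m₁,
      fun r hr => ?_⟩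
    · rw [State.setReg_regs, if_pos rfl, v₁, Ex.eval, hE.inp]
      rw [← v₁]; exact BitVec.isLt _
    · rw [State.setReg_regs, if_neg (hr j le_rfl), f₁ r hr]

theorem Rep.of_exec {s : St} {σ σ' : State E.w} {j : ℕ} (h : Rep E s σ) (hm : σ'.mem = σ.mem)
    (hf : ∀ r, (∀ j' ≥ j, r ≠ treg j') → σ'.regs r = σ.regs r) : Rep E s σ' :=
  h.congr (fun x => hf _ fun j' _ => by simp only [vreg, treg]; omega) hm rfl rfl

theorem Rep.set {s : St} {σ : State E.w} (h : Rep E s σ) (x : Var) (k : BitVec E.w) :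
    Rep E (s.set x k.toNat) (σ.setReg (vreg x) k) := by
  refine ⟨fun y => ?_, h.a⟩
  have : vreg y = vreg x ↔ y = x := by
    rw [← Var.code_injective.eq_iff]; simp only [vreg]; omega
  simp only [State.setReg_regs, St.set_v, this]
  split
  · rfl
  · exact h.v y

theorem Rep.tick {s : St} {σ : State E.w} (h : Rep E s σ) (k : ℕ) : Rep E (s.tick k) σ :=
  ⟨h.v, h.a⟩

theorem Rep.put (hE : E.Fits inp) {s : St} {σ : State E.w} (h : Rep E s σ) (q : Arr) (i : ℕ)
    (hi : i < E.amax) (k : BitVec E.w) :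
    Rep E (s.put q i k.toNat) (σ.setMem (BitVec.ofNat E.w (32 * i + q.code)) k) := by
  refine ⟨h.v, fun q' i' hi' => ?_⟩
  have h1 := q.code_lt
  have h2 := q'.code_lt
  have h3 := hE.amax
  have : BitVec.ofNat E.w (32 * i' + q'.code) = BitVec.ofNat E.w (32 * i + q.code) ↔
      q' = q ∧ i' = i := by
    rw [← BitVec.toNat_inj, BitVec.toNat_ofNat, BitVec.toNat_ofNat, Nat.mod_eq_of_lt (by omega),
      Nat.mod_eq_of_lt (by omega), ← Arr.code_injective.eq_iff]
    omega
  simp only [State.setMem, Function.update_apply, St.put_a, this]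
  split
  · rfl
  · exact h.a q' i' hi'

/-- The hidden registers of the enclosing loops and, if there are no stores, the memory stay
the same. -/
structure Keeps (p : Stmt) (d : ℕ) {w : ℕ} (σ σ' : State w) : Prop where
  regs : ∀ j < 2 * d, σ'.regs (hreg j) = σ.regs (hreg j)
  mem : (∀ q, p.stores q = false) → σ'.mem = σ.mem

theorem hreg_ne_treg (j j' : ℕ) : hreg j ≠ treg j' := by simp only [hreg, treg]; omega
theorem hreg_ne_vreg (j : ℕ) (x : Var) : hreg j ≠ vreg x := by simp only [hreg, vreg]; omega
theorem treg_ne_vreg (j : ℕ) (x : Var) : treg j ≠ vreg x := by simp only [treg, vreg]; omega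

theorem Stmt.exec_comp (hE : E.Fits inp) (p : Stmt) : ∀ (d : ℕ) (s : St) (σ : State E.w),
    Rep E s σ → p.Ok E s → ∃ σ' t a, Exec inp (p.comp d) σ σ' t a ∧ a ≤ 32 * E.amax ∧
      Rep E (p.run E s) σ' ∧ (p.run E s).t = s.t + t ∧ Keeps p d σ σ' := by
  induction p with
  | set x e =>
    intro d s σ h ok
    obtain ⟨σ₁, a₁, e₁, l₁, v₁, m₁, f₁⟩ := e.exec_comp hE 0 s σ h ok
    refine ⟨_, _, _, e₁.seq (Exec.move _ _ _), by simpa using l₁, ?_, rfl, fun j _ => ?_, fun _ => m₁⟩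
    · have := ((h.of_exec m₁ f₁).set x (σ₁.regs (treg 0))).tick (e.cost + 1)
      rwa [v₁] at this
    · rw [State.setReg_regs, if_neg (hreg_ne_vreg _ _), f₁ _ fun _ _ => hreg_ne_treg _ _]
  | put q i e =>
    intro d s σ h ⟨oki, oke, hi⟩
    obtain ⟨σ₁, a₁, e₁, l₁, v₁, m₁, f₁⟩ := e.exec_comp hE 0 s σ h oke
    have h₁ := h.of_exec m₁ f₁
    obtain ⟨σ₂, a₂, e₂, l₂, v₂, m₂, f₂⟩ := i.exec_comp hE 1 s σ₁ h₁ oki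
    have h₂ := h₁.of_exec m₂ f₂
    obtain ⟨σ₃, e₃, v₃, m₃, f₃⟩ := compAddr_exec hE q 1 _ hi σ₂ v₂
    have h₃ := h₂.of_exec m₃ f₃
    have h0 : σ₃.regs (treg 0) = σ₁.regs (treg 0) := by
      rw [f₃ _ fun j' hj => by simp only [treg]; omega, f₂ _ fun j' hj => by simp only [treg]; omega]
    have hq := q.code_lt
    have hm := hE.amax
    refine ⟨_, _, _, e₁.seq (e₂.seq (e₃.seq (Exec.store _ _ _))), ?_, ?_, ?_, fun j _ => ?_, fun hs => ?_⟩
    · rw [v₃, BitVec.toNat_ofNat, Nat.mod_eq_of_lt (by omega)]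
      simp only [Nat.zero_max, max_le_iff]
      omega
    · have := (h₃.put hE q _ hi (σ₃.regs (treg 0))).tick (i.cost + e.cost + 5)
      rw [h0, v₁] at this
      rw [v₃, h0]
      exact this
    · simp only [Stmt.run, St.tick_t, St.put_t]; omega
    · simp only [State.setMem]
      rw [f₃ _ fun _ _ => hreg_ne_treg _ _, f₂ _ fun _ _ => hreg_ne_treg _ _,
        f₁ _ fun _ _ => hreg_ne_treg _ _]
    · simpa [Stmt.stores] using hs q
  | seq p q hp hq =>
    intro d s σ h ⟨okp, okq⟩
    obtain ⟨σ₁, t₁, a₁, e₁, l₁, h₁, c₁, k₁⟩ := hp d s σ h okp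
    obtain ⟨σ₂, t₂, a₂, e₂, l₂, h₂, c₂, k₂⟩ := hq d _ σ₁ h₁ okq
    refine ⟨_, _, _, e₁.seq e₂, by simp [l₁, l₂], h₂, ?_, fun j hj => ?_, fun hs => ?_⟩
    · rw [Stmt.run, c₂, c₁, add_assoc]
    · rw [k₂.regs j hj, k₁.regs j hj]
    · simp only [Stmt.stores, Bool.or_eq_false_iff] at hs
      rw [k₂.mem fun q => (hs q).2, k₁.mem fun q => (hs q).1]
  | ite o a b p q hp hq =>
    intro d s σ h ⟨oka, okb, okpq⟩
    obtain ⟨σ₁, a₁, e₁, l₁, v₁, m₁, f₁⟩ := a.exec_comp hE 0 s σ h oka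
    have h₁ := h.of_exec m₁ f₁
    obtain ⟨σ₂, a₂, e₂, l₂, v₂, m₂, f₂⟩ := b.exec_comp hE 1 s σ₁ h₁ okb
    have h₂ := (h₁.of_exec m₂ f₂).tick (a.cost + b.cost + 1)
    have h0 : σ₂.regs (treg 0) = σ₁.regs (treg 0) :=
      f₂ _ fun j' hj => by simp only [treg]; omega
    have hh : ∀ j, σ₂.regs (hreg j) = σ.regs (hreg j) := fun j => by
      rw [f₂ _ fun _ _ => hreg_ne_treg _ _, f₁ _ fun _ _ => hreg_ne_treg _ _]
    have hc : o.Holds (σ₂.regs (treg 0)) (σ₂.regs (treg 1)) ↔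
        o.nat (a.eval E s) (b.eval E s) := by rw [Cmp.holds_iff, h0, v₁, v₂]
    rw [Stmt.run]
    split at okpq <;> rename_i hcond
    · obtain ⟨σ₃, t₃, a₃, e₃, l₃, h₃, c₃, k₃⟩ := hp d _ σ₂ h₂ okpq
      rw [if_pos hcond]
      refine ⟨_, _, _, e₁.seq (e₂.seq (Exec.cond_true (hc.2 hcond) e₃)), by simp [l₁, l₂, l₃], h₃,
        ?_, fun j hj => ?_, fun hs => ?_⟩
      · rw [c₃, St.tick_t]; omega
      · rw [k₃.regs j hj, hh]
      · simp only [Stmt.stores, Bool.or_eq_false_iff] at hs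
        rw [k₃.mem fun q => (hs q).1, m₂, m₁]
    · obtain ⟨σ₃, t₃, a₃, e₃, l₃, h₃, c₃, k₃⟩ := hq d _ σ₂ h₂ okpq
      rw [if_neg hcond]
      refine ⟨_, _, _, e₁.seq (e₂.seq (Exec.cond_false (hc.not.2 hcond) e₃)), by simp [l₁, l₂, l₃], h₃,
        ?_, fun j hj => ?_, fun hs => ?_⟩
      · rw [c₃, St.tick_t]; omega
      · rw [k₃.regs j hj, hh]
      · simp only [Stmt.stores, Bool.or_eq_false_iff] at hs
        rw [k₃.mem fun q => (hs q).2, m₂, m₁]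
  | skip =>
    intro d s σ h _
    refine ⟨_, _, _, Exec.const _ _ _, by omega, h.congr (fun x => ?_) rfl rfl rfl,
      rfl, fun j _ => ?_, fun _ => rfl⟩
    · rw [State.setReg_regs, if_neg (treg_ne_vreg _ _).symm]
    · rw [State.setReg_regs, if_neg (hreg_ne_treg _ _)]
  | loop x e p hp =>
    intro d s σ h ⟨oke, okp⟩
    obtain ⟨σ₁, a₁, e₁, l₁, v₁, m₁, f₁⟩ := e.exec_comp hE 0 s σ h oke
    have h₁ := h.of_exec m₁ f₁
    have hlt : e.eval E s < 2 ^ E.w := v₁ ▸ BitVec.isLt _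
    have hne : hreg (2 * d) ≠ hreg (2 * d + 1) := by simp only [hreg]; omega
    have key : ∀ (k i : ℕ), i + k = e.eval E s → ∀ τ : State E.w,
        Rep E (Nat.rec (s.tick (e.cost + 3)) (fun i s' => p.run E ((s'.set x i).tick 4)) i) τ →
        (τ.regs (hreg (2 * d))).toNat = e.eval E s → (τ.regs (hreg (2 * d + 1))).toNat = i →
        ∃ σ' t a, Exec inp (.loop .lt (hreg (2 * d + 1)) (hreg (2 * d))
          (.seq (.move (vreg x) (hreg (2 * d + 1))) (.seq (p.comp (d + 1))
            (.seq (.const (treg 0) 1)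
              (.op .add (hreg (2 * d + 1)) (hreg (2 * d + 1)) (treg 0)))))) τ σ' t a ∧
          a ≤ 32 * E.amax ∧ Rep E (Stmt.run E (.loop x e p) s) σ' ∧
          (Stmt.run E (.loop x e p) s).t + 1 = (Nat.rec (s.tick (e.cost + 3))
            (fun i s' => p.run E ((s'.set x i).tick 4)) i : St).t + t ∧
          Keeps p d τ σ' := by
      intro k
      induction k with
      | zero =>
        intro i hi τ hτ hb hc
        refine ⟨τ, _, _, Exec.loop_exit ?_, by omega, ?_, ?_, fun _ _ => rfl, fun _ => rfl⟩
        · simp only [Cmp.Holds]; omega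
        · rw [Stmt.run, ← hi]; exact hτ
        · rw [Stmt.run, ← hi]; rfl
      | succ k ih =>
        intro i hi τ hτ hb hc
        have hτ' := (hτ.set x (τ.regs (hreg (2 * d + 1)))).tick 4
        rw [hc] at hτ'
        obtain ⟨τ₁, t₁, a₁, e₁, l₁, h₁, c₁, k₁⟩ := hp (d + 1) _ _ hτ' (okp i (by omega))
        have g₁ := k₁.regs (2 * d) (by omega)
        have g₂ := k₁.regs (2 * d + 1) (by omega)
        rw [State.setReg_regs, if_neg (hreg_ne_vreg _ _)] at g₁ g₂
        have hw : 1 < 2 ^ E.w := by omega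
        obtain ⟨σ', t', a', e', l', h', c', k'⟩ := ih (i + 1) (by omega)
          ((τ₁.setReg (treg 0) (BitVec.ofNat _ 1)).setReg (hreg (2 * d + 1))
            (BinOp.eval .add ((τ₁.setReg (treg 0) (BitVec.ofNat _ 1)).regs (hreg (2 * d + 1)))
              ((τ₁.setReg (treg 0) (BitVec.ofNat _ 1)).regs (treg 0))))
          (h₁.congr (fun x => by
            rw [State.setReg_regs, if_neg (hreg_ne_vreg _ _).symm, State.setReg_regs,
              if_neg (treg_ne_vreg _ _).symm]) rfl rfl rfl)
          (by rw [State.setReg_regs, if_neg hne, State.setReg_regs, if_neg (hreg_ne_treg _ _), g₁, hb])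
          (by
            rw [State.setReg_regs, if_pos rfl, State.setReg_regs, if_neg (hreg_ne_treg _ _),
              State.setReg_regs, if_pos rfl, g₂, BinOp.toNat_eval]
            · simp only [BinOp.nat, hc, BitVec.toNat_ofNat]
              rw [Nat.mod_eq_of_lt hw]
            · simp only [BinOp.Ok, hc, BitVec.toNat_ofNat]
              rw [Nat.mod_eq_of_lt hw]; omega)
        refine ⟨σ', _, _, Exec.loop_step ?_ ((Exec.move _ _ _).seq (e₁.seq
          ((Exec.const _ _ _).seq (Exec.op _ _ _ _ _)))) e', ?_, h', ?_, fun j hj => ?_, fun hs => ?_⟩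
        · simp only [Cmp.Holds]; omega
        · simp only [Nat.zero_max, Nat.max_zero, max_le_iff]
          exact ⟨l₁, l'⟩
        · rw [c', c₁]
          simp only [St.tick_t, St.set_t]
          omega
        · have hj' : hreg j ≠ hreg (2 * d + 1) := by simp only [hreg]; omega
          rw [k'.regs j hj, State.setReg_regs, if_neg hj', State.setReg_regs,
            if_neg (hreg_ne_treg _ _), k₁.regs j (by omega), State.setReg_regs,
            if_neg (hreg_ne_vreg _ _)]
        · rw [k'.mem hs]
          exact k₁.mem hs
    obtain ⟨σ', t', a', e', l', h', c', k'⟩ := key (e.eval E s) 0 (by omega)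
      ((σ₁.setReg (hreg (2 * d)) (σ₁.regs (treg 0))).setReg (hreg (2 * d + 1)) (BitVec.ofNat _ 0))
      (h₁.congr (fun x => by
        rw [State.setReg_regs, if_neg (hreg_ne_vreg _ _).symm, State.setReg_regs,
          if_neg (hreg_ne_vreg _ _).symm]) rfl rfl rfl)
      (by rw [State.setReg_regs, if_neg hne, State.setReg_regs, if_pos rfl, v₁])
      (by rw [State.setReg_regs, if_pos rfl]; simp)
    refine ⟨σ', _, _, e₁.seq ((Exec.move _ _ _).seq ((Exec.const _ _ _).seq e')), ?_, h', ?_,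
      fun j hj => ?_, fun hs => ?_⟩
    · simp only [Nat.zero_max, max_le_iff]; exact ⟨l₁, l'⟩
    · change _ = s.t + (e.cost + 3) + t' at c'
      omega
    · have hj' : hreg j ≠ hreg (2 * d + 1) := by simp only [hreg]; omega
      have hj'' : hreg j ≠ hreg (2 * d) := by simp only [hreg]; omega
      rw [k'.regs j hj, State.setReg_regs, if_neg hj', State.setReg_regs, if_neg hj'',
        f₁ _ fun _ _ => hreg_ne_treg _ _]
    · rw [k'.mem hs]; exact m₁

end WordRAM

namespace WordRAM

infixr:30 " ;; " => Stmt.seq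

instance : Coe Var Ex := ⟨Ex.var⟩
instance (k : ℕ) : OfNat Ex k := ⟨Ex.lit k⟩
instance : Add Ex := ⟨Ex.bin .add⟩
instance : Sub Ex := ⟨Ex.bin .sub⟩
instance : Mul Ex := ⟨Ex.bin .mul⟩
instance : Div Ex := ⟨Ex.bin .div⟩

namespace Ex

/-- Shift to the left. -/
abbrev shl (a b : Ex) : Ex := .bin .shl a b
/-- Shift to the right. -/
abbrev shr (a b : Ex) : Ex := .bin .shr a b
/-- Bitwise exclusive or. -/
abbrev xor (a b : Ex) : Ex := .bin .xor a b

variable (E : Env) (s : St) (a b i : Ex) (x : Var) (k : ℕ) (q : Arr)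

@[simp] theorem eval_var : (Ex.var x).eval E s = s.v x := rfl
@[simp] theorem eval_ofNat : (no_index (OfNat.ofNat k) : Ex).eval E s = OfNat.ofNat k := rfl
@[simp] theorem eval_add : (a + b).eval E s = a.eval E s + b.eval E s := rfl
@[simp] theorem eval_sub : (a - b).eval E s = a.eval E s - b.eval E s := rfl
@[simp] theorem eval_mul : (a * b).eval E s = a.eval E s * b.eval E s := rfl
@[simp] theorem eval_div : (a / b).eval E s = a.eval E s / b.eval E s := rfl
@[simp] theorem eval_shl : (bin .shl a b).eval E s = a.eval E s * 2 ^ b.eval E s := rfl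
@[simp] theorem eval_shr : (bin .shr a b).eval E s = a.eval E s / 2 ^ b.eval E s := rfl
@[simp] theorem eval_xor : (bin .xor a b).eval E s = a.eval E s ^^^ b.eval E s := rfl
@[simp] theorem eval_get : (get q i).eval E s = s.a q (i.eval E s) := rfl
@[simp] theorem eval_inp : (inp i).eval E s = E.inp (i.eval E s) := rfl

@[simp] theorem ok_var : (Ex.var x).Ok E s ↔ True := Iff.rfl
@[simp] theorem ok_ofNat : (no_index (OfNat.ofNat k) : Ex).Ok E s ↔ OfNat.ofNat k < 2 ^ E.w := Iff.rfl
@[simp] theorem ok_add : (a + b).Ok E s ↔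
  a.Ok E s ∧ b.Ok E s ∧ a.eval E s + b.eval E s < 2 ^ E.w := Iff.rfl
@[simp] theorem ok_sub : (a - b).Ok E s ↔
  a.Ok E s ∧ b.Ok E s ∧ b.eval E s ≤ a.eval E s := Iff.rfl
@[simp] theorem ok_mul : (a * b).Ok E s ↔
  a.Ok E s ∧ b.Ok E s ∧ a.eval E s * b.eval E s < 2 ^ E.w := Iff.rfl
@[simp] theorem ok_div : (a / b).Ok E s ↔ a.Ok E s ∧ b.Ok E s ∧ True := Iff.rfl
@[simp] theorem ok_shl : (bin .shl a b).Ok E s ↔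
  a.Ok E s ∧ b.Ok E s ∧ a.eval E s * 2 ^ b.eval E s < 2 ^ E.w := Iff.rfl
@[simp] theorem ok_shr : (bin .shr a b).Ok E s ↔ a.Ok E s ∧ b.Ok E s ∧ True := Iff.rfl
@[simp] theorem ok_xor : (bin .xor a b).Ok E s ↔ a.Ok E s ∧ b.Ok E s ∧ True := Iff.rfl
@[simp] theorem ok_get : (get q i).Ok E s ↔ i.Ok E s ∧ i.eval E s < E.amax := Iff.rfl
@[simp] theorem ok_inp : (inp i).Ok E s ↔ i.Ok E s := Iff.rfl

@[simp] theorem cost_var : (Ex.var x).cost = 1 := rfl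
@[simp] theorem cost_ofNat : (no_index (OfNat.ofNat k) : Ex).cost = 1 := rfl
@[simp] theorem cost_add : (a + b).cost = a.cost + b.cost + 1 := rfl
@[simp] theorem cost_sub : (a - b).cost = a.cost + b.cost + 1 := rfl
@[simp] theorem cost_mul : (a * b).cost = a.cost + b.cost + 1 := rfl
@[simp] theorem cost_div : (a / b).cost = a.cost + b.cost + 1 := rfl
@[simp] theorem cost_bin (o : BinOp) : (bin o a b).cost = a.cost + b.cost + 1 := rfl
@[simp] theorem cost_get : (get q i).cost = i.cost + 5 := rfl
@[simp] theorem cost_inp : (inp i).cost = i.cost + 1 := rfl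

end Ex

attribute [simp] Cmp.nat

/-- From the state `s`, the statement `p` runs without overflow to a state that satisfies `Q`. -/
def wp (E : Env) (p : Stmt) (s : St) (Q : St → Prop) : Prop := p.Ok E s ∧ Q (p.run E s)

section
variable {E : Env} {s : St} {Q : St → Prop}

@[simp] theorem wp_set {x : Var} {e : Ex} :
    wp E (.set x e) s Q ↔ e.Ok E s ∧ Q ((s.set x (e.eval E s)).tick (e.cost + 1)) := Iff.rfl

@[simp] theorem wp_put {q : Arr} {i e : Ex} :
    wp E (.put q i e) s Q ↔ (i.Ok E s ∧ e.Ok E s ∧ i.eval E s < E.amax) ∧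
      Q ((s.put q (i.eval E s) (e.eval E s)).tick (i.cost + e.cost + 5)) := Iff.rfl

@[simp] theorem wp_skip : wp E .skip s Q ↔ Q (s.tick 1) := by simp [wp, Stmt.Ok, Stmt.run]

@[simp] theorem wp_seq {p q : Stmt} : wp E (p ;; q) s Q ↔ wp E p s fun s' => wp E q s' Q := by
  simp [wp, Stmt.Ok, Stmt.run, and_assoc]

theorem wp_ite {o : Cmp} {a b : Ex} {p q : Stmt} (ha : a.Ok E s) (hb : b.Ok E s)
    (hp : o.nat (a.eval E s) (b.eval E s) → wp E p (s.tick (a.cost + b.cost + 1)) Q)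
    (hq : ¬ o.nat (a.eval E s) (b.eval E s) → wp E q (s.tick (a.cost + b.cost + 1)) Q) :
    wp E (.ite o a b p q) s Q := by
  unfold wp
  rw [Stmt.Ok, Stmt.run]
  split
  · exact ⟨⟨ha, hb, (hp ‹_›).1⟩, (hp ‹_›).2⟩
  · exact ⟨⟨ha, hb, (hq ‹_›).1⟩, (hq ‹_›).2⟩

theorem wp.mono {p : Stmt} {Q' : St → Prop} (h : wp E p s Q)
    (hQ : ∀ s', Frame p s s' → Q s' → Q' s') : wp E p s Q' :=
  ⟨h.1, hQ _ (p.frame_run E s) h.2⟩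

theorem wp_loop {x : Var} {e : Ex} {p : Stmt} (I : ℕ → St → Prop) (he : e.Ok E s)
    (h0 : I 0 (s.tick (e.cost + 3)))
    (hstep : ∀ i < e.eval E s, ∀ s', Frame (.loop x e p) s s' → I i s' →
      wp E p ((s'.set x i).tick 4) (I (i + 1)))
    (hQ : ∀ s', Frame (.loop x e p) s s' → I (e.eval E s) s' → Q s') :
    wp E (.loop x e p) s Q := by
  have key : ∀ i ≤ e.eval E s,
      I i (Nat.rec (s.tick (e.cost + 3)) (fun i s' => p.run E ((s'.set x i).tick 4)) i) ∧
      Frame (.loop x e p) s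
        (Nat.rec (s.tick (e.cost + 3)) (fun i s' => p.run E ((s'.set x i).tick 4)) i) := by
    intro i
    induction i with
    | zero => exact fun _ => ⟨h0, fun _ _ => rfl, fun _ _ => rfl⟩
    | succ i ih =>
      intro hi
      obtain ⟨h1, h2⟩ := ih (by omega)
      refine ⟨(hstep i (by omega) _ h2 h1).2, ?_⟩
      have h3 := p.frame_run E (((Nat.rec (s.tick (e.cost + 3))
        (fun i s' => p.run E ((s'.set x i).tick 4)) i : St).set x i).tick 4)
      refine ⟨fun y hy => ?_, fun q hq => (h3.a q hq).trans (h2.a q hq)⟩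
      have hy' := hy
      simp only [Stmt.writes, Bool.or_eq_false_iff, decide_eq_false_iff_not] at hy'
      refine (h3.v y hy'.2).trans (Eq.trans ?_ (h2.v y hy))
      simp [Ne.symm hy'.1]
  refine ⟨⟨he, fun i hi => ?_⟩, hQ _ (key _ le_rfl).2 (key _ le_rfl).1⟩
  obtain ⟨h1, h2⟩ := key i hi.le
  exact (hstep i hi _ h2 h1).1

end

/-- The words are wide enough for small constants and for the addresses. -/
structure Env.Wide (E : Env) : Prop where
  bits : 8 ≤ E.w
  pow : 256 ≤ 2 ^ E.w
  amax : 32 * E.amax < 2 ^ E.w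

open Var in
/-- Binary search: with `J` rounds, find the first index in `[l, h)` at which `ps` is at least
`tau - bu`. -/
def bsearch (J : Ex) : Stmt :=
  .loop x J <| .ite .lt l h
    (.set mid ((l + h : Ex) / 2) ;;
      .ite .lt (.get .ps mid + bu) tau (.set l (mid + 1)) (.set h mid)) .skip

theorem bsearch_spec {E : Env} {s : St} {J : Ex} (r : ℕ) (hJ : J.Ok E s)
    (hE : E.Wide) (hlr : s.v .l ≤ r) (hrh : r ≤ s.v .h)
    (hcut : ∀ i, s.v .l ≤ i → i < s.v .h → (s.a .ps i + s.v .bu < s.v .tau ↔ i < r))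
    (hlen : s.v .h < s.v .l + 2 ^ J.eval E s) (hh : s.v .h < E.amax)
    (hps : ∀ i, s.v .l ≤ i → i < s.v .h → s.a .ps i + s.v .bu < 2 ^ E.w) :
    wp E (bsearch J) s fun s' => s'.v .l = r ∧ s'.t ≤ s.t + J.cost + 3 + 30 * J.eval E s := by
  obtain ⟨w1, w2, w3⟩ := hE
  refine wp_loop (fun i s' => s.v .l ≤ s'.v .l ∧ s'.v .l ≤ r ∧ r ≤ s'.v .h ∧ s'.v .h ≤ s.v .h ∧
    s'.v .h < s'.v .l + 2 ^ (J.eval E s - i) ∧ s'.t ≤ s.t + J.cost + 3 + 30 * i) hJ ?_ ?_ ?_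
  · simp [hlr, hrh, hlen]; omega
  · intro i hi s' hf ⟨h1, h2, h3, h4, h5, h6⟩
    have eps : s'.a .ps = s.a .ps := hf.a _ rfl
    have ebu : s'.v .bu = s.v .bu := hf.v _ rfl
    have etau : s'.v .tau = s.v .tau := hf.v _ rfl
    have hpow : 2 ^ (J.eval E s - i) = 2 * 2 ^ (J.eval E s - (i + 1)) := by
      rw [← pow_succ']; congr 1; omega
    have hpos : 0 < 2 ^ (J.eval E s - (i + 1)) := by positivity
    refine wp_ite (by simp) (by simp) (fun hc => ?_) (fun hc => ?_)
    · simp at hc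
      have hc1 := hcut ((s'.v .l + s'.v .h) / 2) (by omega) (by omega)
      have hc2 := hps ((s'.v .l + s'.v .h) / 2) (by omega) (by omega)
      simp only [wp_seq, wp_set]
      refine ⟨by simp; omega, wp_ite ?_ ?_ (fun hd => ?_) (fun hd => ?_)⟩
      · simp [eps, ebu]; omega
      · simp
      · simp [eps, ebu, etau] at hd ⊢; omega
      · simp [eps, ebu, etau] at hd ⊢; omega
    · simp at hc ⊢; omega
  · intro s' hf ⟨h1, h2, h3, h4, h5, h6⟩
    simp at h5
    exact ⟨by omega, h6⟩

end WordRAM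

namespace WordRAM

/-! ### Sums over aligned blocks of leaves -/

/-- The sum of `ω` over the aligned block of `2 ^ t` numbers below `2 ^ m` that contains `y`. -/
def blk (m : ℕ) (ω : ℕ → ℕ) (t y : ℕ) : ℕ :=
  ∑ y' ∈ Finset.range (2 ^ m) with y' / 2 ^ t = y / 2 ^ t, ω y'

/-- The sum of `ω` over the numbers below `2 ^ m`. -/
def total (m : ℕ) (ω : ℕ → ℕ) : ℕ := ∑ y ∈ Finset.range (2 ^ m), ω y

section
variable {m : ℕ} {ω : ℕ → ℕ} {t y : ℕ}

theorem blk_zero (hy : y < 2 ^ m) : blk m ω 0 y = ω y := by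
  simp [blk, hy]

theorem blk_top (hy : y < 2 ^ m) : blk m ω m y = total m ω := by
  unfold blk total
  rw [Finset.filter_true_of_mem]
  intro z hz
  rw [Nat.div_eq_of_lt hy, Nat.div_eq_of_lt (Finset.mem_range.1 hz)]

theorem blk_le_total : blk m ω t y ≤ total m ω :=
  Finset.sum_le_sum_of_subset (Finset.filter_subset _ _)

theorem div_two_eq_iff (a b : ℕ) : a / 2 = b / 2 ↔ a = b ∨ a = b ^^^ 1 := by
  have h1 : (b ^^^ 1) / 2 = b / 2 := by rw [Nat.xor_div_two]; simp
  have h2 : (b ^^^ 1) % 2 = (b + 1) % 2 := by rw [Nat.xor_mod_two_eq]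
  omega

theorem xor_two_pow_div (y t : ℕ) : (y ^^^ 2 ^ t) / 2 ^ t = (y / 2 ^ t) ^^^ 1 := by
  rw [← Nat.shiftRight_eq_div_pow, Nat.shiftRight_xor_distrib, Nat.shiftRight_eq_div_pow,
    Nat.shiftRight_eq_div_pow, Nat.div_self (by positivity)]

theorem blk_succ : blk m ω (t + 1) y = blk m ω t y + blk m ω t (y ^^^ 2 ^ t) := by
  unfold blk
  rw [← Finset.sum_union]
  · congr 1
    ext z
    simp only [Finset.mem_filter, Finset.mem_union, xor_two_pow_div, pow_succ, ← Nat.div_div_eq_div_mul,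
      div_two_eq_iff]
    tauto
  · rw [Finset.disjoint_left]
    intro z hz hz'
    simp only [Finset.mem_filter, xor_two_pow_div] at hz hz'
    have h2 : (y / 2 ^ t ^^^ 1) % 2 = (y / 2 ^ t + 1) % 2 := by rw [Nat.xor_mod_two_eq]
    omega

theorem blk_one : t ≤ m → y < 2 ^ m → blk m (fun _ => 1) t y = 2 ^ t := by
  induction t generalizing y with
  | zero => intro _ hy; rw [blk_zero hy, pow_zero]
  | succ t ih =>
    intro ht hy
    rw [blk_succ, ih (by omega) hy, ih (by omega)
      (Nat.xor_lt_two_pow hy (Nat.pow_lt_pow_right (by norm_num) (by omega))), pow_succ]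
    ring

theorem blk_update {k : ℕ} {y' : ℕ} (hy : y < 2 ^ m) : blk m (Function.update ω y (ω y + k)) t y' =
    blk m ω t y' + if y' / 2 ^ t = y / 2 ^ t then k else 0 := by
  unfold blk
  have : ∀ z, Function.update ω y (ω y + k) z = ω z + if z = y then k else 0 := by
    intro z; by_cases h : z = y
    · subst h; simp
    · simp [h]
  simp only [this, Finset.sum_add_distrib]
  congr 1
  simp only [Finset.sum_filter, ← ite_and]
  rw [Finset.sum_eq_single y]
  · simp [eq_comm]
  · intro b _ hb; simp [hb]
  · intro h; simp [hy] at h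

theorem total_update {k : ℕ} (hy : y < 2 ^ m) :
    total m (Function.update ω y (ω y + k)) = total m ω + k := by
  rw [← blk_top hy, blk_update hy, blk_top hy]; simp

theorem node_eq (ht : t ≤ m) : (2 ^ m + y) / 2 ^ t = 2 ^ (m - t) + y / 2 ^ t := by
  rw [← Nat.sub_add_cancel ht, pow_add, Nat.sub_add_cancel ht, Nat.add_comm,
    Nat.add_mul_div_right _ _ (by positivity), Nat.add_comm]

theorem node_lt (hy : y < 2 ^ m) : (2 ^ m + y) / 2 ^ t < 2 ^ (m + 1) := by
  refine (Nat.div_le_self _ _).trans_lt ?_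
  rw [pow_succ]; omega

theorem div_lt_two_pow_sub (ht : t ≤ m) (hy : y < 2 ^ m) : y / 2 ^ t < 2 ^ (m - t) := by
  rw [Nat.div_lt_iff_lt_mul (by positivity), ← pow_add, Nat.sub_add_cancel ht]; exact hy

theorem pow_add_inj {a b x y : ℕ} (hx : x < 2 ^ a) (hy : y < 2 ^ b) (h : 2 ^ a + x = 2 ^ b + y) :
    a = b ∧ x = y := by
  have : a = b := by
    rcases lt_trichotomy a b with h' | h' | h'
    · have := Nat.pow_le_pow_right (n := 2) (by norm_num) (Nat.succ_le_of_lt h')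
      rw [Nat.succ_eq_add_one, pow_succ] at this; omega
    · exact h'
    · have := Nat.pow_le_pow_right (n := 2) (by norm_num) (Nat.succ_le_of_lt h')
      rw [Nat.succ_eq_add_one, pow_succ] at this; omega
  subst this
  exact ⟨rfl, by omega⟩

theorem node_inj {t' y' : ℕ} (ht : t ≤ m) (ht' : t' ≤ m) (hy : y < 2 ^ m) (hy' : y' < 2 ^ m) :
    (2 ^ m + y) / 2 ^ t = (2 ^ m + y') / 2 ^ t' ↔ t = t' ∧ y / 2 ^ t = y' / 2 ^ t' := by
  rw [node_eq ht, node_eq ht']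
  constructor
  · intro h
    obtain ⟨h1, h2⟩ := pow_add_inj (div_lt_two_pow_sub ht hy) (div_lt_two_pow_sub ht' hy') h
    exact ⟨by omega, h2⟩
  · rintro ⟨rfl, h⟩
    rw [h]

end

/-- The array `W` holds the sums of `ω` over aligned blocks as a binary tree in heap order. -/
def IsTree (m : ℕ) (ω W : ℕ → ℕ) : Prop :=
  ∀ t ≤ m, ∀ y < 2 ^ m, W ((2 ^ m + y) / 2 ^ t) = blk m ω t y

/-! ### The tree of weights -/

open Var in
/-- All leaves get weight one. -/
def initTree : Stmt :=
  .loop t (m + 1) <| .set s0 (.shr bm t) ;;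
    .loop j s0 (.put .tree (s0 + j) (.shl 1 t))

theorem initTree_spec {E : Env} {s : St} {m : ℕ} (hE : E.Wide) (hm : s.v .m = m)
    (hbm : s.v .bm = 2 ^ m) (ha : 2 ^ (m + 1) ≤ E.amax) :
    wp E initTree s fun s' => IsTree m (fun _ => 1) (s'.a .tree) ∧
      s'.t ≤ s.t + 100 * 2 ^ m := by
  obtain ⟨w1, w2, w3⟩ := hE
  have hp : m < 2 ^ m := Nat.lt_two_pow_self
  have hp' : 2 ^ (m + 1) = 2 * 2 ^ m := by ring
  refine wp_loop (fun i s' => (∀ t' < i, t' ≤ m → ∀ y < 2 ^ m,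
    s'.a .tree ((2 ^ m + y) / 2 ^ t') = 2 ^ t') ∧
    s'.t + 20 * 2 ^ (m + 1 - i) ≤ s.t + 10 + 20 * 2 ^ (m + 1) + 30 * i) ?_ ?_ ?_ ?_
  · simp [hm]; omega
  · simp
  · simp only [Ex.eval_add, Ex.eval_var, hm, Ex.eval_ofNat]
    intro i hi s' hf ⟨h1, h2⟩
    have ebm : s'.v .bm = 2 ^ m := (hf.v _ rfl).trans hbm
    have hdiv : 2 ^ m / 2 ^ i = 2 ^ (m - i) := Nat.pow_div (by omega) (by norm_num)
    have hle : 2 ^ (m - i) ≤ 2 ^ m := Nat.pow_le_pow_right (by norm_num) (by omega)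
    have hle' : 2 ^ i ≤ 2 ^ m := Nat.pow_le_pow_right (by norm_num) (by omega)
    have hsub : 2 ^ (m + 1 - i) = 2 * 2 ^ (m - i) := by rw [← pow_succ']; congr 1; omega
    simp only [wp_seq, wp_set]
    refine ⟨by simp, wp_loop (fun k s₂ => (∀ t' < i, t' ≤ m → ∀ y < 2 ^ m,
      s₂.a .tree ((2 ^ m + y) / 2 ^ t') = 2 ^ t') ∧
      (∀ j < k, s₂.a .tree (2 ^ (m - i) + j) = 2 ^ i) ∧ s₂.t ≤ s'.t + 12 + 17 * k) ?_ ?_ ?_ ?_⟩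
    · simp
    · simp; exact h1
    · simp only [Ex.eval_var, Ex.eval_shr, St.set_v, St.tick_v, ebm, if_true, hdiv, reduceCtorEq,
        if_false]
      intro k hk s₂ hf₂ ⟨g1, g2, g3⟩
      have es0 : s₂.v .s0 = 2 ^ (m - i) := by rw [hf₂.v _ rfl]; simp
      have et : s₂.v .t = i := by rw [hf₂.v _ rfl]; simp
      simp [es0, et]
      refine ⟨by omega, fun t' ht' ht'm y hy => ?_, fun j hj => ?_, by omega⟩
      · rw [Function.update_of_ne, g1 t' ht' ht'm y hy]
        intro h
        rw [node_eq ht'm] at h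
        have := pow_add_inj (div_lt_two_pow_sub ht'm hy) hk h
        omega
      · rw [Function.update_apply]
        split
        · rfl
        · exact g2 j (by omega)
    · intro s₂ hf₂ ⟨g1, g2, g3⟩
      simp only [Ex.eval_var, Ex.eval_shr, St.set_v, St.tick_v, ebm, if_true, hdiv, reduceCtorEq,
        if_false] at g2 g3
      refine ⟨fun t' ht' ht'm y hy => ?_, ?_⟩
      · rcases Nat.lt_succ_iff_lt_or_eq.1 ht' with h | rfl
        · exact g1 t' h ht'm y hy
        · rw [node_eq ht'm]; exact g2 _ (div_lt_two_pow_sub ht'm hy)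
      · rw [show m + 1 - (i + 1) = m - i by omega]; omega
  · simp only [Ex.eval_add, Ex.eval_var, hm, Ex.eval_ofNat]
    intro s' hf ⟨h1, h2⟩
    refine ⟨fun t ht y hy => ?_, ?_⟩
    · rw [h1 t (by omega) ht y hy, blk_one ht hy]
    · omega

open Var in
/-- Double the weight of the leaf `y`. -/
def bump : Stmt :=
  .set om (.get .tree (bm + y)) ;;
  .loop t (m + 1) (.set z (.shr (bm + y) t) ;; .put .tree z (.get .tree z + om))

theorem bump_spec {E : Env} {s : St} {m y : ℕ} {ω : ℕ → ℕ} (hE : E.Wide) (hm : s.v .m = m)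
    (hbm : s.v .bm = 2 ^ m) (ha : 2 ^ (m + 1) ≤ E.amax) (hy : s.v .y = y) (hy' : y < 2 ^ m)
    (hW : IsTree m ω (s.a .tree)) (hΦ : 2 * total m ω < 2 ^ E.w) :
    wp E bump s fun s' => IsTree m (Function.update ω y (ω y + ω y)) (s'.a .tree) ∧
      s'.t ≤ s.t + 80 + 40 * m := by
  obtain ⟨w1, w2, w3⟩ := hE
  have hp : m < 2 ^ m := Nat.lt_two_pow_self
  have hp' : 2 ^ (m + 1) = 2 * 2 ^ m := by ring
  have hom : s.a .tree (2 ^ m + y) = ω y := by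
    have := hW 0 (by omega) y hy'
    rwa [pow_zero, Nat.div_one, blk_zero hy'] at this
  have hωy : ω y ≤ total m ω := by rw [← blk_zero (ω := ω) hy']; exact blk_le_total
  unfold bump
  simp only [wp_seq, wp_set]
  refine ⟨by simp [hbm, hy]; omega, ?_⟩
  refine wp_loop (fun i s' => (∀ t' ≤ m, ∀ y' < 2 ^ m, s'.a .tree ((2 ^ m + y') / 2 ^ t') =
    blk m ω t' y' + if t' < i ∧ y' / 2 ^ t' = y / 2 ^ t' then ω y else 0) ∧
    s'.t ≤ s.t + 40 + 30 * i) ?_ ?_ ?_ ?_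
  · simp [hm]; omega
  · simp; exact hW
  · simp only [Ex.eval_add, Ex.eval_var, hm, Ex.eval_ofNat, St.set_v, St.tick_v, reduceCtorEq,
      if_false]
    intro i hi s' hf ⟨h1, h2⟩
    have ebm : s'.v .bm = 2 ^ m := by rw [hf.v _ rfl]; simp [hbm]
    have ey : s'.v .y = y := by rw [hf.v _ rfl]; simp [hy]
    have eom : s'.v .om = ω y := by rw [hf.v _ rfl]; simp [hbm, hy, hom]
    have hn := node_lt (t := i) hy'
    have hi' : i ≤ m := by omega
    have hval := h1 i hi' y hy'
    rw [if_neg (by omega)] at hval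
    have hb : blk m ω i y ≤ total m ω := blk_le_total
    simp [ebm, ey, eom, hval]
    refine ⟨by omega, ⟨⟨by omega, by omega⟩, by omega⟩, fun t' ht' y' hy'' => ?_, by omega⟩
    rw [Function.update_apply]
    simp only [node_inj ht' hi' hy'' hy']
    by_cases ht : t' = i
    · subst ht
      by_cases hyy : y' / 2 ^ t' = y / 2 ^ t'
      · rw [if_pos ⟨rfl, hyy⟩, if_pos ⟨by omega, hyy⟩]
        congr 1
        unfold blk
        rw [hyy]
      · rw [if_neg (by tauto), if_neg (by tauto), h1 t' ht' y' hy'', if_neg (by tauto)]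
    · rw [if_neg (by tauto), h1 t' ht' y' hy'']
      have : t' < i ↔ t' ≤ i := by omega
      simp only [this]
  · simp only [Ex.eval_add, Ex.eval_var, hm, Ex.eval_ofNat, St.set_v, St.tick_v, reduceCtorEq,
      if_false]
    intro s' hf ⟨h1, h2⟩
    refine ⟨fun t ht y' hy'' => ?_, by omega⟩
    rw [h1 t ht y' hy'', blk_update hy']
    have : t < m + 1 := by omega
    simp [this]

/-! ### The choice of a displacement -/

open Var in
/-- For a group of `cnt` items in `xs`, choose a displacement `dd` bit by bit, from the most
significant one, so that the weight of the displaced items is at most the average. -/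
def chooseDisp : Stmt :=
  .set dd 0 ;;
  .loop j m (.set t ((m - 1 : Ex) - j) ;; .set s0 0 ;; .set s1 0 ;;
    .loop i cnt (.set z (.get .xs i) ;;
      .set s0 (s0 + .get .tree (.shr (bm + .xor z dd) t)) ;;
      .set s1 (s1 + .get .tree (.shr (bm + .xor z (.xor dd (.shl 1 t))) t))) ;;
    .ite .lt s1 s0 (.set dd (.xor dd (.shl 1 t))) .skip)

theorem sum_blk_le (m : ℕ) (ω X : ℕ → ℕ) (t d k : ℕ) :
    ∑ i ∈ Finset.range k, blk m ω t (X i ^^^ d) ≤ k * total m ω :=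
  (Finset.sum_le_sum fun _ _ => blk_le_total).trans (by simp)

theorem chooseDisp_spec {E : Env} {s : St} {m k : ℕ} {ω : ℕ → ℕ} (hE : E.Wide) (hm : s.v .m = m)
    (hbm : s.v .bm = 2 ^ m) (ha : 2 ^ (m + 1) ≤ E.amax) (hk : s.v .cnt = k) (hk' : k ≤ E.amax)
    (hX : ∀ i < k, s.a .xs i < 2 ^ m)
    (hW : IsTree m ω (s.a .tree)) (hΦ : k * total m ω < 2 ^ E.w) :
    wp E chooseDisp s fun s' => s'.v .dd < 2 ^ m ∧
      2 ^ m * ∑ i ∈ Finset.range k, ω (s.a .xs i ^^^ s'.v .dd) ≤ k * total m ω ∧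
      s'.t ≤ s.t + 10 + m * (60 + 80 * k) := by
  obtain ⟨w1, w2, w3⟩ := hE
  have hp : m < 2 ^ m := Nat.lt_two_pow_self
  have hp' : 2 ^ (m + 1) = 2 * 2 ^ m := by ring
  unfold chooseDisp
  simp only [wp_seq, wp_set]
  refine ⟨by simp, ?_⟩
  refine wp_loop (fun r s' => s'.v .dd < 2 ^ m ∧
    2 ^ r * ∑ i ∈ Finset.range k, blk m ω (m - r) (s.a .xs i ^^^ s'.v .dd) ≤ k * total m ω ∧
    s'.t ≤ s.t + 10 + r * (60 + 80 * k)) ?_ ?_ ?_ ?_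
  · simp
  · simp only [St.tick_v, St.set_v, if_true, pow_zero, one_mul, Nat.sub_zero]
    refine ⟨by simp, sum_blk_le _ _ _ _ _ _, by simp⟩
  · simp only [Ex.eval_var, hm, Ex.eval_ofNat, St.set_v, St.tick_v, reduceCtorEq, if_false]
    intro r hr s' hf ⟨h1, h2, h3⟩
    have ebm : s'.v .bm = 2 ^ m := by rw [hf.v _ rfl]; simp [hbm]
    have em : s'.v .m = m := by rw [hf.v _ rfl]; simp [hm]
    have ek : s'.v .cnt = k := by rw [hf.v _ rfl]; simp [hk]
    have exs : s'.a .xs = s.a .xs := by rw [hf.a _ rfl]; simp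
    have etr : s'.a .tree = s.a .tree := by rw [hf.a _ rfl]; simp
    set d := s'.v .dd
    have ht : m - 1 - r < m := by omega
    have htm : 2 ^ (m - 1 - r) < 2 ^ m := Nat.pow_lt_pow_right (by norm_num) ht
    have hd' : d ^^^ 2 ^ (m - 1 - r) < 2 ^ m := Nat.xor_lt_two_pow h1 htm
    have hsplit : ∑ i ∈ Finset.range k, blk m ω (m - r) (s.a .xs i ^^^ d) =
        ∑ i ∈ Finset.range k, blk m ω (m - 1 - r) (s.a .xs i ^^^ d) +
        ∑ i ∈ Finset.range k, blk m ω (m - 1 - r) (s.a .xs i ^^^ (d ^^^ 2 ^ (m - 1 - r))) := by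
      rw [← Finset.sum_add_distrib, show m - r = m - 1 - r + 1 by omega]
      exact Finset.sum_congr rfl fun i _ => by rw [blk_succ, Nat.xor_assoc]
    simp only [wp_seq, wp_set]
    refine ⟨by simp [em]; omega, by simp, by simp, ?_⟩
    refine wp.mono (Q := fun s₂ =>
      s₂.v .s0 = ∑ i ∈ Finset.range k, blk m ω (m - 1 - r) (s.a .xs i ^^^ d) ∧
      s₂.v .s1 = ∑ i ∈ Finset.range k, blk m ω (m - 1 - r) (s.a .xs i ^^^ (d ^^^ 2 ^ (m - 1 - r))) ∧
      s₂.t ≤ s'.t + 40 + 80 * k) (wp_loop (fun q s₂ =>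
      s₂.v .s0 = ∑ i ∈ Finset.range q, blk m ω (m - 1 - r) (s.a .xs i ^^^ d) ∧
      s₂.v .s1 = ∑ i ∈ Finset.range q, blk m ω (m - 1 - r) (s.a .xs i ^^^ (d ^^^ 2 ^ (m - 1 - r))) ∧
      s₂.t ≤ s'.t + 40 + 80 * q) ?_ ?_ ?_ ?_) ?_
    · simp
    · simp
    · simp only [Ex.eval_var, ek, Ex.eval_ofNat, St.set_v, St.tick_v, reduceCtorEq, if_false]
      intro q hq s₂ hf₂ ⟨g1, g2, g3⟩
      have ebm₂ : s₂.v .bm = 2 ^ m := by rw [hf₂.v _ rfl]; simp [ebm]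
      have et₂ : s₂.v .t = m - 1 - r := by rw [hf₂.v _ rfl]; simp [em]
      have ed₂ : s₂.v .dd = d := by rw [hf₂.v _ rfl]; simp [d]
      have exs₂ : s₂.a .xs = s.a .xs := by rw [hf₂.a _ rfl]; simp [exs]
      have etr₂ : s₂.a .tree = s.a .tree := by rw [hf₂.a _ rfl]; simp [etr]
      have hx := hX q hq
      have hx1 : s.a .xs q ^^^ d < 2 ^ m := Nat.xor_lt_two_pow hx h1
      have hx2 : s.a .xs q ^^^ (d ^^^ 2 ^ (m - 1 - r)) < 2 ^ m := Nat.xor_lt_two_pow hx hd'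
      have hv1 := hW (m - 1 - r) ht.le _ hx1
      have hv2 := hW (m - 1 - r) ht.le _ hx2
      have hn1 := node_lt (t := m - 1 - r) hx1
      have hn2 := node_lt (t := m - 1 - r) hx2
      have hb1 := sum_blk_le m ω (s.a .xs) (m - 1 - r) d (q + 1)
      have hb2 := sum_blk_le m ω (s.a .xs) (m - 1 - r) (d ^^^ 2 ^ (m - 1 - r)) (q + 1)
      rw [Finset.sum_range_succ] at hb1 hb2
      have hmul : (q + 1) * total m ω ≤ k * total m ω := Nat.mul_le_mul_right _ hq
      simp [ebm₂, et₂, ed₂, exs₂, etr₂, hv1, hv2, g1, g2, Finset.sum_range_succ]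
      omega
    · simp only [Ex.eval_var, ek, Ex.eval_ofNat, St.set_v, St.tick_v, reduceCtorEq, if_false]
      exact fun s₂ _ h => h
    · intro s₂ hf₂ ⟨g1, g2, g3⟩
      have ed₂ : s₂.v .dd = d := by rw [hf₂.v _ rfl]; simp [d]
      have et₂ : s₂.v .t = m - 1 - r := by rw [hf₂.v _ rfl]; simp [em]
      have hpw : ∀ x, 2 ^ (r + 1) * x = 2 ^ r * (x + x) := fun x => by ring
      have hsub : m - (r + 1) = m - 1 - r := by omega
      refine wp_ite (by simp) (by simp) (fun hc => ?_) (fun hc => ?_)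
      · simp [g1, g2] at hc
        simp [ed₂, et₂, hsub, hpw]
        refine ⟨by omega, hd', le_trans (Nat.mul_le_mul_left _ ?_) h2, by
          rw [Nat.succ_mul]; omega⟩
        omega
      · simp [g1, g2] at hc
        simp [ed₂, hsub, hpw]
        refine ⟨h1, le_trans (Nat.mul_le_mul_left _ ?_) h2, by
          rw [Nat.succ_mul]; omega⟩
        omega
  · simp only [Ex.eval_var, hm, Ex.eval_ofNat, St.set_v, St.tick_v, reduceCtorEq,
      if_false, Nat.sub_self]
    intro s' hf ⟨h1, h2, h3⟩
    refine ⟨h1, le_of_eq_of_le ?_ h2, h3⟩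
    congr 1
    exact Finset.sum_congr rfl fun i hi =>
      (blk_zero (Nat.xor_lt_two_pow (hX i (Finset.mem_range.1 hi)) h1)).symm

end WordRAM

namespace WordRAM

/-- A text `T` of length `n` over the alphabet `{0, …, sig - 1}` and the parameter `k`. -/
structure Inst where
  n : ℕ
  sig : ℕ
  k : ℕ
  T : ℕ → ℕ

namespace Inst

variable (P : Inst)

/-- Blocks of the text have length `2 ^ u`. -/
def u : ℕ := Nat.clog 2 P.sig
/-- Intervals are split into `2 ^ g` parts. -/
def g : ℕ := P.u / 2 ^ (P.k + 2) + 1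
/-- The number of levels of intervals. -/
def lv : ℕ := P.u / P.g + 1
/-- The dictionary of a block has `2 ^ m` cells. -/
def m : ℕ := P.u + 2 * P.g
/-- One in `2 ^ kap` occurrences of a character is a sample. -/
def kap : ℕ := 2 * P.k + 6
/-- The number of blocks. -/
def nb : ℕ := P.n / 2 ^ P.u + 1

/-- The number of occurrences of `c` before position `p`. -/
def R (c p : ℕ) : ℕ := Nat.count (fun p' => p' < P.n ∧ P.T p' = c) p

/-- The number of characters of the text smaller than `c`. -/
def S (c : ℕ) : ℕ := Nat.count (fun p => P.T p < c) P.n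

structure Valid : Prop where
  two_le : 2 ≤ P.sig
  sig_le : P.sig ≤ P.n
  T_lt : ∀ p < P.n, P.T p < P.sig

/-- The positions, sorted by their characters and then by their values. -/
def IsPos (A : ℕ → ℕ) : Prop := ∀ p < P.n, A (P.S (P.T p) + P.R (P.T p) p) = p

/-- The index of the first occurrence of `c` in block `b` in the sorted array of positions. -/
def lo (b c : ℕ) : ℕ := P.S c + P.R c (b * 2 ^ P.u)

/-- The number of samples of `c` in block `b`. -/
def ns (b c : ℕ) : ℕ := (P.lo (b + 1) c - P.lo b c) / 2 ^ P.kap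

def samp (b c r : ℕ) : ℕ := P.lo b c + (r + 1) * 2 ^ P.kap - 1

/-- The position of a sample in its block, as a leaf of a binary tree in heap order. -/
def vcode (A : ℕ → ℕ) (b c r : ℕ) : ℕ := 2 ^ P.u + A (P.samp b c r) - b * 2 ^ P.u

/-- `col` is an interval of level `i` whose parent contains a sample of `c` in block `b`. -/
def IsKey (A : ℕ → ℕ) (b c i col : ℕ) : Prop :=
  i < P.lv ∧ ∃ r < P.ns b c, col / 2 ^ P.g = P.vcode A b c r / 2 ^ (P.g * (i + 1))

/-- The index of the first occurrence of `c` in block `b` from position `tau - 2 ^ u` on. -/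
def cut (b c tau : ℕ) : ℕ :=
  max (P.lo b c) (min (P.lo (b + 1) c) (P.S c + P.R c (tau - 2 ^ P.u)))

/-- The index of the first occurrence in an interval. -/
def keyVal (b c i col : ℕ) : ℕ := P.cut b c (col * 2 ^ (P.g * i) + b * 2 ^ P.u)

variable {P}

theorem R_mono (c : ℕ) : Monotone (P.R c) := Nat.count_monotone _

theorem R_succ (c p : ℕ) : P.R c (p + 1) = P.R c p + if p < P.n ∧ P.T p = c then 1 else 0 :=
  Nat.count_succ _ _

theorem R_le (c p : ℕ) : P.R c p ≤ P.R c P.n := by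
  rcases le_total p P.n with h | h
  · exact R_mono c h
  · obtain ⟨d, rfl⟩ := Nat.exists_eq_add_of_le h
    rw [R, Nat.count_add, R]
    have : Nat.count (fun k => P.n + k < P.n ∧ P.T (P.n + k) = c) d = 0 := by
      rw [Nat.count_eq_card_filter_range]; simp
    omega

theorem S_succ (c : ℕ) : P.S (c + 1) = P.S c + P.R c P.n := by
  unfold S R
  have : ∀ N ≤ P.n, Nat.count (fun p => P.T p < c + 1) N = Nat.count (fun p => P.T p < c) N +
      Nat.count (fun p' => p' < P.n ∧ P.T p' = c) N := by
    intro N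
    induction N with
    | zero => simp
    | succ N ih =>
      intro hN
      rw [Nat.count_succ, Nat.count_succ, Nat.count_succ, ih (by omega)]
      split_ifs <;> omega
  exact this _ le_rfl

theorem S_mono : Monotone P.S := monotone_nat_of_le_succ fun c => by rw [S_succ]; omega

theorem S_le (c : ℕ) : P.S c ≤ P.n := Nat.count_le _

theorem S_add_R_le (c p : ℕ) : P.S c + P.R c p ≤ P.n := by
  have := R_le (P := P) c p
  have := S_le (P := P) (c + 1)
  rw [S_succ] at this
  omega

theorem exists_occ {c r N : ℕ} : r < P.R c N → ∃ p < N, p < P.n ∧ P.T p = c ∧ P.R c p = r := by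
  induction N with
  | zero => intro h; simp [R] at h
  | succ N ih =>
    intro h
    rw [R_succ] at h
    by_cases h' : r < P.R c N
    · obtain ⟨p, h1, h2⟩ := ih h'
      exact ⟨p, by omega, h2⟩
    · split_ifs at h with h2
      · exact ⟨N, by omega, h2.1, h2.2, by omega⟩
      · omega

theorem IsPos.lt_iff {A : ℕ → ℕ} (hA : P.IsPos A) {c r : ℕ} (hr : r < P.R c P.n) (q : ℕ) :
    A (P.S c + r) < q ↔ r < P.R c q := by
  obtain ⟨p, -, hp, rfl, rfl⟩ := exists_occ hr
  rw [hA p hp]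
  constructor
  · intro h
    have h1 := R_mono (P := P) (P.T p) (Nat.succ_le_of_lt h)
    rw [Nat.succ_eq_add_one, R_succ, if_pos ⟨hp, rfl⟩] at h1
    omega
  · intro h
    by_contra hc
    have := R_mono (P := P) (P.T p) (not_lt.1 hc)
    omega

theorem lo_le (b c : ℕ) : P.lo b c ≤ P.lo (b + 1) c :=
  Nat.add_le_add_left (R_mono c (Nat.mul_le_mul_right _ (by omega))) _

theorem lo_le_n (b c : ℕ) : P.lo b c ≤ P.n := S_add_R_le _ _

/-- In block `b`, the array of positions is below `q` exactly up to rank `R c q`. -/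
theorem IsPos.block_lt_iff {A : ℕ → ℕ} (hA : P.IsPos A) {b c i : ℕ} (h1 : P.lo b c ≤ i)
    (h2 : i < P.lo (b + 1) c) (q : ℕ) : A i < q ↔ i < P.S c + P.R c q := by
  unfold lo at h1 h2
  have h3 := R_le (P := P) c ((b + 1) * 2 ^ P.u)
  obtain ⟨r, rfl⟩ := Nat.exists_eq_add_of_le (show P.S c ≤ i by omega)
  rw [hA.lt_iff (by omega)]
  omega

theorem IsPos.block_mem {A : ℕ → ℕ} (hA : P.IsPos A) {b c i : ℕ} (h1 : P.lo b c ≤ i)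
    (h2 : i < P.lo (b + 1) c) : b * 2 ^ P.u ≤ A i ∧ A i < (b + 1) * 2 ^ P.u ∧ A i < P.n := by
  refine ⟨?_, (hA.block_lt_iff h1 h2 _).2 h2, ?_⟩
  · rw [← not_lt, hA.block_lt_iff h1 h2]; exact not_lt.2 h1
  · rw [hA.block_lt_iff h1 h2]
    exact h2.trans_le (Nat.add_le_add_left (R_le _ _) _)

theorem IsPos.lt_cut_iff {A : ℕ → ℕ} (hA : P.IsPos A) {b c i tau : ℕ} (h1 : P.lo b c ≤ i)
    (h2 : i < P.lo (b + 1) c) : A i + 2 ^ P.u < tau ↔ i < P.cut b c tau := by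
  have := hA.block_lt_iff h1 h2 (tau - 2 ^ P.u)
  have h3 : A i + 2 ^ P.u < tau ↔ A i < tau - 2 ^ P.u := by omega
  rw [h3, this, cut]
  omega

theorem le_cut (b c tau : ℕ) : P.lo b c ≤ P.cut b c tau := le_max_left _ _

theorem cut_le (b c tau : ℕ) : P.cut b c tau ≤ P.lo (b + 1) c :=
  max_le (lo_le b c) (min_le_left _ _)

theorem sum_R_le (x L : ℕ) :
    ∑ c ∈ Finset.range P.sig, P.R c (x + L) ≤ ∑ c ∈ Finset.range P.sig, P.R c x + L := by
  induction L with
  | zero => simp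
  | succ L ih =>
    have : ∑ c ∈ Finset.range P.sig, P.R c (x + (L + 1)) = ∑ c ∈ Finset.range P.sig, P.R c (x + L) +
        ∑ c ∈ Finset.range P.sig, if x + L < P.n ∧ P.T (x + L) = c then 1 else 0 := by
      rw [← Finset.sum_add_distrib]
      exact Finset.sum_congr rfl fun c _ => R_succ _ _
    have h2 : ∑ c ∈ Finset.range P.sig, (if x + L < P.n ∧ P.T (x + L) = c then 1 else 0) ≤ 1 := by
      refine (Finset.sum_le_sum (g := fun c => if P.T (x + L) = c then 1 else 0)
        fun c _ => ?_).trans ?_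
      · split_ifs <;> simp_all
      · rw [Finset.sum_ite_eq]; split_ifs <;> simp
    omega

theorem sum_block_le (b : ℕ) :
    ∑ c ∈ Finset.range P.sig, (P.lo (b + 1) c - P.lo b c) ≤ 2 ^ P.u := by
  have h := sum_R_le (P := P) (b * 2 ^ P.u) (2 ^ P.u)
  have h2 : ∑ c ∈ Finset.range P.sig, P.R c (b * 2 ^ P.u + 2 ^ P.u) =
      ∑ c ∈ Finset.range P.sig, (P.lo (b + 1) c - P.lo b c) +
      ∑ c ∈ Finset.range P.sig, P.R c (b * 2 ^ P.u) := by
    rw [← Finset.sum_add_distrib]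
    refine Finset.sum_congr rfl fun c _ => ?_
    have := lo_le (P := P) b c
    unfold lo at this ⊢
    rw [← Nat.succ_mul]
    simp only [Nat.succ_eq_add_one]
    omega
  omega

theorem sum_ns_le (b : ℕ) : (∑ c ∈ Finset.range P.sig, P.ns b c) * 2 ^ P.kap ≤ 2 ^ P.u := by
  rw [Finset.sum_mul]
  exact (Finset.sum_le_sum fun c _ => Nat.div_mul_le_self _ _).trans (sum_block_le b)

theorem one_le_g : 1 ≤ P.g := by unfold g; exact Nat.succ_pos _

theorem u_lt : P.u < P.g * 2 ^ (P.k + 2) := by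
  unfold g
  rw [mul_comm]
  exact Nat.lt_mul_div_succ _ (by positivity)

theorem lv_le : P.lv ≤ 2 ^ (P.k + 2) :=
  Nat.succ_le_of_lt ((Nat.div_lt_iff_lt_mul one_le_g).2 (by rw [mul_comm]; exact u_lt))

theorem g_mul_lv_le : P.g * P.lv ≤ P.u + P.g := by
  unfold lv
  rw [Nat.mul_add, mul_one]
  exact Nat.add_le_add_right (Nat.mul_div_le _ _) _

theorem u_lt_g_mul_lv : P.u < P.g * P.lv := Nat.lt_mul_div_succ _ one_le_g

theorem m_succ_le : P.m + 1 ≤ P.g * 2 ^ (P.k + 3) := by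
  have h1 := P.u_lt
  have h2 : 1 ≤ 2 ^ P.k := Nat.one_le_two_pow
  have h3 : P.g * 2 ^ (P.k + 2) = 4 * (P.g * 2 ^ P.k) := by ring
  have h4 : P.g * 2 ^ (P.k + 3) = 8 * (P.g * 2 ^ P.k) := by ring
  have h5 : P.g * 1 ≤ P.g * 2 ^ P.k := Nat.mul_le_mul_left _ h2
  unfold m
  omega

/-- A bound for the number of keys of a block. -/
def maxKeys (P : Inst) (b : ℕ) : ℕ := ∑ c ∈ Finset.range P.sig, P.ns b c * (P.lv * 2 ^ P.g)

theorem maxKeys_bound (b : ℕ) : 2 * P.maxKeys b * (P.m + 1) < 2 ^ P.m := by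
  unfold maxKeys
  rw [← Finset.sum_mul]
  set X := ∑ c ∈ Finset.range P.sig, P.ns b c
  have hX : X * 2 ^ P.kap ≤ 2 ^ P.u := sum_ns_le b
  rcases Nat.eq_zero_or_pos X with h0 | h0
  · rw [h0]; simp
  have h1 : 2 * (P.lv * 2 ^ P.g) * (P.m + 1) < 2 ^ P.kap * 2 ^ (2 * P.g) := by
    calc 2 * (P.lv * 2 ^ P.g) * (P.m + 1)
        ≤ 2 * (2 ^ (P.k + 2) * 2 ^ P.g) * (P.g * 2 ^ (P.k + 3)) := by
          gcongr
          · exact lv_le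
          · exact m_succ_le
      _ = 2 ^ P.kap * (2 ^ P.g * P.g) := by rw [kap]; ring
      _ < 2 ^ P.kap * (2 ^ P.g * 2 ^ P.g) := by
          gcongr
          exact Nat.lt_two_pow_self
      _ = _ := by ring
  calc 2 * (X * (P.lv * 2 ^ P.g)) * (P.m + 1) = X * (2 * (P.lv * 2 ^ P.g) * (P.m + 1)) := by ring
    _ < X * (2 ^ P.kap * 2 ^ (2 * P.g)) := by gcongr
    _ = X * 2 ^ P.kap * 2 ^ (2 * P.g) := by ring
    _ ≤ 2 ^ P.u * 2 ^ (2 * P.g) := by gcongr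
    _ = 2 ^ P.m := by rw [m, pow_add]

theorem samp_mem {b c r : ℕ} (hr : r < P.ns b c) :
    P.lo b c ≤ P.samp b c r ∧ P.samp b c r < P.lo (b + 1) c := by
  have h1 : (r + 1) * 2 ^ P.kap ≤ P.ns b c * 2 ^ P.kap := Nat.mul_le_mul_right _ hr
  have h2 : P.ns b c * 2 ^ P.kap ≤ P.lo (b + 1) c - P.lo b c := Nat.div_mul_le_self _ _
  have h3 : 0 < (r + 1) * 2 ^ P.kap := by positivity
  have := lo_le (P := P) b c
  unfold samp
  omega

theorem vcode_mem {A : ℕ → ℕ} (hA : P.IsPos A) {b c r : ℕ} (hr : r < P.ns b c) :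
    2 ^ P.u ≤ P.vcode A b c r ∧ P.vcode A b c r < 2 * 2 ^ P.u := by
  obtain ⟨h1, h2⟩ := samp_mem hr
  obtain ⟨h3, h4, -⟩ := hA.block_mem h1 h2
  rw [Nat.add_mul, Nat.one_mul] at h4
  unfold vcode
  omega

theorem pow_m_ge : 2 * 2 ^ P.u + 2 ^ P.g ≤ 2 ^ P.m := by
  have h1 : 2 ^ P.m = 2 ^ P.u * 2 ^ P.g * 2 ^ P.g := by rw [m, two_mul, ← add_assoc, pow_add, pow_add]
  have h2 : 2 ≤ 2 ^ P.g := by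
    calc 2 = 2 ^ 1 := rfl
      _ ≤ 2 ^ P.g := Nat.pow_le_pow_right (by norm_num) one_le_g
  have h3 : 1 ≤ 2 ^ P.u := Nat.one_le_two_pow
  have h4 : 2 ^ P.u * 2 ^ P.g ≤ 2 ^ P.u * 2 ^ P.g * 2 ^ P.g / 2 := by
    rw [Nat.le_div_iff_mul_le (by norm_num)]; gcongr
  have h5 : 2 ^ P.u * 2 ≤ 2 ^ P.u * 2 ^ P.g := by gcongr
  have h6 : 1 * 2 ^ P.g ≤ 2 ^ P.u * 2 ^ P.g := by gcongr
  rw [h1]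
  omega

theorem child_lt {v g j col : ℕ} (h : col / 2 ^ g = v / 2 ^ (g + j)) :
    col * 2 ^ j < v + 2 ^ (g + j) := by
  have h1 : col < 2 ^ g * (col / 2 ^ g + 1) := Nat.lt_mul_div_succ _ (by positivity)
  calc col * 2 ^ j < 2 ^ g * (col / 2 ^ g + 1) * 2 ^ j := by gcongr
    _ = 2 ^ (g + j) * (v / 2 ^ (g + j)) + 2 ^ (g + j) := by rw [h, pow_add]; ring
    _ ≤ v + 2 ^ (g + j) := by gcongr; exact Nat.mul_div_le _ _

theorem IsKey.lt {A : ℕ → ℕ} (hA : P.IsPos A) {b c i col : ℕ} (h : P.IsKey A b c i col) :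
    col < 2 ^ P.m ∧ col * 2 ^ (P.g * i) < 2 ^ (P.m + 1) := by
  obtain ⟨hi, r, hr, he⟩ := h
  obtain ⟨h1, h2⟩ := vcode_mem hA hr
  have h3 := P.pow_m_ge
  have h4 : col / 2 ^ P.g ≤ P.vcode A b c r / 2 ^ (P.g + 0) := by
    rw [he]
    exact Nat.div_le_div_left (Nat.pow_le_pow_right (by norm_num) (by nlinarith)) (by positivity)
  constructor
  · have h5 : col < 2 ^ P.g * (col / 2 ^ P.g + 1) := Nat.lt_mul_div_succ _ (by positivity)
    have h6 : 2 ^ P.g * (col / 2 ^ P.g + 1) ≤ P.vcode A b c r + 2 ^ P.g := by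
      rw [Nat.mul_add, mul_one]
      refine Nat.add_le_add_right ((Nat.mul_le_mul_left _ h4).trans ?_) _
      exact Nat.mul_div_le _ _
    omega
  · rw [Nat.mul_add, mul_one, add_comm] at he
    have h5 := child_lt he
    have h6 : 2 ^ (P.g + P.g * i) ≤ 2 ^ P.m := by
      refine Nat.pow_le_pow_right (by norm_num) ?_
      have h7 : P.g * (i + 1) ≤ P.g * P.lv := Nat.mul_le_mul_left _ hi
      have h8 := P.g_mul_lv_le
      rw [Nat.mul_add, mul_one] at h7
      unfold m; omega
    have h9 : 0 < 2 ^ P.g := by positivity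
    rw [pow_succ]
    omega

/-! ### Queries -/

/-- The interval of level `i` that contains the position `p` of block `b`. -/
def qcode (P : Inst) (b p i : ℕ) : ℕ := (2 ^ P.u + (p - b * 2 ^ P.u)) / 2 ^ (P.g * i)

theorem qcode_parent (b p i : ℕ) : P.qcode b p i / 2 ^ P.g =
    (2 ^ P.u + (p - b * 2 ^ P.u)) / 2 ^ (P.g * (i + 1)) := by
  unfold qcode
  rw [Nat.div_div_eq_div_mul, ← pow_add, mul_add, mul_one]

theorem level_eq {i i' a a' : ℕ} (hi : i < P.lv) (hi' : i' < P.lv) (ha : a < 2 ^ P.u)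
    (ha' : a' < 2 ^ P.u)
    (h : (2 ^ P.u + a) / 2 ^ (P.g * (i + 1)) = (2 ^ P.u + a') / 2 ^ (P.g * (i' + 1))) : i = i' := by
  have hz : ∀ {a : ℕ}, a < 2 ^ P.u → ∀ j, (2 ^ P.u + a) / 2 ^ j = 0 ↔ P.u < j := by
    intro a ha j
    rw [Nat.div_eq_zero_iff_lt (by positivity)]
    constructor
    · intro h'
      by_contra hc
      have := Nat.pow_le_pow_right (n := 2) (by norm_num) (not_lt.1 hc)
      omega
    · intro h'
      have := Nat.pow_le_pow_right (n := 2) (by norm_num) (Nat.succ_le_of_lt h')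
      rw [Nat.succ_eq_add_one, pow_succ] at this
      omega
  have hlast : ∀ i < P.lv, P.u < P.g * (i + 1) → i + 1 = P.lv := by
    intro i hi h'
    by_contra hc
    have h1 : P.g * (i + 1) ≤ P.g * (P.lv - 1) := Nat.mul_le_mul_left _ (by omega)
    have h2 : P.g * (P.lv - 1) ≤ P.u := by simpa [lv] using Nat.mul_div_le P.u P.g
    omega
  by_cases h1 : P.u < P.g * (i + 1)
  · have h2 := (hz ha _).2 h1
    rw [h] at h2
    have := hlast i hi h1
    have := hlast i' hi' ((hz ha' _).1 h2)
    omega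
  · have h2 := mt (hz ha _).1 h1
    rw [h] at h2
    have h3 := mt (hz ha' _).2 h2
    have := ((node_inj (not_lt.1 h1) (not_lt.1 h3) ha ha').1 h).1
    have := Nat.eq_of_mul_eq_mul_left one_le_g this
    omega

theorem IsKey.level_eq {A : ℕ → ℕ} (hA : P.IsPos A) {b c p i i' : ℕ} (hi : i < P.lv)
    (hp : b * 2 ^ P.u ≤ p) (hp' : p < (b + 1) * 2 ^ P.u)
    (h : P.IsKey A b c i' (P.qcode b p i)) : i' = i := by
  obtain ⟨hi', r, hr, he⟩ := h
  rw [qcode_parent] at he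
  obtain ⟨h1, h2⟩ := vcode_mem hA hr
  rw [Nat.add_mul, Nat.one_mul] at hp'
  obtain ⟨a, ha⟩ := Nat.exists_eq_add_of_le h1
  rw [ha] at he
  exact (Inst.level_eq hi hi' (by omega) (by omega) he).symm

/-- The search for the next occurrence of `c` from position `p` on may be restricted to the
`2 ^ kap + 1` indices from the first occurrence in an interval on, if its parent is the smallest
interval around `p` that contains a sample. -/
theorem keyVal_bounds {A : ℕ → ℕ} (hA : P.IsPos A) {b c p i : ℕ}
    (hp : b * 2 ^ P.u ≤ p) (hp' : p < (b + 1) * 2 ^ P.u)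
    (hno : i = 0 ∨ ¬ P.IsKey A b c (i - 1) (P.qcode b p (i - 1))) (hi : i < P.lv) :
    P.keyVal b c i (P.qcode b p i) ≤ P.S c + P.R c p ∧
    P.S c + P.R c p ≤ P.keyVal b c i (P.qcode b p i) + 2 ^ P.kap := by
  set a := 2 ^ P.u + (p - b * 2 ^ P.u) with ha
  have hau : a < 2 * 2 ^ P.u := by rw [Nat.add_mul] at hp'; omega
  have hgi : P.g * i ≤ P.u := by
    have h1 : P.g * i ≤ P.g * (P.lv - 1) := Nat.mul_le_mul_left _ (by omega)
    have h2 : P.g * (P.lv - 1) ≤ P.u := by simpa [lv] using Nat.mul_div_le P.u P.g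
    omega
  have hq1 : P.qcode b p i * 2 ^ (P.g * i) ≤ a := Nat.div_mul_le_self _ _
  have hq2 : 2 ^ P.u ≤ P.qcode b p i * 2 ^ (P.g * i) := by
    obtain ⟨e, he⟩ := Nat.exists_eq_add_of_le hgi
    have : 2 ^ e ≤ P.qcode b p i := by
      rw [qcode, Nat.le_div_iff_mul_le (by positivity), ← pow_add, add_comm, ← he]; omega
    calc 2 ^ P.u = 2 ^ e * 2 ^ (P.g * i) := by rw [← pow_add, add_comm, ← he]
      _ ≤ _ := Nat.mul_le_mul_right _ this
  set x := P.qcode b p i * 2 ^ (P.g * i) + b * 2 ^ P.u - 2 ^ P.u with hx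
  have hxp : x ≤ p := by omega
  have hbx : b * 2 ^ P.u ≤ x := by omega
  have hval : P.keyVal b c i (P.qcode b p i) = P.S c + P.R c x := by
    have h1 : P.lo b c ≤ P.S c + P.R c x := Nat.add_le_add_left (R_mono c hbx) _
    have h2 : P.S c + P.R c x ≤ P.lo (b + 1) c := Nat.add_le_add_left (R_mono c (by omega)) _
    unfold keyVal cut
    rw [← hx]
    omega
  have hmono := R_mono (P := P) c hxp
  have hG0 : 0 < 2 ^ P.kap := by positivity
  rw [hval]
  refine ⟨by omega, ?_⟩
  rcases hno with rfl | hno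
  · have : x = p := by
      rw [hx, qcode]; simp; omega
    rw [this]; omega
  by_contra hc
  rcases Nat.eq_zero_or_pos i with rfl | hi0
  · have : x = p := by
      rw [hx, qcode]; simp; omega
    rw [this] at hc; omega
  apply hno
  have hlox : P.lo b c ≤ P.S c + P.R c x := Nat.add_le_add_left (R_mono c hbx) _
  have hphi : P.S c + P.R c p ≤ P.lo (b + 1) c := Nat.add_le_add_left (R_mono c hp'.le) _
  set G := 2 ^ P.kap with hG
  set r := (P.S c + P.R c x - P.lo b c) / G with hr
  have hr1 : r * G ≤ P.S c + P.R c x - P.lo b c := Nat.div_mul_le_self _ _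
  have hr2 : P.S c + P.R c x - P.lo b c < (r + 1) * G := by
    rw [mul_comm]; exact Nat.lt_mul_div_succ _ hG0
  have hr3 : (r + 1) * G = r * G + G := by ring
  have hrns : r < P.ns b c := by
    unfold ns
    rw [← hG, Nat.lt_iff_add_one_le, Nat.le_div_iff_mul_le hG0]
    omega
  obtain ⟨s1, s2⟩ := samp_mem hrns
  have hsx : P.S c + P.R c x ≤ P.samp b c r := by rw [samp, ← hG]; omega
  have hsp : P.samp b c r < P.S c + P.R c p := by rw [samp, ← hG]; omega
  have g1 : x ≤ A (P.samp b c r) := by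
    rw [← not_lt, hA.block_lt_iff s1 s2]; omega
  have g2 : A (P.samp b c r) < p := by rw [hA.block_lt_iff s1 s2]; exact hsp
  refine ⟨by omega, r, hrns, ?_⟩
  rw [qcode_parent, Nat.sub_add_cancel hi0, ← ha]
  refine le_antisymm ?_ ?_
  · rw [Nat.le_div_iff_mul_le (by positivity)]
    change P.qcode b p i * 2 ^ (P.g * i) ≤ P.vcode A b c r
    unfold vcode
    omega
  · refine Nat.div_le_div_right ?_
    unfold vcode
    omega

/-- If not even the largest intervals have samples, there are few occurrences. -/
theorem few_of_not_isKey {A : ℕ → ℕ} (hA : P.IsPos A) {b c p : ℕ} (hp' : p < (b + 1) * 2 ^ P.u)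
    (hno : ¬ P.IsKey A b c (P.lv - 1) (P.qcode b p (P.lv - 1))) :
    P.lo (b + 1) c < P.lo b c + 2 ^ P.kap := by
  by_contra hc
  apply hno
  have h0 : 0 < P.ns b c := Nat.div_pos (by omega) (by positivity)
  have hlv : 0 < P.lv := Nat.succ_pos _
  refine ⟨by omega, 0, h0, ?_⟩
  have hbig : 2 * 2 ^ P.u ≤ 2 ^ (P.g * P.lv) := by
    rw [← pow_succ']
    exact Nat.pow_le_pow_right (by norm_num) u_lt_g_mul_lv
  rw [qcode_parent, Nat.sub_add_cancel hlv, Nat.div_eq_of_lt, Nat.div_eq_of_lt]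
  · exact (vcode_mem hA h0).2.trans_le hbig
  · refine lt_of_lt_of_le ?_ hbig
    have : 0 < 2 ^ P.u := by positivity
    rw [Nat.add_mul] at hp'
    omega

end Inst

end WordRAM

namespace WordRAM

namespace Inst

/-- The parameters that stay fixed in the variables of the programs. -/
def parVars : List Var := [.u, .g, .lv, .m, .kap, .nb, .bu, .bg, .bm]

structure HasPar (P : Inst) (s : St) : Prop where
  u : s.v .u = P.u
  g : s.v .g = P.g
  lv : s.v .lv = P.lv
  m : s.v .m = P.m
  kap : s.v .kap = P.kap
  nb : s.v .nb = P.nb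
  bu : s.v .bu = 2 ^ P.u
  bg : s.v .bg = 2 ^ P.g
  bm : s.v .bm = 2 ^ P.m

theorem HasPar.congr {P : Inst} {s s' : St} (h : P.HasPar s) (hv : ∀ x ∈ parVars, s'.v x = s.v x) :
    P.HasPar s' := by
  obtain ⟨h1, h2, h3, h4, h5, h6, h7, h8, h9⟩ := h
  simp only [parVars, List.mem_cons, List.not_mem_nil, or_false, forall_eq_or_imp, forall_eq] at hv
  obtain ⟨v1, v2, v3, v4, v5, v6, v7, v8, v9⟩ := hv
  constructor <;> simp only [*]

@[simp] theorem hasPar_tick {P : Inst} {s : St} {k : ℕ} : P.HasPar (s.tick k) ↔ P.HasPar s :=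
  ⟨fun h => h.congr fun _ _ => rfl, fun h => h.congr fun _ _ => rfl⟩

@[simp] theorem hasPar_put {P : Inst} {s : St} {q : Arr} {i k : ℕ} :
    P.HasPar (s.put q i k) ↔ P.HasPar s :=
  ⟨fun h => h.congr fun _ _ => rfl, fun h => h.congr fun _ _ => rfl⟩

theorem HasPar.set {P : Inst} {s : St} (h : P.HasPar s) (x : Var) (k : ℕ)
    (hx : x ∉ parVars) : P.HasPar (s.set x k) :=
  h.congr fun y hy => by
    rw [St.set_v, if_neg]; rintro rfl; exact hx hy

theorem HasPar.frame {P : Inst} {s s' : St} {p : Stmt} (h : P.HasPar s) (hf : Frame p s s')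
    (hp : parVars.all (fun x => !p.writes x) = true) : P.HasPar s' :=
  h.congr fun x hx => hf.v x (by simpa using List.all_eq_true.1 hp x hx)

/-- The words and the memory are large enough for the instance. -/
structure Fits (P : Inst) (E : Env) : Prop where
  wide : E.Wide
  n_lt : P.n < E.amax
  blocks_le : (P.nb + 1) * 2 ^ P.u ≤ E.amax
  cells_le : P.nb * 2 ^ P.m ≤ E.amax
  tree_le : 2 ^ (P.m + 1) ≤ E.amax
  sq_lt : 2 ^ (2 * P.m + 4) ≤ 2 ^ E.w
  kap_lt : P.n + 2 ^ P.kap < 2 ^ E.w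

/-- The keys of a character are listed without repetition in `xs`, with values in `xv`. -/
structure Listed (P : Inst) (A : ℕ → ℕ) (b c stamp : ℕ) (mk xs xv : ℕ → ℕ) (K : ℕ) : Prop where
  isKey : ∀ j < K, ∃ i, P.IsKey A b c i (xs j) ∧ xv j = P.keyVal b c i (xs j)
  mark : ∀ col, mk col = stamp ↔ ∃ j < K, xs j = col
  inj : ∀ j < K, ∀ j' < K, xs j = xs j' → j = j'

end Inst

/-- The variables that describe the current character `c` of block `b`. -/
structure CharCtx (P : Inst) (b c : ℕ) (s : St) : Prop where
  par : P.HasPar s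
  tb : s.v .tb = b * 2 ^ P.u
  stamp : s.v .stamp = b * 2 ^ P.u + c + 1
  lo : s.v .lo = P.lo b c
  hi : s.v .hi = P.lo (b + 1) c

def charVars : List Var := .tb :: .stamp :: .lo :: .hi :: Inst.parVars

theorem CharCtx.congr {P : Inst} {b c : ℕ} {s s' : St} (h : CharCtx P b c s)
    (hv : ∀ x ∈ charVars, s'.v x = s.v x) : CharCtx P b c s' := by
  refine ⟨h.par.congr fun x hx => hv x (by simp [charVars, hx]), ?_, ?_, ?_, ?_⟩
  · rw [hv _ (by simp [charVars]), h.tb]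
  · rw [hv _ (by simp [charVars]), h.stamp]
  · rw [hv _ (by simp [charVars]), h.lo]
  · rw [hv _ (by simp [charVars]), h.hi]

theorem CharCtx.tick {P : Inst} {b c : ℕ} {s : St} (h : CharCtx P b c s) (k : ℕ) :
    CharCtx P b c (s.tick k) := h.congr fun _ _ => rfl

theorem CharCtx.set {P : Inst} {b c : ℕ} {s : St} (h : CharCtx P b c s) (x : Var) (k : ℕ)
    (hx : x ∉ charVars) : CharCtx P b c (s.set x k) :=
  h.congr fun y hy => by
    rw [St.set_v, if_neg]; rintro rfl; exact hx hy

theorem CharCtx.frame {P : Inst} {b c : ℕ} {s s' : St} {p : Stmt} (h : CharCtx P b c s)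
    (hf : Frame p s s') (hp : charVars.all (fun x => !p.writes x) = true) : CharCtx P b c s' :=
  h.congr fun x hx => hf.v x (by simpa using List.all_eq_true.1 hp x hx)

open Var in
/-- Add the key `col` with its value to the list, unless it is there already. -/
def addKey : Stmt :=
  .ite .ne (.get .mark col) stamp
    (.put .mark col stamp ;; .put .xs cnt col ;;
      .set tau (.shl col sh + tb) ;; .set l lo ;; .set h hi ;; bsearch (u + 1) ;;
      .put .xv cnt l ;; .set cnt (cnt + 1)) .skip

section
variable {P : Inst} {E : Env}

theorem addKey_spec (hF : P.Fits E) {s : St} {b c i col : ℕ}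
    (hA : P.IsPos (s.a .ps)) (hb : b < P.nb) (hc : CharCtx P b c s)
    (hsh : s.v .sh = P.g * i) (hcol : s.v .col = col)
    (hkey : P.IsKey (s.a .ps) b c i col) (hcnt : s.v .cnt < 2 ^ P.m)
    (hL : P.Listed (s.a .ps) b c (b * 2 ^ P.u + c + 1) (s.a .mark) (s.a .xs) (s.a .xv) (s.v .cnt)) :
    wp E addKey s fun s' =>
      P.Listed (s.a .ps) b c (b * 2 ^ P.u + c + 1) (s'.a .mark) (s'.a .xs) (s'.a .xv) (s'.v .cnt) ∧
      s'.v .cnt ≤ s.v .cnt + 1 ∧ s'.a .mark col = b * 2 ^ P.u + c + 1 ∧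
      (∀ x, s.a .mark x = b * 2 ^ P.u + c + 1 → s'.a .mark x = b * 2 ^ P.u + c + 1) ∧
      (∀ x, s'.a .mark x = b * 2 ^ P.u + c + 1 ∨ s'.a .mark x = s.a .mark x) ∧
      s'.t ≤ s.t + 150 + 30 * P.u := by
  obtain ⟨w1, w2, w3⟩ := hF.wide
  have f1 := hF.tree_le
  have f2 := hF.blocks_le
  have f3 := hF.n_lt
  obtain ⟨k1, k2⟩ := hkey.lt hA
  have hpow : 2 ^ (P.m + 1) = 2 * 2 ^ P.m := by ring
  have htb : b * 2 ^ P.u + 2 ^ P.u ≤ (P.nb + 1) * 2 ^ P.u := by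
    rw [← Nat.succ_mul]; exact Nat.mul_le_mul_right _ (by omega)
  have hub := P.pow_m_ge
  have hu : P.u < 2 ^ P.u := Nat.lt_two_pow_self
  unfold addKey
  refine wp_ite (by simp [hcol]; omega) (by simp) (fun h => ?_) (fun h => ?_)
  · simp [hcol, hc.stamp] at h
    simp only [wp_seq, wp_put, wp_set]
    simp [hc.stamp, hcol, hsh, hc.tb, hc.lo, hc.hi]
    refine ⟨by omega, by omega, by omega, ?_⟩
    refine (bsearch_spec (P.cut b c (col * 2 ^ (P.g * i) + b * 2 ^ P.u)) ?_ hF.wide ?_ ?_ ?_ ?_ ?_ ?_).mono ?_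
    · simp [hc.par.u]; omega
    · simpa using Inst.le_cut _ _ _
    · simpa using Inst.cut_le _ _ _
    · simp [hc.par.bu]
      exact fun j h1 h2 => hA.lt_cut_iff h1 h2
    · simp [hc.par.u]
      have h1 := P.sum_block_le b
      have h2 := Inst.S_add_R_le (P := P) c ((b + 1) * 2 ^ P.u)
      have h3 : P.lo (b + 1) c - P.lo b c ≤ 2 ^ P.u := by
        unfold Inst.lo
        have : P.R c (b * 2 ^ P.u + 2 ^ P.u) ≤ P.R c (b * 2 ^ P.u) + 2 ^ P.u := by
          unfold Inst.R; rw [Nat.count_add]; exact Nat.add_le_add_left (Nat.count_le _) _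
        rw [← Nat.succ_mul, Nat.succ_eq_add_one] at this
        omega
      have h4 : 0 < 2 ^ P.u := by positivity
      rw [pow_succ]; omega
    · simp
      have := Inst.lo_le_n (P := P) (b + 1) c
      omega
    · simp [hc.par.bu]
      intro j h1 h2
      have := (hA.block_mem h1 h2).2.2
      omega
    · intro s' hf ⟨g1, g2⟩
      have e1 : s'.a .mark = Function.update (s.a .mark) col (b * 2 ^ P.u + c + 1) := by
        rw [hf.a _ rfl]; simp
      have e2 : s'.a .xs = Function.update (s.a .xs) (s.v .cnt) col := by
        rw [hf.a _ rfl]; simp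
      have e3 : s'.a .xv = s.a .xv := by
        rw [hf.a _ rfl]; simp
      have e4 : s'.v .cnt = s.v .cnt := by
        rw [hf.v _ rfl]; simp
      simp [e1, e2, e3, e4, g1]
      simp [hc.par.u] at g2
      refine ⟨by omega, by omega, ?_, ?_, ?_, by omega⟩
      · refine ⟨fun j hj => ?_, fun x => ?_, fun j hj j' hj' he => ?_⟩
        · rcases Nat.lt_succ_iff_lt_or_eq.1 hj with hj | rfl
          · simpa [Function.update_of_ne hj.ne] using hL.isKey j hj
          · exact ⟨i, by simpa using hkey, by simp [Inst.keyVal]⟩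
        · by_cases hx : x = col
          · subst hx
            simp only [Function.update_self, true_iff]
            exact ⟨s.v .cnt, by omega, by simp⟩
          · rw [Function.update_of_ne hx, hL.mark]
            constructor
            · rintro ⟨j, hj, rfl⟩
              exact ⟨j, by omega, by simp [Function.update_of_ne hj.ne]⟩
            · rintro ⟨j, hj, hj'⟩
              rcases Nat.lt_succ_iff_lt_or_eq.1 hj with hj | rfl
              · rw [Function.update_of_ne hj.ne] at hj'
                exact ⟨j, hj, hj'⟩
              · rw [Function.update_self] at hj'
                exact absurd hj'.symm hx
        · have hnew : ∀ j < s.v .cnt, s.a .xs j ≠ col := fun j hj he =>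
            h ((hL.mark col).2 ⟨j, hj, he⟩)
          rcases Nat.lt_succ_iff_lt_or_eq.1 hj with hj | rfl <;>
            rcases Nat.lt_succ_iff_lt_or_eq.1 hj' with hj' | rfl
          · rw [Function.update_of_ne hj.ne, Function.update_of_ne hj'.ne] at he
            exact hL.inj j hj j' hj' he
          · rw [Function.update_of_ne hj.ne, Function.update_self] at he
            exact absurd he (hnew j hj)
          · rw [Function.update_of_ne hj'.ne, Function.update_self] at he
            exact absurd he.symm (hnew j' hj')
          · rfl
      · intro x hx
        rw [Function.update_apply]; split <;> simp [hx]
      · intro x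
        rw [Function.update_apply]; split <;> simp
  · simp [hcol, hc.stamp] at h
    simp [h]
    exact ⟨hL, by omega⟩

open Var in
/-- List the keys of the current character. -/
def collectKeys : Stmt :=
  .set cnt 0 ;;
  .loop r (.shr (hi - lo) kap)
    (.set v ((bu + .get .ps ((lo + .shl (r + 1) kap) - 1)) - tb) ;;
      .loop i lv (.set sh (g * i) ;; .set col0 (.shl (.shr v (sh + g)) g) ;;
        .loop d bg (.set col (col0 + d) ;; addKey)))

theorem Inst.ns_le_maxKeys {b c : ℕ} (hc : c < P.sig) :
    P.ns b c * (P.lv * 2 ^ P.g) ≤ P.maxKeys b :=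
  Finset.single_le_sum (f := fun c => P.ns b c * (P.lv * 2 ^ P.g)) (fun _ _ => Nat.zero_le _)
    (Finset.mem_range.2 hc)

theorem Inst.two_mul_maxKeys_lt (b : ℕ) : 2 * P.maxKeys b < 2 ^ P.m := by
  have := P.maxKeys_bound b
  nlinarith

theorem collectKeys_spec (hF : P.Fits E) {s : St} {b c : ℕ}
    (hA : P.IsPos (s.a .ps)) (hb : b < P.nb) (hc : CharCtx P b c s) (hcs : c < P.sig)
    (hm : ∀ x, s.a .mark x ≠ b * 2 ^ P.u + c + 1) :
    wp E collectKeys s fun s' =>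
      P.Listed (s.a .ps) b c (b * 2 ^ P.u + c + 1) (s'.a .mark) (s'.a .xs) (s'.a .xv) (s'.v .cnt) ∧
      s'.v .cnt ≤ P.ns b c * (P.lv * 2 ^ P.g) ∧
      (∀ i col, P.IsKey (s.a .ps) b c i col → ∃ j < s'.v .cnt, s'.a .xs j = col) ∧
      (∀ x, s'.a .mark x = b * 2 ^ P.u + c + 1 ∨ s'.a .mark x = s.a .mark x) ∧
      s'.t ≤ s.t + 50 + P.ns b c * (60 + P.lv * (60 + 2 ^ P.g * (200 + 30 * P.u))) := by
  obtain ⟨w1, w2, w3⟩ := hF.wide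
  have f1 := hF.tree_le
  have f3 := hF.n_lt
  have hpow : 2 ^ (P.m + 1) = 2 * 2 ^ P.m := by ring
  have hub := P.pow_m_ge
  have hm0 : P.m < 2 ^ P.m := Nat.lt_two_pow_self
  have hkk := (Inst.ns_le_maxKeys (b := b) hcs).trans_lt
    (lt_of_le_of_lt (Nat.le_mul_of_pos_left _ two_pos) (P.two_mul_maxKeys_lt b))
  have hlole := P.lo_le b c
  have hlon := Inst.lo_le_n (P := P) (b + 1) c
  set st := b * 2 ^ P.u + c + 1 with hst
  set A := s.a .ps with hAdef
  unfold collectKeys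
  simp only [wp_seq, wp_set]
  refine ⟨by simp, ?_⟩
  refine wp_loop (fun r s' => P.Listed A b c st (s'.a .mark) (s'.a .xs) (s'.a .xv) (s'.v .cnt) ∧
      s'.v .cnt ≤ r * (P.lv * 2 ^ P.g) ∧
      (∀ r' < r, ∀ i < P.lv, ∀ col, col / 2 ^ P.g = P.vcode A b c r' / 2 ^ (P.g * (i + 1)) →
        s'.a .mark col = st) ∧
      (∀ x, s'.a .mark x = st ∨ s'.a .mark x = s.a .mark x) ∧
      s'.t ≤ s.t + 50 + r * (60 + P.lv * (60 + 2 ^ P.g * (200 + 30 * P.u)))) ?_ ?_ ?_ ?_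
  · simp [hc.hi, hc.lo]; omega
  · simp
    exact ⟨by simp, by simpa using hm, by simp⟩
  · simp only [Ex.eval_shr, Ex.eval_sub, Ex.eval_var, St.tick_v, St.set_v, reduceCtorEq, if_false,
      hc.hi, hc.lo, hc.par.kap]
    intro r hr s₁ hf₁ ⟨hL, hK, hall, hold, ht⟩
    have hr : r < P.ns b c := hr
    have c₁ : CharCtx P b c s₁ := CharCtx.frame ((hc.set _ _ (by decide)).tick _) hf₁ rfl
    have eps : s₁.a .ps = A := by rw [hf₁.a _ rfl]; rfl
    obtain ⟨m1, m2⟩ := Inst.samp_mem hr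
    obtain ⟨v1, v2⟩ := Inst.vcode_mem hA hr
    obtain ⟨p1, p2, p3⟩ := hA.block_mem m1 m2
    have hrk : (r + 1) * 2 ^ P.kap ≤ P.lo (b + 1) c - P.lo b c :=
      (Nat.mul_le_mul_right _ hr).trans (Nat.div_mul_le_self _ _)
    have hrk0 : 0 < (r + 1) * 2 ^ P.kap := by positivity
    have hg0 : 0 < 2 ^ P.g := by positivity
    have hr1 : r + 1 ≤ (r + 1) * 2 ^ P.kap := Nat.le_mul_of_pos_right _ (by positivity)
    have hsamp : P.lo b c + (r + 1) * 2 ^ P.kap - 1 = P.samp b c r := rfl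
    have hrr : (r + 1) * (P.lv * 2 ^ P.g) ≤ P.ns b c * (P.lv * 2 ^ P.g) := Nat.mul_le_mul_right _ hr
    rw [Nat.add_mul, one_mul] at hrr
    simp only [wp_seq, wp_set]
    refine ⟨?_, ?_⟩
    · simp [c₁.par.bu, c₁.lo, c₁.par.kap, c₁.tb, eps, hsamp]
      omega
    refine wp_loop (fun i s' => P.Listed A b c st (s'.a .mark) (s'.a .xs) (s'.a .xv) (s'.v .cnt) ∧
      s'.v .cnt ≤ r * (P.lv * 2 ^ P.g) + i * 2 ^ P.g ∧
      (∀ x, s₁.a .mark x = st → s'.a .mark x = st) ∧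
      (∀ i' < i, ∀ col, col / 2 ^ P.g = P.vcode A b c r / 2 ^ (P.g * (i' + 1)) →
        s'.a .mark col = st) ∧
      (∀ x, s'.a .mark x = st ∨ s'.a .mark x = s.a .mark x) ∧
      s'.t ≤ s₁.t + 40 + i * (60 + 2 ^ P.g * (200 + 30 * P.u))) ?_ ?_ ?_ ?_
    · simp
    · simp
      exact ⟨hL, hK, hold⟩
    · simp only [Ex.eval_var, St.tick_v, St.set_v, reduceCtorEq, if_false, c₁.par.lv]
      intro i hi s₂ hf₂ ⟨hL₂, hK₂, hmono₂, hall₂, hold₂, ht₂⟩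
      have c₂ : CharCtx P b c s₂ :=
        CharCtx.frame ((((c₁.set _ _ (by decide)).tick _).set _ _ (by decide)).tick _) hf₂ rfl
      have ev : s₂.v .v = P.vcode A b c r := by
        rw [hf₂.v _ rfl]
        simp [c₁.par.bu, c₁.lo, c₁.par.kap, c₁.tb, eps, hsamp, Inst.vcode]
      have hgi : P.g * i + P.g ≤ P.u + P.g := by
        have h1 := P.g_mul_lv_le
        have h2 : P.g * (i + 1) ≤ P.g * P.lv := Nat.mul_le_mul_left _ hi
        rw [Nat.mul_add] at h2; omega
      have hum : P.u + P.g ≤ P.m := by unfold Inst.m; omega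
      set col0 := P.vcode A b c r / 2 ^ (P.g * i + P.g) * 2 ^ P.g with hcol0
      have hdiv : ∀ d < 2 ^ P.g, (col0 + d) / 2 ^ P.g = P.vcode A b c r / 2 ^ (P.g * (i + 1)) := by
        intro d hd
        rw [hcol0, mul_comm, Nat.mul_add_div (by positivity), Nat.div_eq_of_lt hd, add_zero,
          Nat.mul_add, mul_one]
      have hkey : ∀ d < 2 ^ P.g, P.IsKey A b c i (col0 + d) := fun d hd =>
        ⟨hi, r, hr, hdiv d hd⟩
      have hc0 := ((hkey 0 (by positivity)).lt hA).1
      have hii : (i + 1) * 2 ^ P.g ≤ P.lv * 2 ^ P.g := Nat.mul_le_mul_right _ hi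
      rw [Nat.add_mul, one_mul] at hii
      simp only [wp_seq, wp_set]
      refine ⟨?_, ?_, ?_⟩
      · simp [c₂.par.g]; omega
      · simp [c₂.par.g, ev, ← hcol0]; omega
      refine wp_loop (fun d s' => P.Listed A b c st (s'.a .mark) (s'.a .xs) (s'.a .xv) (s'.v .cnt) ∧
        s'.v .cnt ≤ r * (P.lv * 2 ^ P.g) + i * 2 ^ P.g + d ∧
        (∀ x, s₂.a .mark x = st → s'.a .mark x = st) ∧
        (∀ d' < d, s'.a .mark (col0 + d') = st) ∧
        (∀ x, s'.a .mark x = st ∨ s'.a .mark x = s.a .mark x) ∧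
        s'.t ≤ s₂.t + 40 + d * (200 + 30 * P.u)) ?_ ?_ ?_ ?_
      · simp
      · simp
        exact ⟨hL₂, hK₂, hold₂⟩
      · simp only [Ex.eval_var, St.tick_v, St.set_v, reduceCtorEq, if_false, c₂.par.bg]
        intro d hd s₃ hf₃ ⟨hL₃, hK₃, hmono₃, hall₃, hold₃, ht₃⟩
        have c₃ : CharCtx P b c s₃ :=
          CharCtx.frame ((((((c₂.set _ _ (by decide)).tick _).set _ _ (by decide)).tick _).set _ _
            (by decide)).tick _) hf₃ rfl
        have ec : s₃.v .col0 = col0 := by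
          rw [hf₃.v _ rfl]
          simp [c₂.par.g, ev, hcol0]
        have es : s₃.v .sh = P.g * i := by
          rw [hf₃.v _ rfl]
          simp [c₂.par.g]
        have eps₃ : s₃.a .ps = A := by
          rw [hf₃.a _ rfl, ← eps]
          simp only [St.tick_a, St.set_a]
          rw [hf₂.a _ rfl]; rfl
        have hk := hkey d hd
        have hklt := (hk.lt hA).1
        simp only [wp_seq, wp_set]
        refine ⟨by simp [ec]; omega, ?_⟩
        refine (addKey_spec hF (b := b) (c := c) (i := i) (col := col0 + d) ?_ hb ?_ ?_ ?_ ?_ ?_ ?_).mono ?_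
        · simpa [eps₃] using hA
        · exact (((c₃.set _ _ (by decide)).tick _).set _ _ (by decide)).tick _
        · simp [es]
        · simp [ec]
        · simpa [eps₃] using hk
        · simp; omega
        · simpa [eps₃] using hL₃
        · simp [eps₃]
          intro s' hf g1 g2 g3 g4 g5 g6
          refine ⟨g1, by omega, fun x hx => g4 x (hmono₃ x hx), fun d' hd' => ?_, fun x => ?_, ?_⟩
          · rcases Nat.lt_or_eq_of_le hd' with h | rfl
            · exact g4 _ (hall₃ d' h)
            · exact g3
          · rcases g5 x with h | h
            · exact Or.inl h
            · rw [h]; exact hold₃ x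
          · rw [Nat.add_mul]; omega
      · simp only [Ex.eval_var, St.tick_v, St.set_v, reduceCtorEq, if_false, c₂.par.bg]
        intro s' hf ⟨hL₃, hK₃, hmono₃, hall₃, hold₃, ht₃⟩
        refine ⟨hL₃, by rw [Nat.add_mul]; omega, fun x hx => hmono₃ x (hmono₂ x hx),
          fun i' hi' col hcol => ?_, hold₃, by rw [Nat.add_mul]; omega⟩
        rcases Nat.lt_succ_iff_lt_or_eq.1 hi' with h | rfl
        · exact hmono₃ _ (hall₂ i' h col hcol)
        · have h1 := Nat.div_add_mod col (2 ^ P.g)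
          have h2 := Nat.mod_lt col (show 0 < 2 ^ P.g by positivity)
          have h3 := hall₃ (col % 2 ^ P.g) h2
          rw [hcol, Nat.mul_add, mul_one, mul_comm, ← hcol0] at h1
          rwa [h1] at h3
    · simp only [Ex.eval_var, St.tick_v, St.set_v, reduceCtorEq, if_false, c₁.par.lv]
      intro s' hf ⟨hL₂, hK₂, hmono₂, hall₂, hold₂, ht₂⟩
      refine ⟨hL₂, by rw [Nat.add_mul, one_mul]; omega, fun r' hr' i hi col hcol => ?_, hold₂,
        by rw [Nat.add_mul]; omega⟩
      rcases Nat.lt_succ_iff_lt_or_eq.1 hr' with h | rfl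
      · exact hmono₂ _ (hall r' h i hi col hcol)
      · exact hall₂ i hi col hcol
  · simp only [Ex.eval_shr, Ex.eval_sub, Ex.eval_var, St.tick_v, St.set_v, reduceCtorEq, if_false,
      hc.hi, hc.lo, hc.par.kap]
    intro s' hf ⟨hL, hK, hall, hold, ht⟩
    refine ⟨hL, hK, ?_, hold, ht⟩
    rintro i col ⟨hi, r, hr, he⟩
    exact (hL.mark col).1 (hall r hr i hi col he)

end

end WordRAM

namespace WordRAM

/-! ### Buckets -/

/-- The linked list that starts at `p` begins with the pairs of `l`. -/
def Chain (kc kv nx : ℕ → ℕ) (nk : ℕ) : ℕ → List (ℕ × ℕ) → Prop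
  | _, [] => True
  | p, e :: l => ∃ id < nk, p = id + 1 ∧ kc id = e.1 ∧ kv id = e.2 ∧ Chain kc kv nx nk (nx id) l

theorem Chain.mono {kc kv nx kc' kv' nx' : ℕ → ℕ} {nk nk' : ℕ} (hnk : nk ≤ nk')
    (h1 : ∀ i < nk, kc' i = kc i) (h2 : ∀ i < nk, kv' i = kv i) (h3 : ∀ i < nk, nx' i = nx i) :
    ∀ {l : List (ℕ × ℕ)} {p : ℕ}, Chain kc kv nx nk p l → Chain kc' kv' nx' nk' p l
  | [], _, _ => trivial
  | _ :: _, _, ⟨id, hid, hp, hc, hv, h⟩ =>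
    ⟨id, hid.trans_le hnk, hp, (h1 id hid).trans hc, (h2 id hid).trans hv,
      (h3 id hid) ▸ h.mono hnk h1 h2 h3⟩

/-- The linked lists of the arrays represent the buckets `bk`, of which there are `2 ^ m`, and the
weights are the powers of two of their sizes. -/
structure Buckets (m base nk : ℕ) (bk : ℕ → List (ℕ × ℕ)) (s : St) : Prop where
  chain : ∀ y < 2 ^ m, Chain (s.a .kc) (s.a .kv) (s.a .nxt) nk (s.a .head (base + y)) (bk y)
  len : ∀ y < 2 ^ m, s.a .len (base + y) = (bk y).length
  tree : IsTree m (fun y => 2 ^ (bk y).length) (s.a .tree)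

/-- The sum of the weights of the buckets. -/
def weight (m : ℕ) (bk : ℕ → List (ℕ × ℕ)) : ℕ := total m fun y => 2 ^ (bk y).length

/-- The number of elements of the buckets. -/
def size (m : ℕ) (bk : ℕ → List (ℕ × ℕ)) : ℕ := total m fun y => (bk y).length

/-- Add an element to a bucket. -/
def pushTo (bk : ℕ → List (ℕ × ℕ)) (y : ℕ) (e : ℕ × ℕ) : ℕ → List (ℕ × ℕ) :=
  Function.update bk y (e :: bk y)

theorem weight_pushTo {m y : ℕ} (bk : ℕ → List (ℕ × ℕ)) (e : ℕ × ℕ) (hy : y < 2 ^ m) :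
    weight m (pushTo bk y e) = weight m bk + 2 ^ (bk y).length := by
  unfold weight
  rw [← total_update (ω := fun y => 2 ^ (bk y).length) hy]
  congr 1
  ext z
  by_cases h : z = y
  · subst h; simp [pushTo, pow_succ]; ring
  · simp [pushTo, h]

theorem size_pushTo {m y : ℕ} (bk : ℕ → List (ℕ × ℕ)) (e : ℕ × ℕ) (hy : y < 2 ^ m) :
    size m (pushTo bk y e) = size m bk + 1 := by
  unfold size
  rw [← total_update (ω := fun y => (bk y).length) hy]
  congr 1
  ext z
  by_cases h : z = y
  · subst h; simp [pushTo]
  · simp [pushTo, h]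

open Var in
/-- Put the `i`-th key of the current character into its bucket. -/
def pushKey : Stmt :=
  .set y (.xor (.get .xs i) dd) ;; bump ;;
    .put .kc nk c ;; .put .kv nk (.get .xv i) ;; .put .nxt nk (.get .head (base + y)) ;;
    .set nk (nk + 1) ;; .put .head (base + y) nk ;;
    .put .len (base + y) (.get .len (base + y) + 1)

section
variable {P : Inst} {E : Env}

theorem pushKey_spec (hF : P.Fits E) {s : St} {base : ℕ} {bk : ℕ → List (ℕ × ℕ)}
    (hp : P.HasPar s) (hbase : s.v .base = base) (hb : base + 2 ^ P.m ≤ E.amax)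
    (hi : s.v .i < E.amax) (hx : s.a .xs (s.v .i) ^^^ s.v .dd < 2 ^ P.m)
    (hnk : s.v .nk + 1 < E.amax)
    (hB : Buckets P.m base (s.v .nk) bk s) (hw : 2 * weight P.m bk < 2 ^ E.w) :
    wp E pushKey s fun s' =>
      Buckets P.m base (s.v .nk + 1) (pushTo bk (s.a .xs (s.v .i) ^^^ s.v .dd)
        (s.v .c, s.a .xv (s.v .i))) s' ∧ s'.v .nk = s.v .nk + 1 ∧
      (∀ x, x < base ∨ base + 2 ^ P.m ≤ x →
        s'.a .head x = s.a .head x ∧ s'.a .len x = s.a .len x) ∧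
      s'.t ≤ s.t + 200 + 40 * P.m := by
  obtain ⟨w1, w2, w3⟩ := hF.wide
  set y := s.a .xs (s.v .i) ^^^ s.v .dd with hy
  unfold pushKey
  simp only [wp_seq, wp_set]
  refine ⟨by simp [hi], ?_⟩
  refine (bump_spec (m := P.m) (y := y) (ω := fun y => 2 ^ (bk y).length) hF.wide ?_ ?_ hF.tree_le
    ?_ hx ?_ hw).mono ?_
  · simp [hp.m]
  · simp [hp.bm]
  · simp [hy]
  · simpa using hB.tree
  intro s₁ hf₁ ⟨htree, ht⟩
  have ebase : s₁.v .base = base := by rw [hf₁.v _ rfl]; simp [hbase]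
  have ey : s₁.v .y = y := by rw [hf₁.v _ rfl]; simp [hy]
  have ei : s₁.v .i = s.v .i := by rw [hf₁.v _ rfl]; simp
  have enk : s₁.v .nk = s.v .nk := by rw [hf₁.v _ rfl]; simp
  have ec : s₁.v .c = s.v .c := by rw [hf₁.v _ rfl]; simp
  have exv : s₁.a .xv = s.a .xv := by rw [hf₁.a _ rfl]; simp
  have ekc : s₁.a .kc = s.a .kc := by rw [hf₁.a _ rfl]; simp
  have ekv : s₁.a .kv = s.a .kv := by rw [hf₁.a _ rfl]; simp
  have enxt : s₁.a .nxt = s.a .nxt := by rw [hf₁.a _ rfl]; simp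
  have ehead : s₁.a .head = s.a .head := by rw [hf₁.a _ rfl]; simp
  have elen : s₁.a .len = s.a .len := by rw [hf₁.a _ rfl]; simp
  have hlen := hB.len y hx
  have hlt : (bk y).length < 2 ^ (bk y).length := Nat.lt_two_pow_self
  have hle : 2 ^ (bk y).length ≤ weight P.m bk := by
    have : blk P.m (fun y => 2 ^ (bk y).length) 0 y ≤ weight P.m bk := blk_le_total
    rwa [blk_zero hx] at this
  simp [ebase, ey, ei, enk, ec, exv, ehead, elen, hlen]
  simp at ht
  refine ⟨by omega, by omega, by omega, by omega, by omega, by omega, ⟨?_, ?_, ?_⟩, ?_, by omega⟩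
  · intro z hz
    have hmono : Chain (Function.update (s.a .kc) (s.v .nk) (s.v .c))
        (Function.update (s.a .kv) (s.v .nk) (s.a .xv (s.v .i)))
        (Function.update (s.a .nxt) (s.v .nk) (s.a .head (base + y))) (s.v .nk + 1)
        (s.a .head (base + z)) (bk z) :=
      (hB.chain z hz).mono (by omega) (fun i hi => Function.update_of_ne hi.ne _ _)
        (fun i hi => Function.update_of_ne hi.ne _ _) (fun i hi => Function.update_of_ne hi.ne _ _)
    by_cases h : z = y
    · subst h
      simp [pushTo, ekc, ekv, enxt, ehead]
      refine ⟨s.v .nk, by omega, rfl, by simp, by simp, ?_⟩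
      simpa using hmono
    · simpa [pushTo, h, ekc, ekv, enxt, ehead] using hmono
  · intro z hz
    by_cases h : z = y
    · subst h; simp [pushTo]
    · simp [pushTo, h, elen, hB.len z hz]
  · have : (fun z => 2 ^ (pushTo bk y (s.v .c, s.a .xv (s.v .i)) z).length) =
        Function.update (fun y => 2 ^ (bk y).length) y (2 ^ (bk y).length + 2 ^ (bk y).length) := by
      ext z
      by_cases h : z = y
      · subst h; simp [pushTo, pow_succ]; ring
      · simp [pushTo, h]
    rw [this]
    simpa using htree
  · intro x hx'
    rw [Function.update_of_ne (by omega), Function.update_of_ne (by omega)]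
    exact ⟨rfl, rfl⟩

open Var in
/-- Choose a displacement for the keys of the current character and put them into buckets. -/
def placeChar : Stmt :=
  .ite .lt 0 cnt (chooseDisp ;; .put .disp1 (base + c) dd ;; .loop i cnt pushKey) .skip

theorem placeChar_spec (hF : P.Fits E) {s : St} {base : ℕ} {bk : ℕ → List (ℕ × ℕ)}
    (hp : P.HasPar s) (hbase : s.v .base = base) (hb : base + 2 ^ P.m ≤ E.amax)
    (hc : s.v .c < 2 ^ P.m) (hd1 : s.a .disp1 (base + s.v .c) < 2 ^ P.m)
    (hxs : ∀ j < s.v .cnt, s.a .xs j < 2 ^ P.m)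
    (hinj : ∀ j < s.v .cnt, ∀ j' < s.v .cnt, s.a .xs j = s.a .xs j' → j = j')
    (hnk : s.v .nk + s.v .cnt ≤ 2 ^ P.m)
    (hB : Buckets P.m base (s.v .nk) bk s) (hw : weight P.m bk ≤ 2 * 2 ^ P.m)
    (hlt : ∀ y < 2 ^ P.m, ∀ e ∈ bk y, e.1 < s.v .c)
    (hnd : ∀ y < 2 ^ P.m, ((bk y).map Prod.fst).Nodup) :
    wp E placeChar s fun s' => ∃ bk',
      Buckets P.m base (s.v .nk + s.v .cnt) bk' s' ∧ s'.v .nk = s.v .nk + s.v .cnt ∧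
      s'.a .disp1 (base + s.v .c) < 2 ^ P.m ∧
      (∀ y < 2 ^ P.m, ∀ e, e ∈ bk' y ↔ e ∈ bk y ∨
        ∃ j < s.v .cnt, s.a .xs j ^^^ s'.a .disp1 (base + s.v .c) = y ∧
          e = (s.v .c, s.a .xv j)) ∧
      (∀ y < 2 ^ P.m, ((bk' y).map Prod.fst).Nodup) ∧
      size P.m bk' = size P.m bk + s.v .cnt ∧
      weight P.m bk' ≤ weight P.m bk + 2 * s.v .cnt ∧
      (∀ x, x ≠ base + s.v .c → s'.a .disp1 x = s.a .disp1 x) ∧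
      (∀ x, x < base ∨ base + 2 ^ P.m ≤ x →
        s'.a .head x = s.a .head x ∧ s'.a .len x = s.a .len x) ∧
      s'.t ≤ s.t + 60 + s.v .cnt * (300 + 180 * P.m) := by
  obtain ⟨w1, w2, w3⟩ := hF.wide
  have f1 := hF.tree_le
  have f2 := hF.sq_lt
  have hpow : 2 ^ (P.m + 1) = 2 * 2 ^ P.m := by ring
  have hsq : 2 ^ (2 * P.m + 4) = 16 * (2 ^ P.m * 2 ^ P.m) := by ring
  have hpos : 0 < 2 ^ P.m := by positivity
  have hsq2 : 2 ^ P.m * 1 ≤ 2 ^ P.m * 2 ^ P.m := Nat.mul_le_mul_left _ hpos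
  set K := s.v .cnt with hK
  have hKw : K * weight P.m bk ≤ 2 ^ P.m * (2 * 2 ^ P.m) := Nat.mul_le_mul (by omega) hw
  have hKw' : K * weight P.m bk ≤ K * (2 * 2 ^ P.m) := Nat.mul_le_mul_left _ hw
  unfold placeChar
  refine wp_ite (by simp) (by simp) (fun h => ?_) (fun h => ?_)
  · simp [← hK] at h
    simp only [wp_seq, wp_put]
    refine (chooseDisp_spec (m := P.m) (k := K) (ω := fun y => 2 ^ (bk y).length) hF.wide
      (by simp [hp.m]) (by simp [hp.bm]) f1 (by simp [hK]) (by omega) (by simpa using hxs)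
      (by simpa using hB.tree) ?_).mono ?_
    · change K * weight P.m bk < _
      rw [show 2 ^ P.m * (2 * 2 ^ P.m) = 2 * (2 ^ P.m * 2 ^ P.m) by ring] at hKw
      omega
    intro s₁ hf₁ ⟨hdd, hsum, ht⟩
    simp only [St.tick_a, St.tick_t] at hsum ht
    set d := s₁.v .dd with hd
    have hsum' : ∑ j ∈ Finset.range K, 2 ^ (bk (s.a .xs j ^^^ d)).length ≤ 2 * K := by
      refine Nat.le_of_mul_le_mul_left (c := 2 ^ P.m) ?_ hpos
      refine hsum.trans (hKw'.trans ?_)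
      rw [mul_left_comm, mul_left_comm (2 ^ P.m), mul_comm (2 ^ P.m)]
    have hxd : ∀ j < K, s.a .xs j ^^^ d < 2 ^ P.m := fun j hj => Nat.xor_lt_two_pow (hxs j hj) hdd
    have p₁ : P.HasPar s₁ := Inst.HasPar.frame (by simpa using hp) hf₁ rfl
    have ebase : s₁.v .base = base := by rw [hf₁.v _ rfl]; simp [hbase]
    have ec : s₁.v .c = s.v .c := by rw [hf₁.v _ rfl]; simp
    have ecnt : s₁.v .cnt = K := by rw [hf₁.v _ rfl]; simp [hK]
    have enk : s₁.v .nk = s.v .nk := by rw [hf₁.v _ rfl]; simp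
    have ea : ∀ q, s₁.a q = s.a q := fun q => by rw [hf₁.a _ rfl]; simp
    refine ⟨?_, ?_⟩
    · simp [ebase, ec]; omega
    refine wp_loop (fun q s' => ∃ bk', Buckets P.m base (s.v .nk + q) bk' s' ∧
      s'.v .nk = s.v .nk + q ∧
      (∀ y < 2 ^ P.m, ∀ e, e ∈ bk' y ↔ e ∈ bk y ∨
        ∃ j < q, s.a .xs j ^^^ d = y ∧ e = (s.v .c, s.a .xv j)) ∧
      (∀ y < 2 ^ P.m, ((bk' y).map Prod.fst).Nodup) ∧
      size P.m bk' = size P.m bk + q ∧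
      weight P.m bk' = weight P.m bk + ∑ j ∈ Finset.range q, 2 ^ (bk (s.a .xs j ^^^ d)).length ∧
      (∀ y, (∀ j < q, s.a .xs j ^^^ d ≠ y) → bk' y = bk y) ∧
      (∀ x, x < base ∨ base + 2 ^ P.m ≤ x →
        s'.a .head x = s.a .head x ∧ s'.a .len x = s.a .len x) ∧
      s'.t ≤ s₁.t + 20 + q * (210 + 40 * P.m)) (by simp) ?_ ?_ ?_
    · refine ⟨bk, ⟨?_, ?_, ?_⟩, ?_⟩
      · simpa [ea] using hB.chain
      · simpa [ea] using hB.len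
      · simpa [ea] using hB.tree
      · simp [enk, ea]
        exact hnd
    · simp only [Ex.eval_var, ecnt, St.tick_v, St.put_v]
      intro q hq s₂ hf₂ ⟨bk', hB₂, enk₂, hmem, hnd₂, hsize, hweight, hsame, hout, ht₂⟩
      have p₂ : P.HasPar s₂ := Inst.HasPar.frame (by simpa using p₁) hf₂ rfl
      have ebase₂ : s₂.v .base = base := by rw [hf₂.v _ rfl]; simp [ebase]
      have ec₂ : s₂.v .c = s.v .c := by rw [hf₂.v _ rfl]; simp [ec]
      have ed₂ : s₂.v .dd = d := by rw [hf₂.v _ rfl]; simp [hd]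
      have exs₂ : s₂.a .xs = s.a .xs := by rw [hf₂.a _ rfl]; simp [ea]
      have exv₂ : s₂.a .xv = s.a .xv := by rw [hf₂.a _ rfl]; simp [ea]
      have hfresh : ∀ j < q, s.a .xs j ^^^ d ≠ s.a .xs q ^^^ d := fun j hj he =>
        hj.ne (hinj j (by omega) q hq (Nat.xor_left_inj.1 he))
      have hq' : ∑ j ∈ Finset.range q, 2 ^ (bk (s.a .xs j ^^^ d)).length ≤
          ∑ j ∈ Finset.range K, 2 ^ (bk (s.a .xs j ^^^ d)).length :=
        Finset.sum_le_sum_of_subset (Finset.range_mono hq.le)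
      have hK1 : K ≤ 2 ^ P.m := by omega
      refine (pushKey_spec (bk := bk') hF ?_ (by simp [ebase₂]) hb ?_ ?_ ?_ ⟨?_, ?_, ?_⟩ ?_).mono ?_
      · simpa using p₂.set .i q (by decide)
      · simp; omega
      · simpa [exs₂, ed₂] using hxd q hq
      · simp [enk₂]; omega
      · simpa [enk₂] using hB₂.chain
      · simpa using hB₂.len
      · simpa using hB₂.tree
      · omega
      · simp only [St.tick_v, St.set_v, St.tick_a, St.set_a, reduceCtorEq, if_false, if_true, ec₂, ed₂, exs₂,
          exv₂, enk₂, St.tick_t, St.set_t]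
        intro s' hf ⟨g1, g2, g3, g4⟩
        refine ⟨_, g1, g2, ?_, ?_, ?_, ?_, ?_, ?_, ?_⟩
        · intro y hy e
          by_cases h : y = s.a .xs q ^^^ d
          · rw [pushTo, h, Function.update_self, List.mem_cons, hmem _ (hxd q hq)]
            constructor
            · rintro (h' | h' | ⟨j, hj, h1, h2⟩)
              · exact Or.inr ⟨q, by omega, rfl, h'⟩
              · exact Or.inl h'
              · exact Or.inr ⟨j, by omega, h1, h2⟩
            · rintro (h' | ⟨j, hj, h1, h2⟩)
              · exact Or.inr (Or.inl h')
              · rcases Nat.lt_succ_iff_lt_or_eq.1 hj with hj | rfl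
                · exact Or.inr (Or.inr ⟨j, hj, h1, h2⟩)
                · exact Or.inl h2
          · rw [pushTo, Function.update_of_ne h, hmem y hy]
            constructor
            · rintro (h' | ⟨j, hj, h1, h2⟩)
              · exact Or.inl h'
              · exact Or.inr ⟨j, by omega, h1, h2⟩
            · rintro (h' | ⟨j, hj, h1, h2⟩)
              · exact Or.inl h'
              · rcases Nat.lt_succ_iff_lt_or_eq.1 hj with hj | rfl
                · exact Or.inr ⟨j, hj, h1, h2⟩
                · exact absurd h1.symm h
        · intro y hy
          by_cases h : y = s.a .xs q ^^^ d
          · rw [pushTo, h, Function.update_self, List.map_cons, List.nodup_cons]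
            refine ⟨?_, hnd₂ _ (hxd q hq)⟩
            rw [List.mem_map]
            rintro ⟨e, he, he'⟩
            rcases (hmem _ (hxd q hq) e).1 he with h' | ⟨j, hj, h1, h2⟩
            · have := hlt _ (hxd q hq) e h'
              simp only at he'
              omega
            · exact hfresh j hj h1
          · rw [pushTo, Function.update_of_ne h]
            exact hnd₂ y hy
        · rw [size_pushTo _ _ (hxd q hq), hsize, add_assoc]
        · rw [weight_pushTo _ _ (hxd q hq), hweight, hsame _ hfresh, Finset.sum_range_succ, add_assoc]
        · intro y hy
          rw [pushTo, Function.update_of_ne (hy q (by omega)).symm]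
          exact hsame y fun j hj => hy j (by omega)
        · intro x hx
          obtain ⟨h1, h2⟩ := g3 x hx
          obtain ⟨h3, h4⟩ := hout x hx
          exact ⟨h1.trans h3, h2.trans h4⟩
        · rw [Nat.add_mul]; omega
    · simp only [Ex.eval_var, ecnt, St.tick_v, St.put_v]
      intro s' hf ⟨bk', hB₂, enk₂, hmem, hnd₂, hsize, hweight, hsame, hout, ht₂⟩
      have ed1 : s'.a .disp1 = Function.update (s.a .disp1) (base + s.v .c) d := by
        rw [hf.a _ rfl]; simp [ea, ebase, ec, hd]
      refine ⟨bk', hB₂, enk₂, ?_, ?_, hnd₂, hsize, by omega, ?_, hout, ?_⟩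
      · simpa [ed1] using hdd
      · simpa [ed1] using hmem
      · intro x hx
        rw [ed1, Function.update_of_ne hx]
      · have h1 : P.m * (60 + 80 * K) ≤ K * (140 * P.m) := by
          have : P.m * 60 ≤ P.m * 60 * K := Nat.le_mul_of_pos_right _ h
          calc P.m * (60 + 80 * K) = P.m * 60 + P.m * 80 * K := by ring
            _ ≤ P.m * 60 * K + P.m * 80 * K := by omega
            _ = _ := by ring
        have h2 : K * (300 + 180 * P.m) = K * 90 + (K * (140 * P.m) + K * (210 + 40 * P.m)) := by ring
        simp at ht
        omega
  · simp [← hK] at h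
    simp only [wp_skip]
    rw [h]
    exact ⟨bk, ⟨hB.chain, hB.len, hB.tree⟩, rfl, hd1, by simp, hnd, rfl, by omega, fun _ _ => rfl,
      fun _ _ => ⟨rfl, rfl⟩, by simp⟩

end

end WordRAM

namespace WordRAM

/-- The sorted positions of the text and the boundaries of the blocks are in place. -/
structure Prepared (P : Inst) (s : St) : Prop where
  par : P.HasPar s
  sig : s.v .sig = P.sig
  pos : P.IsPos (s.a .ps)
  first : ∀ b ≤ P.nb, ∀ c < P.sig, s.a .first (b * 2 ^ P.u + c) = P.lo b c

theorem Prepared.congr {P : Inst} {s s' : St} (h : Prepared P s)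
    (hv : ∀ x ∈ Var.sig :: Inst.parVars, s'.v x = s.v x) (hps : s'.a .ps = s.a .ps)
    (hf : s'.a .first = s.a .first) : Prepared P s' := by
  refine ⟨h.par.congr fun x hx => hv x (by simp [hx]), ?_, hps ▸ h.pos, hf ▸ h.first⟩
  rw [hv _ (by simp), h.sig]

theorem Prepared.tick {P : Inst} {s : St} (h : Prepared P s) (k : ℕ) : Prepared P (s.tick k) :=
  h.congr (fun _ _ => rfl) rfl rfl

theorem Prepared.set {P : Inst} {s : St} (h : Prepared P s) (x : Var) (k : ℕ)
    (hx : x ∉ Var.sig :: Inst.parVars) : Prepared P (s.set x k) :=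
  h.congr (fun y hy => by rw [St.set_v, if_neg]; rintro rfl; exact hx hy) rfl rfl

theorem Prepared.frame {P : Inst} {s s' : St} {p : Stmt} (h : Prepared P s) (hf : Frame p s s')
    (hp : (Var.sig :: Inst.parVars).all (fun x => !p.writes x) = true)
    (h1 : p.stores .ps = false) (h2 : p.stores .first = false) : Prepared P s' :=
  h.congr (fun x hx => hf.v x (by simpa using List.all_eq_true.1 hp x hx)) (hf.a _ h1) (hf.a _ h2)

/-- The buckets contain the keys of block `b` of all characters below `C`. -/
structure KeyBuckets (P : Inst) (A : ℕ → ℕ) (b C : ℕ) (d1 : ℕ → ℕ) (bk : ℕ → List (ℕ × ℕ)) :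
    Prop where
  lt : ∀ y < 2 ^ P.m, ∀ e ∈ bk y, e.1 < C
  sound : ∀ y < 2 ^ P.m, ∀ e ∈ bk y, ∃ i col, P.IsKey A b e.1 i col ∧ col ^^^ d1 e.1 = y ∧
    e.2 = P.keyVal b e.1 i col
  complete : ∀ c < C, ∀ i col, P.IsKey A b c i col → ∃ v, (c, v) ∈ bk (col ^^^ d1 c)
  nodup : ∀ y < 2 ^ P.m, ((bk y).map Prod.fst).Nodup

open Var in
/-- Distribute the keys of a block to buckets. -/
def fillBuckets : Stmt :=
  .set nk 0 ;;
  .loop c sig (.set lo (.get .first (tb + c)) ;; .set hi (.get .first ((tb + bu) + c)) ;;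
    .set stamp ((tb + c) + 1) ;; collectKeys ;; placeChar)

section
variable {P : Inst} {E : Env}

theorem Inst.Valid.sig_le_pow (_ : P.Valid) : P.sig ≤ 2 ^ P.u := Nat.le_pow_clog (by norm_num) _

theorem fillBuckets_spec (hF : P.Fits E) (hV : P.Valid) {s : St} {b base : ℕ}
    (hP : Prepared P s) (hb : b < P.nb) (htb : s.v .tb = b * 2 ^ P.u) (hbase : s.v .base = base)
    (hba : base + 2 ^ P.m ≤ E.amax) (htree : IsTree P.m (fun _ => 1) (s.a .tree))
    (hlen : ∀ y < 2 ^ P.m, s.a .len (base + y) = 0)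
    (hd1 : ∀ c < 2 ^ P.m, s.a .disp1 (base + c) < 2 ^ P.m)
    (hmark : ∀ x, s.a .mark x ≤ b * 2 ^ P.u) :
    wp E fillBuckets s fun s' => ∃ bk,
      Buckets P.m base (s'.v .nk) bk s' ∧
      KeyBuckets P (s.a .ps) b P.sig (fun c => s'.a .disp1 (base + c)) bk ∧
      (∀ c < 2 ^ P.m, s'.a .disp1 (base + c) < 2 ^ P.m) ∧
      size P.m bk = s'.v .nk ∧ s'.v .nk ≤ P.maxKeys b ∧ weight P.m bk ≤ 2 ^ P.m + 2 * s'.v .nk ∧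
      (∀ x, s'.a .mark x ≤ (b + 1) * 2 ^ P.u) ∧
      (∀ x, x < base ∨ base + 2 ^ P.m ≤ x → s'.a .disp1 x = s.a .disp1 x ∧
        s'.a .head x = s.a .head x ∧ s'.a .len x = s.a .len x) ∧
      s'.t ≤ s.t + 1000 * 2 ^ P.m := by
  obtain ⟨w1, w2, w3⟩ := hF.wide
  have f1 := hF.tree_le
  have f2 := hF.blocks_le
  have f3 := hF.n_lt
  have hpow : 2 ^ (P.m + 1) = 2 * 2 ^ P.m := by ring
  have hub := P.pow_m_ge
  have hsig := hV.sig_le_pow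
  have hnb : (b + 2) * 2 ^ P.u ≤ (P.nb + 1) * 2 ^ P.u := Nat.mul_le_mul_right _ (by omega)
  have hb2 : (b + 2) * 2 ^ P.u = b * 2 ^ P.u + 2 * 2 ^ P.u := by ring
  have hb1 : (b + 1) * 2 ^ P.u = b * 2 ^ P.u + 2 ^ P.u := by ring
  have hmk := P.two_mul_maxKeys_lt b
  have hg0 : 0 < 2 ^ P.g := by positivity
  have hu0 : 0 < 2 ^ P.u := by positivity
  have hlv0 : 1 ≤ P.lv := Nat.succ_pos _
  have hum : P.u ≤ P.m := by unfold Inst.m; omega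
  set A := s.a .ps with hA
  set F : ℕ → ℕ := fun c => ∑ c' ∈ Finset.range c, P.ns b c' * (P.lv * 2 ^ P.g) with hFdef
  have hFle : ∀ c ≤ P.sig, F c ≤ P.maxKeys b := fun c hc =>
    Finset.sum_le_sum_of_subset (Finset.range_mono hc)
  have hFs : ∀ c, F (c + 1) = F c + P.ns b c * (P.lv * 2 ^ P.g) := fun c => Finset.sum_range_succ _ _
  unfold fillBuckets
  simp only [wp_seq, wp_set]
  refine ⟨by simp, ?_⟩
  refine wp_loop (fun C s' => ∃ bk, Buckets P.m base (s'.v .nk) bk s' ∧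
      KeyBuckets P A b C (fun c => s'.a .disp1 (base + c)) bk ∧
      (∀ c < 2 ^ P.m, s'.a .disp1 (base + c) < 2 ^ P.m) ∧
      size P.m bk = s'.v .nk ∧ s'.v .nk ≤ F C ∧ weight P.m bk ≤ 2 ^ P.m + 2 * s'.v .nk ∧
      (∀ x, s'.a .mark x ≤ b * 2 ^ P.u + C) ∧
      (∀ x, x < base ∨ base + 2 ^ P.m ≤ x → s'.a .disp1 x = s.a .disp1 x ∧
        s'.a .head x = s.a .head x ∧ s'.a .len x = s.a .len x) ∧
      s'.t ≤ s.t + 20 + C * 300 + F C * (620 + 210 * P.m)) (by simp) ?_ ?_ ?_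
  · refine ⟨fun _ => [], ⟨?_, ?_, ?_⟩, ⟨?_, ?_, ?_, ?_⟩, ?_⟩
    · intro y _; trivial
    · simpa using hlen
    · simpa using htree
    · simp
    · simp
    · simp
    · simp
    · simp only [St.tick_a, St.set_a, St.tick_v, St.set_v, if_true, size, weight, total, hFdef]
      refine ⟨hd1, by simp, by simp, by simp, by simpa using hmark, by simp, by simp⟩
  · simp only [Ex.eval_var, St.tick_v, St.set_v, reduceCtorEq, if_false, hP.sig]
    intro c hc s₁ hf₁ ⟨bk, hB, hK, hd, hsize, hnk, hw, hmk₁, hout, ht⟩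
    have P₁ : Prepared P s₁ :=
      Prepared.frame ((hP.set _ _ (by decide)).tick _) hf₁ rfl rfl rfl
    have etb : s₁.v .tb = b * 2 ^ P.u := by rw [hf₁.v _ rfl]; simp [htb]
    have ebase : s₁.v .base = base := by rw [hf₁.v _ rfl]; simp [hbase]
    have eps : s₁.a .ps = A := by rw [hf₁.a _ rfl]; simp [hA]
    have efirst : s₁.a .first = s.a .first := by rw [hf₁.a _ rfl]; simp
    have g1 := P₁.first b hb.le c hc
    have g2 := P₁.first (b + 1) hb c hc
    rw [hb1] at g2
    have hFc := hFle (c + 1) hc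
    have hFsc := hFs c
    simp only [wp_seq, wp_set]
    refine ⟨by simp [etb]; omega, by simp [etb, P₁.par.bu]; omega, by simp [etb]; omega, ?_⟩
    refine (collectKeys_spec hF (b := b) (c := c) ?_ hb ⟨?_, ?_, ?_, ?_, ?_⟩ hc ?_).mono ?_
    · simpa [eps] using P₁.pos
    · exact ((((((((P₁.par.set .c _ (by decide)).congr fun _ _ => rfl).set .lo _ (by decide)).congr
        fun _ _ => rfl).set .hi _ (by decide)).congr fun _ _ => rfl).set .stamp _ (by decide)).congr
        fun _ _ => rfl)
    · simp [etb]
    · simp [etb]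
    · simpa [etb] using g1
    · simpa [etb, P₁.par.bu] using g2
    · intro x
      have := hmk₁ x
      simp; omega
    intro s₂ hf₂ ⟨hL, hcnt, hall, hmk₂, ht₂⟩
    simp only [St.tick_a, St.set_a, eps] at hL hall hmk₂
    have ebase₂ : s₂.v .base = base := by rw [hf₂.v _ rfl]; simp [ebase]
    have ec₂ : s₂.v .c = c := by rw [hf₂.v _ rfl]; simp
    have enk₂ : s₂.v .nk = s₁.v .nk := by rw [hf₂.v _ rfl]; simp
    have ea₂ : ∀ q, collectKeys.stores q = false → s₂.a q = s₁.a q := fun q hq => by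
      rw [hf₂.a _ hq]; simp
    have par₂ : P.HasPar s₂ := by
      refine Inst.HasPar.frame ?_ hf₂ rfl
      exact (((((((P₁.par.set .c _ (by decide)).congr fun _ _ => rfl).set .lo _ (by decide)).congr
        fun _ _ => rfl).set .hi _ (by decide)).congr fun _ _ => rfl).set .stamp _ (by decide)).congr
        fun _ _ => rfl
    have hc' : c < 2 ^ P.m := by omega
    refine (placeChar_spec (bk := bk) hF par₂ ebase₂ hba ?_ ?_ ?_ hL.inj ?_ ⟨?_, ?_, ?_⟩ ?_ ?_ ?_).mono ?_
    · rwa [ec₂]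
    · rw [ec₂, ea₂ _ rfl]; exact hd c hc'
    · intro j hj
      obtain ⟨i, hk, -⟩ := hL.isKey j hj
      exact (hk.lt hP.pos).1
    · rw [enk₂]; omega
    · rw [enk₂, ea₂ .kc rfl, ea₂ .kv rfl, ea₂ .nxt rfl, ea₂ .head rfl]; exact hB.chain
    · rw [ea₂ .len rfl]; exact hB.len
    · rw [ea₂ .tree rfl]; exact hB.tree
    · omega
    · rw [ec₂]; exact hK.lt
    · exact hK.nodup
    intro s' hf ⟨bk', hB', hnk', hd', hmem, hnd', hsize', hw', hdne, hout', ht'⟩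
    rw [ec₂] at hd' hmem hdne
    rw [ea₂ .disp1 rfl] at hdne
    have emk : s'.a .mark = s₂.a .mark := hf.a _ rfl
    rw [enk₂] at hnk' hB'
    rw [← hnk'] at hB'
    have hdo : ∀ c' < c, s'.a .disp1 (base + c') = s₁.a .disp1 (base + c') := fun c' h =>
      hdne _ (by omega)
    have hxs : ∀ j < s₂.v .cnt, s₂.a .xs j < 2 ^ P.m := by
      intro j hj
      obtain ⟨i, hk, -⟩ := hL.isKey j hj
      exact (hk.lt hP.pos).1
    refine ⟨bk', hB', ⟨?_, ?_, ?_, hnd'⟩, ?_, by omega, by omega, by omega, ?_, ?_, ?_⟩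
    · intro y hy e he
      rcases (hmem y hy e).1 he with h | ⟨j, hj, -, h⟩
      · exact (hK.lt y hy e h).trans (Nat.lt_succ_self _)
      · rw [h]; exact Nat.lt_succ_self _
    · intro y hy e he
      rcases (hmem y hy e).1 he with h | ⟨j, hj, h1, h2⟩
      · simp only [hdo _ (hK.lt y hy e h)]
        exact hK.sound y hy e h
      · obtain ⟨i, h3, h4⟩ := hL.isKey j hj
        rw [h2]
        exact ⟨i, s₂.a .xs j, h3, h1, h4⟩
    · intro c' hc'' i col hk
      have hcol := (hk.lt hP.pos).1
      rcases Nat.lt_succ_iff_lt_or_eq.1 hc'' with h | rfl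
      · obtain ⟨v, hv⟩ := hK.complete c' h i col hk
        refine ⟨v, ?_⟩
        simp only [hdo _ h]
        refine (hmem _ (Nat.xor_lt_two_pow hcol (hd c' (by omega))) _).2 (Or.inl hv)
      · obtain ⟨j, hj, rfl⟩ := hall i col hk
        exact ⟨_, (hmem _ (Nat.xor_lt_two_pow hcol hd') _).2 (Or.inr ⟨j, hj, rfl, rfl⟩)⟩
    · intro x hx
      by_cases h : x = c
      · rw [h]; exact hd'
      · rw [hdne _ (by omega)]; exact hd x hx
    · intro x
      rw [emk]
      rcases hmk₂ x with h | h
      · rw [h]; omega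
      · rw [h]; have := hmk₁ x; omega
    · intro x hx
      obtain ⟨h1, h2, h3⟩ := hout x hx
      obtain ⟨h4, h5⟩ := hout' x hx
      rw [ea₂ .head rfl] at h4
      rw [ea₂ .len rfl] at h5
      exact ⟨(hdne x (by omega)).trans h1, h4.trans h2, h5.trans h3⟩
    · simp at ht₂
      have e1 : P.ns b c * (60 + P.lv * (60 + 2 ^ P.g * (200 + 30 * P.u))) ≤
          (P.ns b c * (P.lv * 2 ^ P.g)) * (320 + 30 * P.m) := by
        rw [mul_assoc]
        refine Nat.mul_le_mul_left _ ?_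
        have h1 : 1 ≤ P.lv * 2 ^ P.g := Nat.mul_pos hlv0 hg0
        have h2 : P.lv * 1 ≤ P.lv * 2 ^ P.g := Nat.mul_le_mul_left _ hg0
        have h3 : P.lv * 2 ^ P.g * P.u ≤ P.lv * 2 ^ P.g * P.m := Nat.mul_le_mul_left _ hum
        calc _ = 60 + 60 * (P.lv * 1) + 200 * (P.lv * 2 ^ P.g) + 30 * (P.lv * 2 ^ P.g * P.u) := by ring
          _ ≤ 60 * (P.lv * 2 ^ P.g) + 60 * (P.lv * 2 ^ P.g) + 200 * (P.lv * 2 ^ P.g) +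
            30 * (P.lv * 2 ^ P.g * P.m) := by omega
          _ = _ := by ring
      have e2 : s₂.v .cnt * (300 + 180 * P.m) ≤ (P.ns b c * (P.lv * 2 ^ P.g)) * (300 + 180 * P.m) :=
        Nat.mul_le_mul_right _ hcnt
      have e3 : F (c + 1) * (620 + 210 * P.m) = F c * (620 + 210 * P.m) +
          ((P.ns b c * (P.lv * 2 ^ P.g)) * (320 + 30 * P.m) +
           (P.ns b c * (P.lv * 2 ^ P.g)) * (300 + 180 * P.m)) := by
        rw [hFsc]; ring
      omega
  · simp only [Ex.eval_var, St.tick_v, St.set_v, reduceCtorEq, if_false, hP.sig]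
    intro s' hf ⟨bk, hB, hK, hd, hsize, hnk, hw, hmk₁, hout, ht⟩
    refine ⟨bk, hB, hK, hd, hsize, hnk.trans (hFle _ le_rfl), hw, fun x => ?_, hout, ?_⟩
    · have := hmk₁ x; omega
    · have h1 := hFle P.sig le_rfl
      have h2 := P.maxKeys_bound b
      have h3 : F P.sig * (620 + 210 * P.m) ≤ 310 * (2 * P.maxKeys b * (P.m + 1)) := by
        calc F P.sig * (620 + 210 * P.m) ≤ P.maxKeys b * (620 * (P.m + 1)) :=
              Nat.mul_le_mul h1 (by omega)
          _ = _ := by ring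
      omega

end

end WordRAM

namespace WordRAM

open Var in
/-- Copy a linked list to the arrays `xs` and `xv`. -/
def copyBucket : Stmt :=
  .loop i cnt (.set idx (p - 1) ;; .put .xs i (.get .kc idx) ;; .put .xv i (.get .kv idx) ;;
    .set p (.get .nxt idx))

theorem copyBucket_spec {E : Env} (hE : E.Wide) {s : St} {nk : ℕ} {l : List (ℕ × ℕ)}
    (hl : Chain (s.a .kc) (s.a .kv) (s.a .nxt) nk (s.v .p) l) (hcnt : s.v .cnt = l.length)
    (hnk : nk ≤ E.amax) (hlen : l.length ≤ E.amax) :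
    wp E copyBucket s fun s' =>
      (∀ j (h : j < l.length), s'.a .xs j = l[j].1 ∧ s'.a .xv j = l[j].2) ∧
      s'.t ≤ s.t + 10 + l.length * 60 := by
  obtain ⟨w1, w2, w3⟩ := hE
  refine wp_loop (fun q s' => Chain (s.a .kc) (s.a .kv) (s.a .nxt) nk (s'.v .p) (l.drop q) ∧
    (∀ j (h : j < l.length), j < q → s'.a .xs j = l[j].1 ∧ s'.a .xv j = l[j].2) ∧
    s'.t ≤ s.t + 10 + q * 60) (by simp) ?_ ?_ ?_
  · simpa using hl
  · simp only [Ex.eval_var, hcnt]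
    intro q hq s' hf ⟨h1, h2, h3⟩
    have ekc : s'.a .kc = s.a .kc := hf.a _ rfl
    have ekv : s'.a .kv = s.a .kv := hf.a _ rfl
    have enxt : s'.a .nxt = s.a .nxt := hf.a _ rfl
    rw [List.drop_eq_getElem_cons hq] at h1
    obtain ⟨id, hid, hp, hc, hv, h1⟩ := h1
    simp [ekc, ekv, enxt, hp]
    refine ⟨by omega, by omega, by omega, h1, fun j hj hjq => ?_, by omega⟩
    rcases Nat.lt_or_eq_of_le hjq with h | rfl
    · rw [Function.update_of_ne h.ne, Function.update_of_ne h.ne]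
      exact h2 j hj h
    · simp [hc, hv]
  · simp only [Ex.eval_var, hcnt]
    intro s' hf ⟨h1, h2, h3⟩
    exact ⟨fun j hj => h2 j hj hj, h3⟩

/-- Leaves have weight two where the array `K` has a nonzero entry, and one elsewhere. -/
def occWeight (base : ℕ) (K : ℕ → ℕ) (z : ℕ) : ℕ := if K (base + z) = 0 then 1 else 2

open Var in
/-- Store the `i`-th element of bucket `r` in the dictionary. -/
def storeKey : Stmt :=
  .set y (.xor (.get .xs i) dd) ;; bump ;;
    .put .key (base + y) ((.shl (.get .xs i) m + r : Ex) + 1) ;; .put .val (base + y) (.get .xv i)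

open Var in
/-- Store the elements of bucket `r` in the dictionary. -/
def storeBucket : Stmt :=
  .set cnt (.get .len (base + r)) ;;
  .ite .lt 0 cnt (.set p (.get .head (base + r)) ;; copyBucket ;; chooseDisp ;;
    .put .disp2 (base + r) dd ;; .loop i cnt storeKey) .skip

section
variable {P : Inst} {E : Env}

theorem storeKey_spec (hF : P.Fits E) {s : St} {base c r v y : ℕ}
    (hp : P.HasPar s) (hbase : s.v .base = base) (hb : base + 2 ^ P.m ≤ E.amax)
    (hi : s.v .i < E.amax) (hr : s.v .r = r) (hr' : r < 2 ^ P.m) (hc : s.a .xs (s.v .i) = c)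
    (hc' : c < 2 ^ P.m) (hv : s.a .xv (s.v .i) = v) (hy : c ^^^ s.v .dd = y) (hy' : y < 2 ^ P.m)
    (hW : IsTree P.m (occWeight base (s.a .key)) (s.a .tree)) (hfree : s.a .key (base + y) = 0) :
    wp E storeKey s fun s' =>
      s'.a .key = Function.update (s.a .key) (base + y) (c * 2 ^ P.m + r + 1) ∧
      s'.a .val = Function.update (s.a .val) (base + y) v ∧
      IsTree P.m (occWeight base (s'.a .key)) (s'.a .tree) ∧
      total P.m (occWeight base (s'.a .key)) = total P.m (occWeight base (s.a .key)) + 1 ∧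
      s'.t ≤ s.t + 200 + 40 * P.m := by
  obtain ⟨w1, w2, w3⟩ := hF.wide
  have f2 := hF.sq_lt
  have hsq : 2 ^ (2 * P.m + 4) = 16 * (2 ^ P.m * 2 ^ P.m) := by ring
  have hcr : (c + 1) * 2 ^ P.m ≤ 2 ^ P.m * 2 ^ P.m := Nat.mul_le_mul_right _ hc'
  rw [Nat.add_mul, one_mul] at hcr
  have hpos : 0 < 2 ^ P.m := by positivity
  have hsq2 : 2 ^ P.m * 1 ≤ 2 ^ P.m * 2 ^ P.m := Nat.mul_le_mul_left _ hpos
  have htot : total P.m (occWeight base (s.a .key)) ≤ 2 * 2 ^ P.m := by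
    refine (Finset.sum_le_card_nsmul _ _ 2 fun z _ => ?_).trans (by simp [mul_comm])
    unfold occWeight; split <;> simp
  have hone : occWeight base (s.a .key) y = 1 := if_pos hfree
  have hupd : occWeight base (Function.update (s.a .key) (base + y) (c * 2 ^ P.m + r + 1)) =
      Function.update (occWeight base (s.a .key)) y (occWeight base (s.a .key) y + 1) := by
    ext z
    by_cases h : z = y
    · subst h; rw [Function.update_self, hone]; simp [occWeight]
    · rw [Function.update_of_ne h]; simp [occWeight, h]
  unfold storeKey
  simp only [wp_seq, wp_set]
  refine ⟨by simp [hi], ?_⟩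
  refine (bump_spec (m := P.m) (y := y) (ω := occWeight base (s.a .key)) hF.wide ?_ ?_ hF.tree_le
    ?_ hy' ?_ (by omega)).mono ?_
  · simp [hp.m]
  · simp [hp.bm]
  · simp [hc, hy]
  · simpa using hW
  intro s₁ hf₁ ⟨htree, ht⟩
  have ebase : s₁.v .base = base := by rw [hf₁.v _ rfl]; simp [hbase]
  have ey : s₁.v .y = y := by rw [hf₁.v _ rfl]; simp [hc, hy]
  have ei : s₁.v .i = s.v .i := by rw [hf₁.v _ rfl]; simp
  have er : s₁.v .r = r := by rw [hf₁.v _ rfl]; simp [hr]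
  have em : s₁.v .m = P.m := by rw [hf₁.v _ rfl]; simp [hp.m]
  have exs : s₁.a .xs = s.a .xs := by rw [hf₁.a _ rfl]; simp
  have exv : s₁.a .xv = s.a .xv := by rw [hf₁.a _ rfl]; simp
  have ekey : s₁.a .key = s.a .key := by rw [hf₁.a _ rfl]; simp
  have eval : s₁.a .val = s.a .val := by rw [hf₁.a _ rfl]; simp
  simp [ebase, ey, ei, er, em, exs, exv, hc, hv, ekey, eval]
  simp at ht
  refine ⟨by omega, by omega, ?_, ?_, by omega⟩
  · rw [hupd, hone, ← hone]; simpa [hone] using htree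
  · rw [hupd, total_update hy']

theorem storeBucket_spec (hF : P.Fits E) {s : St} {base nk r : ℕ} {l : List (ℕ × ℕ)}
    (hp : P.HasPar s) (hbase : s.v .base = base) (hb : base + 2 ^ P.m ≤ E.amax)
    (hr : s.v .r = r) (hr' : r < 2 ^ P.m) (hnk : nk ≤ E.amax)
    (hl : Chain (s.a .kc) (s.a .kv) (s.a .nxt) nk (s.a .head (base + r)) l)
    (hlen : s.a .len (base + r) = l.length) (hlm : l.length ≤ 2 ^ P.m)
    (hlt : ∀ e ∈ l, e.1 < 2 ^ P.m) (hnd : (l.map Prod.fst).Nodup)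
    (hd : s.a .disp2 (base + r) < 2 ^ P.m)
    (hW : IsTree P.m (occWeight base (s.a .key)) (s.a .tree))
    (htot : l.length * total P.m (occWeight base (s.a .key)) < (l.length + 1) * 2 ^ P.m) :
    wp E storeBucket s fun s' => ∃ dd < 2 ^ P.m,
      s'.a .disp2 = Function.update (s.a .disp2) (base + r) dd ∧
      (∀ e ∈ l, s.a .key (base + (e.1 ^^^ dd)) = 0 ∧
        s'.a .key (base + (e.1 ^^^ dd)) = e.1 * 2 ^ P.m + r + 1 ∧
        s'.a .val (base + (e.1 ^^^ dd)) = e.2) ∧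
      (∀ x, (∀ e ∈ l, x ≠ base + (e.1 ^^^ dd)) →
        s'.a .key x = s.a .key x ∧ s'.a .val x = s.a .val x) ∧
      IsTree P.m (occWeight base (s'.a .key)) (s'.a .tree) ∧
      total P.m (occWeight base (s'.a .key)) =
        total P.m (occWeight base (s.a .key)) + l.length ∧
      s'.t ≤ s.t + 100 + l.length * (400 + 200 * P.m) := by
  obtain ⟨w1, w2, w3⟩ := hF.wide
  have f1 := hF.tree_le
  have f2 := hF.sq_lt
  have hpow : 2 ^ (P.m + 1) = 2 * 2 ^ P.m := by ring
  have hsq : 2 ^ (2 * P.m + 4) = 16 * (2 ^ P.m * 2 ^ P.m) := by ring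
  have hpos : 0 < 2 ^ P.m := by positivity
  have hsq2 : 2 ^ P.m * 1 ≤ 2 ^ P.m * 2 ^ P.m := Nat.mul_le_mul_left _ hpos
  have hlsq : l.length * 2 ^ P.m ≤ 2 ^ P.m * 2 ^ P.m := Nat.mul_le_mul_right _ hlm
  rw [Nat.add_mul, one_mul] at htot
  set K := s.a .key with hK
  unfold storeBucket
  simp only [wp_seq, wp_set]
  refine ⟨by simp [hbase, hr]; omega, ?_⟩
  refine wp_ite (by simp) (by simp) (fun h => ?_) (fun h => ?_)
  · simp [hbase, hr, hlen] at h
    simp only [wp_seq, wp_set, wp_put]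
    refine ⟨by simp [hbase, hr]; omega, ?_⟩
    refine (copyBucket_spec (l := l) (nk := nk) hF.wide ?_ ?_ hnk (by omega)).mono ?_
    · simpa [hbase, hr] using hl
    · simp [hbase, hr, hlen]
    intro s₁ hf₁ ⟨hx, ht₁⟩
    simp at ht₁
    have p₁ : P.HasPar s₁ := by
      refine Inst.HasPar.frame ?_ hf₁ rfl
      exact ((hp.set .cnt _ (by decide)).congr fun _ _ => rfl).set .p _ (by decide) |>.congr
        fun _ _ => rfl
    have ecnt₁ : s₁.v .cnt = l.length := by rw [hf₁.v _ rfl]; simp [hbase, hr, hlen]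
    have ea₁ : ∀ q, copyBucket.stores q = false → s₁.a q = s.a q := fun q hq => by
      rw [hf₁.a _ hq]; simp
    have hxs : ∀ j < l.length, s₁.a .xs j < 2 ^ P.m := fun j hj => by
      rw [(hx j hj).1]; exact hlt _ (List.getElem_mem hj)
    refine (chooseDisp_spec (m := P.m) (k := l.length) (ω := occWeight base K) hF.wide p₁.m p₁.bm
      f1 ecnt₁ (by omega) hxs ?_ (by omega)).mono ?_
    · rw [ea₁ .tree rfl]; exact hW
    intro s₂ hf₂ ⟨hdd, hsum, ht₂⟩
    set d := s₂.v .dd with hd'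
    have p₂ : P.HasPar s₂ := p₁.frame hf₂ rfl
    have ebase₂ : s₂.v .base = base := by rw [hf₂.v _ rfl, hf₁.v _ rfl]; simp [hbase]
    have er₂ : s₂.v .r = r := by rw [hf₂.v _ rfl, hf₁.v _ rfl]; simp [hr]
    have ecnt₂ : s₂.v .cnt = l.length := by rw [hf₂.v _ rfl, ecnt₁]
    have ea₂ : ∀ q, copyBucket.stores q = false → s₂.a q = s.a q := fun q hq => by
      rw [hf₂.a _ rfl, ea₁ q hq]
    have exs₂ : ∀ j (h : j < l.length), s₂.a .xs j = l[j].1 := fun j hj => by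
      rw [hf₂.a _ rfl, (hx j hj).1]
    have exv₂ : ∀ j (h : j < l.length), s₂.a .xv j = l[j].2 := fun j hj => by
      rw [hf₂.a _ rfl, (hx j hj).2]
    have hz : ∀ j (h : j < l.length), l[j].1 ^^^ d < 2 ^ P.m := fun j hj =>
      Nat.xor_lt_two_pow (hlt _ (List.getElem_mem hj)) hdd
    have hsum' : ∑ j ∈ Finset.range l.length, occWeight base K (s₁.a .xs j ^^^ d) ≤ l.length := by
      by_contra hc
      have h1 := Nat.mul_le_mul_left (2 ^ P.m) (Nat.succ_le_of_lt (not_le.1 hc))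
      rw [Nat.mul_succ, mul_comm] at h1
      omega
    have hfree : ∀ j (h : j < l.length), K (base + (l[j].1 ^^^ d)) = 0 := by
      intro j hj
      by_contra hc
      have h1 : ∑ j ∈ Finset.range l.length, 1 <
          ∑ j ∈ Finset.range l.length, occWeight base K (s₁.a .xs j ^^^ d) := by
        refine Finset.sum_lt_sum (fun i _ => ?_) ⟨j, Finset.mem_range.2 hj, ?_⟩
        · unfold occWeight; split <;> simp
        · rw [(hx j hj).1, occWeight, if_neg hc]; norm_num
      simp at h1
      omega
    have hinj : ∀ j (h : j < l.length) j' (h' : j' < l.length),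
        l[j].1 ^^^ d = l[j'].1 ^^^ d → j = j' := by
      intro j hj j' hj' he
      have := Nat.xor_left_inj.1 he
      have h1 := (List.nodup_iff_injective_get.1 hnd) (a₁ := ⟨j, by simpa using hj⟩)
        (a₂ := ⟨j', by simpa using hj'⟩) (by simpa using this)
      simpa using h1
    refine ⟨by simp [ebase₂, er₂]; omega, ?_⟩
    refine wp_loop (fun q s' =>
      (∀ j (h : j < l.length), j < q → s'.a .key (base + (l[j].1 ^^^ d)) = l[j].1 * 2 ^ P.m + r + 1 ∧
        s'.a .val (base + (l[j].1 ^^^ d)) = l[j].2) ∧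
      (∀ x, (∀ j (h : j < l.length), j < q → x ≠ base + (l[j].1 ^^^ d)) →
        s'.a .key x = K x ∧ s'.a .val x = s.a .val x) ∧
      IsTree P.m (occWeight base (s'.a .key)) (s'.a .tree) ∧
      total P.m (occWeight base (s'.a .key)) = total P.m (occWeight base K) + q ∧
      s'.t ≤ s₂.t + 20 + q * (210 + 40 * P.m)) (by simp) ?_ ?_ ?_
    · simp [ea₂ .key rfl, ea₂ .val rfl, ea₂ .tree rfl]
      exact ⟨fun _ => rfl, hW, rfl⟩
    · simp only [Ex.eval_var, ecnt₂, St.tick_v, St.put_v]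
      intro q hq s₃ hf₃ ⟨h1, h2, h3, h4, h5⟩
      have p₃ : P.HasPar s₃ := Inst.HasPar.frame (by simpa using p₂) hf₃ rfl
      have ebase₃ : s₃.v .base = base := by rw [hf₃.v _ rfl]; simp [ebase₂]
      have er₃ : s₃.v .r = r := by rw [hf₃.v _ rfl]; simp [er₂]
      have ed₃ : s₃.v .dd = d := by rw [hf₃.v _ rfl]; simp [hd']
      have exs₃ : s₃.a .xs q = l[q].1 := by rw [hf₃.a _ rfl]; simp [exs₂ q hq]
      have exv₃ : s₃.a .xv q = l[q].2 := by rw [hf₃.a _ rfl]; simp [exv₂ q hq]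
      refine (storeKey_spec hF (base := base) (r := r) (c := l[q].1) (v := l[q].2)
        (y := l[q].1 ^^^ d) ?_ ?_ hb ?_ ?_ hr' ?_ (hlt _ (List.getElem_mem hq)) ?_ ?_ (hz q hq)
        ?_ ?_).mono ?_
      · exact (p₃.set .i _ (by decide)).congr fun _ _ => rfl
      · simp [ebase₃]
      · simp; omega
      · simp [er₃]
      · simp [exs₃]
      · simp [exv₃]
      · simp [ed₃]
      · simpa using h3
      · simp only [St.tick_a, St.set_a]
        rw [(h2 _ ?_).1]
        · exact hfree q hq
        · intro j hj hjq he
          exact hjq.ne (hinj j hj q hq (by omega))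
      intro s' hf ⟨g1, g2, g3, g4, g5⟩
      simp only [St.tick_a, St.set_a, St.tick_t, St.set_t] at g1 g2 g4 g5
      refine ⟨fun j hj hjq => ?_, fun x hx => ?_, g3, by omega, by rw [Nat.add_mul]; omega⟩
      · rcases Nat.lt_succ_iff_lt_or_eq.1 hjq with h | rfl
        · have hne : base + (l[j].1 ^^^ d) ≠ base + (l[q].1 ^^^ d) := fun he =>
            h.ne (hinj j hj q hq (by omega))
          rw [g1, g2, Function.update_of_ne hne, Function.update_of_ne hne]
          exact h1 j hj h
        · rw [g1, g2, Function.update_self, Function.update_self]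
          exact ⟨rfl, rfl⟩
      · have hne := hx q hq (by omega)
        rw [g1, g2, Function.update_of_ne hne, Function.update_of_ne hne]
        exact h2 x fun j hj hjq => hx j hj (by omega)
    · simp only [Ex.eval_var, ecnt₂, St.tick_v, St.put_v]
      intro s' hf ⟨h1, h2, h3, h4, h5⟩
      refine ⟨d, hdd, ?_, fun e he => ?_, fun x hx => h2 x fun j hj _ => hx _ (List.getElem_mem hj),
        h3, h4, ?_⟩
      · rw [hf.a _ rfl]; simp [ea₂ .disp2 rfl, ebase₂, er₂, hd']
      · obtain ⟨j, hj, rfl⟩ := List.getElem_of_mem he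
        exact ⟨hfree j hj, h1 j hj hj⟩
      · have e1 : P.m * (60 + 80 * l.length) ≤ l.length * (140 * P.m) := by
          have : P.m * 60 ≤ P.m * 60 * l.length := Nat.le_mul_of_pos_right _ h
          calc P.m * (60 + 80 * l.length) = P.m * 60 + P.m * 80 * l.length := by ring
            _ ≤ P.m * 60 * l.length + P.m * 80 * l.length := by omega
            _ = _ := by ring
        have e2 : l.length * (400 + 200 * P.m) = l.length * 60 + l.length * 130 +
          (l.length * (140 * P.m) + l.length * (210 + 40 * P.m)) + l.length * (20 * P.m) := by ring
        omega
  · simp [hbase, hr, hlen] at h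
    simp only [wp_skip]
    rw [h]
    refine ⟨s.a .disp2 (base + r), hd, by simp, by simp, fun _ _ => ⟨rfl, rfl⟩, hW, by simp; rfl, by simp⟩

end

end WordRAM

namespace WordRAM

/-- The cells from `base` on are a dictionary for the keys of block `b`. -/
structure IsDict (P : Inst) (A : ℕ → ℕ) (b base : ℕ) (d1 d2 key val : ℕ → ℕ) : Prop where
  d1_lt : ∀ c < 2 ^ P.m, d1 (base + c) < 2 ^ P.m
  d2_lt : ∀ y < 2 ^ P.m, d2 (base + y) < 2 ^ P.m
  sound : ∀ c < P.sig, ∀ col y z, col ^^^ d1 (base + c) = y → y < 2 ^ P.m →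
    c ^^^ d2 (base + y) = z → key (base + z) = c * 2 ^ P.m + y + 1 →
    ∃ i, P.IsKey A b c i col ∧ val (base + z) = P.keyVal b c i col
  complete : ∀ c < P.sig, ∀ i col y z, col ^^^ d1 (base + c) = y →
    c ^^^ d2 (base + y) = z → P.IsKey A b c i col → key (base + z) = c * 2 ^ P.m + y + 1

theorem Inst.Valid.lt_pow_m {P : Inst} (h : P.Valid) {c : ℕ} (hc : c < P.sig) : c < 2 ^ P.m := by
  have h1 := P.pow_m_ge
  have h2 := h.sig_le_pow
  have h3 : 0 < 2 ^ P.g := by positivity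
  omega

theorem IsDict.congr {P : Inst} {A : ℕ → ℕ} {b base : ℕ} {d1 d2 key val d1' d2' key' val' : ℕ → ℕ}
    (h : IsDict P A b base d1 d2 key val) (hA : P.IsPos A) (hV : P.Valid)
    (he : ∀ x, base ≤ x → x < base + 2 ^ P.m →
      d1' x = d1 x ∧ d2' x = d2 x ∧ key' x = key x ∧ val' x = val x) :
    IsDict P A b base d1' d2' key' val' := by
  have h0 : ∀ x < 2 ^ P.m, d1' (base + x) = d1 (base + x) ∧ d2' (base + x) = d2 (base + x) ∧
      key' (base + x) = key (base + x) ∧ val' (base + x) = val (base + x) := fun x hx =>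
    he _ (by omega) (by omega)
  have hs : ∀ c < P.sig, c < 2 ^ P.m := fun c hc => hV.lt_pow_m hc
  refine ⟨fun c hc => ?_, fun y hy => ?_, fun c hc col y z e1 hy e2 hk => ?_,
    fun c hc i col y z e1 e2 hk => ?_⟩
  · rw [(h0 c hc).1]; exact h.d1_lt c hc
  · rw [(h0 y hy).2.1]; exact h.d2_lt y hy
  · rw [(h0 c (hs c hc)).1] at e1
    rw [(h0 y hy).2.1] at e2
    have hz : z < 2 ^ P.m := e2 ▸ Nat.xor_lt_two_pow (hs c hc) (h.d2_lt y hy)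
    rw [(h0 z hz).2.2.1] at hk
    rw [(h0 z hz).2.2.2]
    exact h.sound c hc col y z e1 hy e2 hk
  · rw [(h0 c (hs c hc)).1] at e1
    have hy : y < 2 ^ P.m := e1 ▸ Nat.xor_lt_two_pow (hk.lt hA).1 (h.d1_lt c (hs c hc))
    rw [(h0 y hy).2.1] at e2
    have hz : z < 2 ^ P.m := e2 ▸ Nat.xor_lt_two_pow (hs c hc) (h.d2_lt y hy)
    rw [(h0 z hz).2.2.1]
    exact h.complete c hc i col y z e1 e2 hk

theorem IsTree.congr {m : ℕ} {ω ω' W : ℕ → ℕ} (h : IsTree m ω W) (he : ∀ z < 2 ^ m, ω' z = ω z) :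
    IsTree m ω' W := fun t ht y hy => (h t ht y hy).trans <|
  Finset.sum_congr rfl fun z hz => (he z (Finset.mem_range.1 (Finset.mem_filter.1 hz).1)).symm

open Var in
/-- Build the dictionary of a block. -/
def buildDict : Stmt := initTree ;; fillBuckets ;; initTree ;; .loop r bm storeBucket

theorem mul_add_inj {M c c' r r' : ℕ} (hr : r < M) (hr' : r' < M)
    (h : c * M + r = c' * M + r') : c = c' ∧ r = r' := by
  have h1 : (c * M + r) % M = r := by rw [Nat.add_comm, Nat.add_mul_mod_self_right, Nat.mod_eq_of_lt hr]
  have h2 : (c' * M + r') % M = r' := by rw [Nat.add_comm, Nat.add_mul_mod_self_right, Nat.mod_eq_of_lt hr']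
  rw [h, h2] at h1
  subst h1
  exact ⟨Nat.eq_of_mul_eq_mul_right (by omega) (Nat.add_right_cancel h), rfl⟩

section
variable {P : Inst} {E : Env}

theorem buildDict_spec (hF : P.Fits E) (hV : P.Valid) {s : St} {b base : ℕ}
    (hP : Prepared P s) (hb : b < P.nb) (htb : s.v .tb = b * 2 ^ P.u) (hbase : s.v .base = base)
    (hba : base + 2 ^ P.m ≤ E.amax)
    (hnew : ∀ x, base ≤ x → x < base + 2 ^ P.m → s.a .len x = 0 ∧ s.a .disp1 x = 0 ∧
      s.a .disp2 x = 0 ∧ s.a .key x = 0)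
    (hmark : ∀ x, s.a .mark x ≤ b * 2 ^ P.u) :
    wp E buildDict s fun s' =>
      IsDict P (s.a .ps) b base (s'.a .disp1) (s'.a .disp2) (s'.a .key) (s'.a .val) ∧
      (∀ x, s'.a .mark x ≤ (b + 1) * 2 ^ P.u) ∧
      (∀ x, x < base ∨ base + 2 ^ P.m ≤ x → s'.a .len x = s.a .len x ∧
        s'.a .disp1 x = s.a .disp1 x ∧ s'.a .disp2 x = s.a .disp2 x ∧
        s'.a .key x = s.a .key x ∧ s'.a .val x = s.a .val x) ∧
      s'.t ≤ s.t + 3000 * 2 ^ P.m := by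
  obtain ⟨w1, w2, w3⟩ := hF.wide
  have f1 := hF.tree_le
  have hpow : 2 ^ (P.m + 1) = 2 * 2 ^ P.m := by ring
  have hpos : 0 < 2 ^ P.m := by positivity
  have hs : ∀ c < P.sig, c < 2 ^ P.m := fun c hc => hV.lt_pow_m hc
  have hn0 : ∀ x < 2 ^ P.m, s.a .len (base + x) = 0 ∧ s.a .disp1 (base + x) = 0 ∧
      s.a .disp2 (base + x) = 0 ∧ s.a .key (base + x) = 0 := fun x hx => hnew _ (by omega) (by omega)
  unfold buildDict
  simp only [wp_seq]
  refine (initTree_spec hF.wide hP.par.m hP.par.bm f1).mono ?_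
  intro s₁ hf₁ ⟨htree₁, ht₁⟩
  have ea₁ : ∀ q, initTree.stores q = false → s₁.a q = s.a q := fun q hq => hf₁.a _ hq
  have P₁ : Prepared P s₁ := hP.frame hf₁ rfl rfl rfl
  refine (fillBuckets_spec hF hV (b := b) (base := base) P₁ hb ?_ ?_ hba htree₁ ?_ ?_ ?_).mono ?_
  · rw [hf₁.v _ rfl, htb]
  · rw [hf₁.v _ rfl, hbase]
  · rw [ea₁ .len rfl]; exact fun y hy => (hn0 y hy).1
  · rw [ea₁ .disp1 rfl]; exact fun y hy => by rw [(hn0 y hy).2.1]; exact hpos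
  · rw [ea₁ .mark rfl]; exact hmark
  intro s₂ hf₂ ⟨bk, hB, hK, hd1, hsize, hnk, hw, hmk, hout, ht₂⟩
  have ea₂ : ∀ q, initTree.stores q = false → fillBuckets.stores q = false → s₂.a q = s.a q :=
    fun q h1 h2 => by rw [hf₂.a _ h2, ea₁ q h1]
  have P₂ : Prepared P s₂ := P₁.frame hf₂ rfl rfl rfl
  refine (initTree_spec hF.wide P₂.par.m P₂.par.bm f1).mono ?_
  intro s₃ hf₃ ⟨htree₃, ht₃⟩
  have P₃ : Prepared P s₃ := P₂.frame hf₃ rfl rfl rfl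
  have ea₃ : ∀ q, initTree.stores q = false → s₃.a q = s₂.a q := fun q hq => hf₃.a _ hq
  have ebase₃ : s₃.v .base = base := by rw [hf₃.v _ rfl, hf₂.v _ rfl, hf₁.v _ rfl, hbase]
  have eps : s₁.a .ps = s.a .ps := ea₁ _ rfl
  rw [eps] at hK
  set nk := s₂.v .nk with hnk'
  set D1 := s₂.a .disp1 with hD1
  have hmb := P.maxKeys_bound b
  have hm2 := P.two_mul_maxKeys_lt b
  have hlen : ∀ y < 2 ^ P.m, (bk y).length ≤ P.m + 1 := by
    intro y hy
    have h1 : blk P.m (fun y => 2 ^ (bk y).length) 0 y ≤ weight P.m bk := blk_le_total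
    rw [blk_zero hy] at h1
    have h2 : 2 ^ (bk y).length ≤ 2 ^ (P.m + 1) := by omega
    exact (Nat.pow_le_pow_iff_right (by norm_num)).1 h2
  have hm0 : P.m < 2 ^ P.m := Nat.lt_two_pow_self
  set Λ : ℕ → ℕ := fun r => ∑ y ∈ Finset.range r, (bk y).length with hΛ
  have hΛle : ∀ r ≤ 2 ^ P.m, Λ r ≤ nk := fun r hr => by
    rw [← hsize]; exact Finset.sum_le_sum_of_subset (Finset.range_mono hr)
  refine wp_loop (fun r s' =>
    (∀ y < r, ∀ e ∈ bk y, s'.a .key (base + (e.1 ^^^ s'.a .disp2 (base + y))) = e.1 * 2 ^ P.m + y + 1 ∧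
      s'.a .val (base + (e.1 ^^^ s'.a .disp2 (base + y))) = e.2) ∧
    (∀ z < 2 ^ P.m, s'.a .key (base + z) ≠ 0 → ∃ y < r, ∃ e ∈ bk y,
      z = e.1 ^^^ s'.a .disp2 (base + y)) ∧
    (∀ y < 2 ^ P.m, s'.a .disp2 (base + y) < 2 ^ P.m) ∧
    (∀ x, x < base ∨ base + 2 ^ P.m ≤ x → s'.a .disp2 x = s.a .disp2 x ∧
      s'.a .key x = s.a .key x ∧ s'.a .val x = s.a .val x) ∧
    IsTree P.m (occWeight base (s'.a .key)) (s'.a .tree) ∧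
    total P.m (occWeight base (s'.a .key)) = 2 ^ P.m + Λ r ∧
    s'.t ≤ s₃.t + 10 + 110 * r + Λ r * (400 + 200 * P.m)) (by simp) ?_ ?_ ?_
  · have e1 : s₃.a .key = s.a .key := by rw [ea₃ _ rfl, ea₂ _ rfl rfl]
    have e2 : s₃.a .val = s.a .val := by rw [ea₃ _ rfl, ea₂ _ rfl rfl]
    have e3 : s₃.a .disp2 = s.a .disp2 := by rw [ea₃ _ rfl, ea₂ _ rfl rfl]
    have hocc : ∀ z < 2 ^ P.m, occWeight base (s.a .key) z = 1 := fun z hz => if_pos (hn0 z hz).2.2.2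
    simp only [St.tick_a, St.tick_t, e1, e2, e3, hΛ, Finset.range_zero, Finset.sum_empty]
    refine ⟨by simp, fun z hz hne => absurd (hn0 z hz).2.2.2 hne, fun y hy => ?_,
      fun _ _ => by simp, htree₃.congr hocc, ?_, by simp⟩
    · rw [(hn0 y hy).2.2.1]; exact hpos
    · rw [total, Finset.sum_congr rfl fun z hz => hocc z (Finset.mem_range.1 hz)]; simp
  · simp only [Ex.eval_var, P₃.par.bm]
    intro r hr s₄ hf₄ ⟨h1, h2, h3, h4, h5, h6, h7⟩
    have P₄ : Prepared P s₄ := P₃.frame hf₄ rfl rfl rfl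
    have ea₄ : ∀ q, (Stmt.loop .r (.var .bm) storeBucket).stores q = false → s₄.a q = s₃.a q :=
      fun q hq => hf₄.a _ hq
    have hΛr := hΛle r hr.le
    have hΛs : Λ (r + 1) = Λ r + (bk r).length := Finset.sum_range_succ _ _
    have hlr := hlen r hr
    refine (storeBucket_spec hF (base := base) (nk := nk) (r := r) (l := bk r) ?_ ?_ hba ?_ hr ?_ ?_
      ?_ ?_ ?_ (hK.nodup r hr) ?_ ?_ ?_).mono ?_
    · exact (P₄.par.set .r _ (by decide)).congr fun _ _ => rfl
    · simp only [St.tick_v, St.set_v, reduceCtorEq, if_false]; rw [hf₄.v _ rfl, ebase₃]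
    · simp
    · omega
    · simp only [St.tick_a, St.set_a]
      rw [ea₄ .kc rfl, ea₄ .kv rfl, ea₄ .nxt rfl, ea₄ .head rfl, ea₃ .kc rfl, ea₃ .kv rfl,
        ea₃ .nxt rfl, ea₃ .head rfl]
      exact hB.chain r hr
    · simp only [St.tick_a, St.set_a]
      rw [ea₄ .len rfl, ea₃ .len rfl]
      exact hB.len r hr
    · omega
    · exact fun e he => hs _ (hK.lt r hr e he)
    · exact h3 r hr
    · exact h5
    · simp only [St.tick_a, St.set_a, h6]
      have e1 : (bk r).length * Λ r ≤ (P.m + 1) * P.maxKeys b :=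
        Nat.mul_le_mul hlr (by omega)
      have e2 : 2 * P.maxKeys b * (P.m + 1) = 2 * ((P.m + 1) * P.maxKeys b) := by ring
      rw [Nat.mul_add, Nat.add_mul, one_mul]
      omega
    intro s' hf ⟨dd, hdd, g1, g2, g3, g4, g5, g6⟩
    simp only [St.tick_a, St.set_a, St.tick_t, St.set_t] at g1 g2 g3 g5 g6
    have hdy : ∀ y, y ≠ r → s'.a .disp2 (base + y) = s₄.a .disp2 (base + y) := fun y hy => by
      rw [g1, Function.update_of_ne (by omega)]
    have hdr : s'.a .disp2 (base + r) = dd := by rw [g1, Function.update_self]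
    have hin : ∀ e ∈ bk r, e.1 ^^^ dd < 2 ^ P.m := fun e he =>
      Nat.xor_lt_two_pow (hs _ (hK.lt r hr e he)) hdd
    refine ⟨fun y hy e he => ?_, fun z hz hne => ?_, fun y hy => ?_, fun x hx => ?_, g4, by omega, ?_⟩
    · rcases Nat.lt_succ_iff_lt_or_eq.1 hy with h | rfl
      · rw [hdy y h.ne]
        have h8 := h1 y h e he
        have h9 := g3 (base + (e.1 ^^^ s₄.a .disp2 (base + y))) fun e' he' heq => by
          rw [heq, (g2 e' he').1] at h8
          omega
        rw [h9.1, h9.2]; exact h8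
      · rw [hdr]; exact (g2 e he).2
    · by_cases hc : ∃ e ∈ bk r, z = e.1 ^^^ dd
      · obtain ⟨e, he, rfl⟩ := hc
        exact ⟨r, by omega, e, he, by rw [hdr]⟩
      · rw [(g3 (base + z) fun e he heq => hc ⟨e, he, by omega⟩).1] at hne
        obtain ⟨y, hy, e, he, hz'⟩ := h2 z hz hne
        exact ⟨y, by omega, e, he, by rw [hdy y hy.ne]; exact hz'⟩
    · by_cases h : y = r
      · rw [h, hdr]; exact hdd
      · rw [hdy y h]; exact h3 y hy
    · obtain ⟨i1, i2, i3⟩ := h4 x hx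
      have i4 := g3 x fun e he heq => by have := hin e he; omega
      refine ⟨?_, i4.1.trans i2, i4.2.trans i3⟩
      rw [g1, Function.update_of_ne (by omega), i1]
    · rw [hΛs, Nat.add_mul]; omega
  · simp only [Ex.eval_var, P₃.par.bm]
    intro s' hf ⟨h1, h2, h3, h4, h5, h6, h7⟩
    have ed1 : s'.a .disp1 = D1 := by rw [hf.a _ rfl, ea₃ _ rfl]
    refine ⟨⟨?_, h3, ?_, ?_⟩, ?_, ?_, ?_⟩
    · rw [ed1]; exact hd1
    · rintro c hc col y z hy hy' hz hkey
      rw [ed1] at hy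
      have hz' : z < 2 ^ P.m := hz ▸ Nat.xor_lt_two_pow (hs c hc) (h3 y hy')
      obtain ⟨y', hy₁, e, he, hze⟩ := h2 z hz' (by omega)
      obtain ⟨k1, k2⟩ := h1 y' hy₁ e he
      rw [← hze, hkey] at k1
      obtain ⟨rfl, rfl⟩ := mul_add_inj hy' hy₁ (Nat.add_right_cancel k1)
      obtain ⟨i, col', q1, q2, q3⟩ := hK.sound y hy' e he
      have : col' = col := Nat.xor_left_inj.1 (q2.trans hy.symm)
      subst this
      exact ⟨i, q1, by rw [hze, k2, q3]⟩
    · rintro c hc i col y z hy hz hk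
      rw [ed1] at hy
      obtain ⟨v, hv⟩ := hK.complete c hc i col hk
      have hy' : y < 2 ^ P.m :=
        hy ▸ Nat.xor_lt_two_pow (hk.lt hP.pos).1 (hd1 c (hs c hc))
      rw [← hz]
      rw [show col ^^^ D1 (base + c) = y from hy] at hv
      exact (h1 y hy' _ hv).1
    · have : s'.a .mark = s₂.a .mark := by rw [hf.a _ rfl, ea₃ _ rfl]
      rw [this]; exact hmk
    · intro x hx
      obtain ⟨i1, i2, i3⟩ := h4 x hx
      obtain ⟨j1, j2, j3⟩ := hout x hx
      refine ⟨?_, ?_, i1, i2, i3⟩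
      · rw [hf.a _ rfl, ea₃ _ rfl, j3, ea₁ _ rfl]
      · rw [ed1, j1, ea₁ _ rfl]
    · have e1 := hΛle _ le_rfl
      have e2 : Λ (2 ^ P.m) * (400 + 200 * P.m) ≤ 200 * (2 * P.maxKeys b * (P.m + 1)) := by
        calc Λ (2 ^ P.m) * (400 + 200 * P.m) ≤ P.maxKeys b * (400 * (P.m + 1)) :=
              Nat.mul_le_mul (by omega) (by omega)
          _ = _ := by ring
      omega

end

end WordRAM

namespace WordRAM

open Var in
/-- Compute the parameters. -/
def setPar : Stmt :=
  .set u 0 ;; .loop i sig (.ite .lt (.shl 1 u) sig (.set u (u + 1)) .skip) ;;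
  .set g ((u / .shl 1 (k + 2) : Ex) + 1) ;; .set lv ((u / g : Ex) + 1) ;; .set m (u + (g + g : Ex)) ;;
  .set kap ((k + k : Ex) + 6) ;; .set nb (.shr n u + 1) ;;
  .set bu (.shl 1 u) ;; .set bg (.shl 1 g) ;; .set bm (.shl 1 m)

open Var in
/-- Store the parameters. -/
def savePar : Stmt :=
  .put .par 0 u ;; .put .par 1 g ;; .put .par 2 lv ;; .put .par 3 m ;; .put .par 4 kap ;; .put .par 5 nb

open Var in
/-- Load the parameters. -/
def loadPar : Stmt :=
  .set u (.get .par 0) ;; .set g (.get .par 1) ;; .set lv (.get .par 2) ;; .set m (.get .par 3) ;;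
  .set kap (.get .par 4) ;; .set nb (.get .par 5) ;;
  .set bu (.shl 1 u) ;; .set bg (.shl 1 g) ;; .set bm (.shl 1 m)

/-- The array `A` contains the parameters. -/
structure Inst.SavedPar (P : Inst) (A : ℕ → ℕ) : Prop where
  u : A 0 = P.u
  g : A 1 = P.g
  lv : A 2 = P.lv
  m : A 3 = P.m
  kap : A 4 = P.kap
  nb : A 5 = P.nb

section
variable {P : Inst} {E : Env}

theorem setPar_spec (hF : P.Fits E) {s : St} (hn : s.v .n = P.n)
    (hs : s.v .sig = P.sig) (hk : s.v .k = P.k) :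
    wp E setPar s fun s' => P.HasPar s' ∧ s'.t ≤ s.t + 200 + 30 * P.sig := by
  obtain ⟨w1, w2, w3⟩ := hF.wide
  have f1 := hF.tree_le
  have f3 := hF.n_lt
  have f4 := hF.kap_lt
  have hpow : 2 ^ (P.m + 1) = 2 * 2 ^ P.m := by ring
  have hub := P.pow_m_ge
  have hg0 : 0 < 2 ^ P.g := by positivity
  have hu0 : 0 < 2 ^ P.u := by positivity
  have hm0 : P.m < 2 ^ P.m := Nat.lt_two_pow_self
  have hk0 : P.kap < 2 ^ P.kap := Nat.lt_two_pow_self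
  have hkk : 2 ^ (P.k + 2) ≤ 2 ^ P.kap := Nat.pow_le_pow_right (by norm_num) (by unfold Inst.kap; omega)
  have hkap : P.kap = P.k + P.k + 6 := by unfold Inst.kap; ring
  have hm : P.m = P.u + (P.g + P.g) := by unfold Inst.m; ring
  have hlv : P.u / P.g ≤ P.u := Nat.div_le_self _ _
  have hg : P.u / 2 ^ (P.k + 2) + 1 = P.g := rfl
  have hlv' : P.u / P.g + 1 = P.lv := rfl
  have hnb : P.n / 2 ^ P.u ≤ P.n := Nat.div_le_self _ _
  have hnb' : P.n / 2 ^ P.u + 1 = P.nb := rfl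
  unfold setPar
  simp only [wp_seq, wp_set]
  refine ⟨by simp, ?_⟩
  refine wp_loop (fun i s' => s'.v .u = min i P.u ∧ s'.t ≤ s.t + 20 + 20 * i) (by simp) ?_ ?_ ?_
  · simp
  · simp only [Ex.eval_var, St.tick_v, St.set_v, reduceCtorEq, if_false, hs]
    intro i hi s₁ hf ⟨h1, h2⟩
    have es : s₁.v .sig = P.sig := by rw [hf.v _ rfl]; simp [hs]
    have hpu : 2 ^ min i P.u ≤ 2 ^ P.u := Nat.pow_le_pow_right (by norm_num) (min_le_right _ _)
    refine wp_ite (by simp [h1]; omega) (by simp) (fun h => ?_) (fun h => ?_)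
    · simp [h1, es] at h ⊢
      have := (Nat.lt_clog_iff_pow_lt (by norm_num)).2 h
      change _ < P.u at this
      omega
    · simp [h1, es] at h ⊢
      have := (Nat.clog_le_iff_le_pow (by norm_num)).2 h
      change P.u ≤ _ at this
      omega
  · simp only [Ex.eval_var, St.tick_v, St.set_v, reduceCtorEq, if_false, hs]
    intro s₁ hf ⟨h1, h2⟩
    have hus : P.u ≤ P.sig := Nat.clog_le_of_le_pow Nat.lt_two_pow_self.le
    rw [min_eq_right hus] at h1
    have en : s₁.v .n = P.n := by rw [hf.v _ rfl]; simp [hn]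
    have ek : s₁.v .k = P.k := by rw [hf.v _ rfl]; simp [hk]
    simp [en, ek, h1, hg, hlv', ← hm, ← hkap, hnb']
    refine ⟨by omega, by omega, by omega, by omega, by omega, by omega, by omega, by omega, ?_, by omega⟩
    constructor <;> simp [h1]

theorem savePar_spec (hF : P.Fits E) (ha : 8 < E.amax) {s : St} (hp : P.HasPar s) :
    wp E savePar s fun s' => P.SavedPar (s'.a .par) ∧ s'.t ≤ s.t + 100 := by
  obtain ⟨w1, w2, w3⟩ := hF.wide
  simp [savePar, hp.u, hp.g, hp.lv, hp.m, hp.kap, hp.nb]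
  refine ⟨by omega, by omega, by omega, by omega, by omega, by omega, ?_⟩
  constructor <;> simp

theorem loadPar_spec (hF : P.Fits E) (ha : 8 < E.amax) {s : St} (hp : P.SavedPar (s.a .par)) :
    wp E loadPar s fun s' => P.HasPar s' ∧ s'.t ≤ s.t + 100 := by
  obtain ⟨w1, w2, w3⟩ := hF.wide
  have f1 := hF.tree_le
  have hpow : 2 ^ (P.m + 1) = 2 * 2 ^ P.m := by ring
  have hub := P.pow_m_ge
  have hg0 : 0 < 2 ^ P.g := by positivity
  have hu0 : 0 < 2 ^ P.u := by positivity
  simp [loadPar, hp.u, hp.g, hp.lv, hp.m, hp.kap, hp.nb]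
  refine ⟨by omega, by omega, by omega, by omega, by omega, by omega, by omega, by omega, by omega, ?_⟩
  constructor <;> simp

/-- The index of position `p` in the sorted array. -/
def Inst.rank (P : Inst) (p : ℕ) : ℕ := P.S (P.T p) + P.R (P.T p) p

theorem Inst.rank_lt_S_succ {p : ℕ} (hp : p < P.n) : P.rank p < P.S (P.T p + 1) := by
  have h1 := R_mono (P := P) (P.T p) (Nat.succ_le_of_lt hp)
  rw [Nat.succ_eq_add_one, R_succ, if_pos ⟨hp, rfl⟩] at h1
  rw [S_succ, rank]
  omega

theorem Inst.rank_ne {p p' : ℕ} (hp : p < P.n) (h : p' < p) : P.rank p' ≠ P.rank p := by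
  have hp' := h.trans hp
  rcases lt_trichotomy (P.T p') (P.T p) with hT | hT | hT
  · have h1 := rank_lt_S_succ hp'
    have h2 := S_mono (P := P) (Nat.succ_le_of_lt hT)
    have h3 : P.S (P.T p) ≤ P.rank p := Nat.le_add_right _ _
    simp only [Nat.succ_eq_add_one] at h2
    omega
  · have h1 := R_mono (P := P) (P.T p') (Nat.succ_le_of_lt h)
    rw [Nat.succ_eq_add_one, R_succ, if_pos ⟨hp', rfl⟩] at h1
    unfold rank
    rw [← hT]
    omega
  · have h1 := rank_lt_S_succ hp
    have h2 := S_mono (P := P) (Nat.succ_le_of_lt hT)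
    have h3 : P.S (P.T p') ≤ P.rank p' := Nat.le_add_right _ _
    simp only [Nat.succ_eq_add_one] at h2
    omega

theorem Inst.n_lt_blocks : P.n < P.nb * 2 ^ P.u := by
  rw [mul_comm]; exact Nat.lt_mul_div_succ _ (by positivity)

open Var in
/-- Count the occurrences of the characters. -/
def countChars : Stmt :=
  .loop p n (.set c (.inp p) ;; .put .st (c + 1) (.get .st (c + 1) + 1)) ;;
  .loop c sig (.put .st (c + 1) (.get .st (c + 1) + .get .st c))

theorem countChars_spec (hF : P.Fits E) (hV : P.Valid) (hT : ∀ p < P.n, E.inp p = P.T p) {s : St}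
    (hn : s.v .n = P.n) (hs : s.v .sig = P.sig) (h0 : ∀ i, s.a .st i = 0) :
    wp E countChars s fun s' => (∀ c ≤ P.sig, s'.a .st c = P.S c) ∧ s'.t ≤ s.t + 100 + 100 * P.n := by
  obtain ⟨w1, w2, w3⟩ := hF.wide
  have f3 := hF.n_lt
  have hsn := hV.sig_le
  have hS0 : P.S 0 = 0 := by simp [Inst.S, Nat.count_eq_card_filter_range]
  have hRn : ∀ c, P.R c P.n ≤ P.n := fun c => Nat.count_le _
  have hR0 : ∀ c, P.R c 0 = 0 := fun c => Nat.count_zero _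
  have hRle : ∀ c p, P.R c p ≤ P.n := fun c p => (Inst.R_le c p).trans (hRn c)
  unfold countChars
  simp only [wp_seq]
  refine wp.mono (Q := fun s' => s'.a .st 0 = 0 ∧ (∀ c, s'.a .st (c + 1) = P.R c P.n) ∧
    s'.t ≤ s.t + 20 + 50 * P.n) (wp_loop (fun q s' => s'.a .st 0 = 0 ∧
    (∀ c, s'.a .st (c + 1) = P.R c q) ∧ s'.t ≤ s.t + 20 + 50 * q) (by simp) ?_ ?_ ?_) ?_
  · simp [h0, hR0]
  · simp only [Ex.eval_var, hn]
    intro q hq s₁ hf ⟨h1, h2, h3⟩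
    have hq' := hV.T_lt q hq
    have hr := hRle (P.T q) q
    simp [hT q hq, h2]
    refine ⟨by omega, h1, fun c => ?_,
      by omega⟩
    rw [Inst.R_succ, Function.update_apply]
    by_cases h : c = P.T q
    · simp [h, hq]
    · simp [h, Ne.symm h, h2]
  · simp only [Ex.eval_var, hn]
    exact fun _ _ h => h
  intro s₁ hf₁ ⟨h1, h2, h3⟩
  have es : s₁.v .sig = P.sig := by rw [hf₁.v _ rfl, hs]
  refine wp_loop (fun q s' => (∀ c ≤ q, s'.a .st c = P.S c) ∧
    (∀ c ≥ q, s'.a .st (c + 1) = P.R c P.n) ∧ s'.t ≤ s₁.t + 10 + 40 * q) (by simp) ?_ ?_ ?_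
  · simp [h1, h2, hS0]
  · simp only [Ex.eval_var, es]
    intro q hq s₂ hf ⟨g1, g2, g3⟩
    have e1 := g1 q le_rfl
    have e2 := g2 q le_rfl
    have e3 := Inst.S_le (P := P) (q + 1)
    have e4 := Inst.S_succ (P := P) q
    simp [e1, e2]
    refine ⟨by omega, fun c hc => ?_, fun c hc => ?_, by omega⟩
    · rcases Nat.lt_or_eq_of_le hc with h | rfl
      · rw [Function.update_of_ne (by omega)]; exact g1 c (by omega)
      · simp; omega
    · rw [Function.update_of_ne (by omega)]; exact g2 c (by omega)
  · simp only [Ex.eval_var, es]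
    intro s' hf ⟨g1, g2, g3⟩
    exact ⟨g1, by omega⟩

open Var in
/-- Sort the positions by their characters, and record the boundaries of the blocks. -/
def sortPos : Stmt :=
  .loop b (nb + 1) (.set tb (.shl b u) ;; .loop c sig (.put .first (tb + c) (.get .st c)) ;;
    .loop x bu (.set p (tb + x) ;; .ite .lt p n
      (.set c (.inp p) ;; .put .ps (.get .st c) p ;; .put .st c (.get .st c + 1)) .skip))

theorem sortPos_spec (hF : P.Fits E) (hV : P.Valid) (hT : ∀ p < P.n, E.inp p = P.T p) {s : St}
    (hp : P.HasPar s) (hn : s.v .n = P.n) (hs : s.v .sig = P.sig)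
    (hst : ∀ c ≤ P.sig, s.a .st c = P.S c) :
    wp E sortPos s fun s' => Prepared P s' ∧ s'.t ≤ s.t + 20 + (P.nb + 1) * (50 + 150 * 2 ^ P.u) := by
  obtain ⟨w1, w2, w3⟩ := hF.wide
  have f2 := hF.blocks_le
  have f3 := hF.n_lt
  have hsn := hV.sig_le
  have hsu := hV.sig_le_pow
  have hR0 : ∀ c, P.R c 0 = 0 := fun c => Nat.count_zero _
  have hnb := P.n_lt_blocks
  rw [Nat.add_mul, one_mul] at f2
  have hnb1 : P.nb ≤ P.nb * 2 ^ P.u := Nat.le_mul_of_pos_right _ (by positivity)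
  refine wp.mono (Q := fun s' => P.IsPos (s'.a .ps) ∧
    (∀ b ≤ P.nb, ∀ c < P.sig, s'.a .first (b * 2 ^ P.u + c) = P.lo b c) ∧
    s'.t ≤ s.t + 20 + (P.nb + 1) * (50 + 150 * 2 ^ P.u)) (wp_loop (fun b s' =>
    (∀ c < P.sig, s'.a .st c = P.S c + P.R c (b * 2 ^ P.u)) ∧
    (∀ p < P.n, p < b * 2 ^ P.u → s'.a .ps (P.rank p) = p) ∧
    (∀ b' < b, ∀ c < P.sig, s'.a .first (b' * 2 ^ P.u + c) = P.lo b' c) ∧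
    s'.t ≤ s.t + 20 + b * (50 + 150 * 2 ^ P.u)) ?_ ?_ ?_ ?_) ?_
  · simp [hp.nb]; omega
  · simp [hR0]
    exact fun c hc => hst c hc.le
  · simp only [Ex.eval_add, Ex.eval_var, Ex.eval_ofNat, hp.nb]
    intro b hb s₁ hf₁ ⟨h1, h2, h3, h4⟩
    have p₁ : P.HasPar s₁ := hp.frame hf₁ rfl
    have es₁ : s₁.v .sig = P.sig := by rw [hf₁.v _ rfl, hs]
    have en₁ : s₁.v .n = P.n := by rw [hf₁.v _ rfl, hn]
    have hbb : b * 2 ^ P.u ≤ P.nb * 2 ^ P.u := Nat.mul_le_mul_right _ (by omega)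
    have hbs : (b + 1) * 2 ^ P.u = b * 2 ^ P.u + 2 ^ P.u := by ring
    simp only [wp_seq, wp_set]
    refine ⟨by simp [p₁.u]; omega, ?_⟩
    refine wp.mono (Q := fun s' =>
      (∀ b' < b + 1, ∀ c < P.sig, s'.a .first (b' * 2 ^ P.u + c) = P.lo b' c) ∧
      s'.t ≤ s₁.t + 30 + 30 * P.sig) (wp_loop (fun q s' =>
      (∀ b' < b, ∀ c < P.sig, s'.a .first (b' * 2 ^ P.u + c) = P.lo b' c) ∧
      (∀ c < q, s'.a .first (b * 2 ^ P.u + c) = P.lo b c) ∧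
      s'.t ≤ s₁.t + 30 + 30 * q) (by simp) ?_ ?_ ?_) ?_
    · simp; exact h3
    · simp only [Ex.eval_var, St.tick_v, St.set_v, reduceCtorEq, if_false, es₁]
      intro q hq s₂ hf₂ ⟨g1, g2, g3⟩
      have etb : s₂.v .tb = b * 2 ^ P.u := by rw [hf₂.v _ rfl]; simp [p₁.u]
      have est : s₂.a .st = s₁.a .st := by rw [hf₂.a _ rfl]; simp
      simp [etb, est]
      refine ⟨by omega, fun b' hb' c hc => ?_, fun c hc => ?_, by omega⟩
      · have : (b' + 1) * 2 ^ P.u ≤ b * 2 ^ P.u := Nat.mul_le_mul_right _ hb'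
        rw [Nat.add_mul] at this
        rw [Function.update_of_ne (by omega)]
        exact g1 b' hb' c hc
      · rcases Nat.lt_or_eq_of_le hc with h | rfl
        · rw [Function.update_of_ne (by omega)]; exact g2 c h
        · rw [Function.update_self]; exact h1 c hq
    · simp only [Ex.eval_var, St.tick_v, St.set_v, reduceCtorEq, if_false, es₁]
      intro s₂ hf₂ ⟨g1, g2, g3⟩
      refine ⟨fun b' hb' c hc => ?_, g3⟩
      rcases Nat.lt_succ_iff_lt_or_eq.1 hb' with h | rfl
      · exact g1 b' h c hc
      · exact g2 c hc
    intro s₂ hf₂ ⟨g1, g2⟩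
    have ebu₂ : s₂.v .bu = 2 ^ P.u := by rw [hf₂.v _ rfl]; simp [p₁.bu]
    have en₂ : s₂.v .n = P.n := by rw [hf₂.v _ rfl]; simp [en₁]
    have etb₂ : s₂.v .tb = b * 2 ^ P.u := by rw [hf₂.v _ rfl]; simp [p₁.u]
    have est₂ : s₂.a .st = s₁.a .st := by rw [hf₂.a _ rfl]; simp
    have eps₂ : s₂.a .ps = s₁.a .ps := by rw [hf₂.a _ rfl]; simp
    refine wp_loop (fun x s' =>
      (∀ c < P.sig, s'.a .st c = P.S c + P.R c (b * 2 ^ P.u + x)) ∧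
      (∀ p < P.n, p < b * 2 ^ P.u + x → s'.a .ps (P.rank p) = p) ∧
      s'.t ≤ s₂.t + 10 + x * 100) (by simp) ?_ ?_ ?_
    · simp [est₂, eps₂]; exact ⟨h1, h2⟩
    · simp only [Ex.eval_var, ebu₂]
      intro x hx s₃ hf₃ ⟨i1, i2, i3⟩
      have en₃ : s₃.v .n = P.n := by rw [hf₃.v _ rfl, en₂]
      have etb₃ : s₃.v .tb = b * 2 ^ P.u := by rw [hf₃.v _ rfl, etb₂]
      set p := b * 2 ^ P.u + x with hpdef
      simp only [wp_seq, wp_set]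
      refine ⟨by simp [etb₃]; omega, wp_ite (by simp) (by simp) (fun h => ?_) (fun h => ?_)⟩
      · simp [etb₃, en₃, ← hpdef] at h
        have hTp := hV.T_lt p h
        have e1 := i1 _ hTp
        have e2 := Inst.rank_lt_S_succ h
        have e3 := Inst.S_le (P := P) (P.T p + 1)
        have e4 : P.S (P.T p) + P.R (P.T p) p = P.rank p := rfl
        simp [etb₃, ← hpdef, hT p h, e1, e4]
        refine ⟨by omega, by omega, fun c hc => ?_, fun p' hp' hpp => ?_, by omega⟩
        · rw [show b * 2 ^ P.u + (x + 1) = p + 1 by omega, Inst.R_succ, Function.update_apply]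
          by_cases hcT : c = P.T p
          · subst hcT; simp [h]; omega
          · simp [hcT, Ne.symm hcT, i1 c hc]
        · rcases Nat.lt_or_eq_of_le (show p' ≤ p by omega) with h' | rfl
          · rw [Function.update_of_ne (Inst.rank_ne h h')]; exact i2 p' hp' h'
          · rw [Function.update_self]
      · simp [etb₃, en₃, ← hpdef] at h
        simp [etb₃]
        refine ⟨fun c hc => ?_, fun p' hp' hpp => i2 p' hp' (by omega), by omega⟩
        rw [show b * 2 ^ P.u + (x + 1) = p + 1 by omega, Inst.R_succ, if_neg (by omega), i1 c hc, add_zero]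
    · simp only [Ex.eval_var, ebu₂]
      intro s' hf ⟨i1, i2, i3⟩
      rw [hbs]
      refine ⟨i1, i2, ?_, by rw [Nat.add_mul]; omega⟩
      rw [hf.a _ rfl]; exact g1
  · simp only [Ex.eval_add, Ex.eval_var, Ex.eval_ofNat, hp.nb]
    intro s' hf ⟨h1, h2, h3, h4⟩
    rw [Nat.add_mul, one_mul] at h2
    exact ⟨fun p hp' => h2 p hp' (by omega), fun b hb => h3 b (by omega), h4⟩
  · intro s' hf ⟨h1, h2, h3⟩
    refine ⟨⟨hp.frame hf rfl, ?_, h1, h2⟩, h3⟩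
    rw [hf.v _ rfl, hs]

end

end WordRAM

namespace WordRAM

/-- The arrays are an index of the text. -/
structure IsIndex (P : Inst) (a : Arr → ℕ → ℕ) : Prop where
  par : P.SavedPar (a .par)
  pos : P.IsPos (a .ps)
  first : ∀ b ≤ P.nb, ∀ c < P.sig, a .first (b * 2 ^ P.u + c) = P.lo b c
  dict : ∀ b < P.nb, IsDict P (a .ps) b (b * 2 ^ P.m) (a .disp1) (a .disp2) (a .key) (a .val)

open Var in
/-- Build the index. -/
def buildIndex : Stmt :=
  setPar ;; savePar ;; countChars ;; sortPos ;;
  .loop b nb (.set tb (.shl b u) ;; .set base (.shl b m) ;; buildDict)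

section
variable {P : Inst} {E : Env}

theorem buildIndex_spec (hF : P.Fits E) (hV : P.Valid) (hT : ∀ p < P.n, E.inp p = P.T p) {s : St}
    (ha : 8 < E.amax) (hn : s.v .n = P.n) (hs : s.v .sig = P.sig) (hk : s.v .k = P.k)
    (h0 : ∀ q i, s.a q i = 0) :
    wp E buildIndex s fun s' => IsIndex P s'.a ∧ s'.t ≤ s.t + 5000 * (P.nb * 2 ^ P.m) := by
  obtain ⟨w1, w2, w3⟩ := hF.wide
  have f2 := hF.blocks_le
  have f5 := hF.cells_le
  have hx6 : 0 < 2 ^ P.m := by positivity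
  have hg0 : 0 < 2 ^ P.g := by positivity
  unfold buildIndex
  simp only [wp_seq]
  refine (setPar_spec hF hn hs hk).mono ?_
  intro s₁ hf₁ ⟨p₁, ht₁⟩
  refine (savePar_spec hF ha p₁).mono ?_
  intro s₂ hf₂ ⟨hpar, ht₂⟩
  have p₂ : P.HasPar s₂ := p₁.frame hf₂ rfl
  have en₂ : s₂.v .n = P.n := by rw [hf₂.v _ rfl, hf₁.v _ rfl, hn]
  have es₂ : s₂.v .sig = P.sig := by rw [hf₂.v _ rfl, hf₁.v _ rfl, hs]
  have ea₂ : ∀ q, savePar.stores q = false → s₂.a q = s.a q := fun q hq => by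
    rw [hf₂.a _ hq, hf₁.a _ rfl]
  refine (countChars_spec hF hV hT en₂ es₂ ?_).mono ?_
  · rw [ea₂ _ rfl]; exact h0 _
  intro s₃ hf₃ ⟨hst, ht₃⟩
  have p₃ : P.HasPar s₃ := p₂.frame hf₃ rfl
  refine (sortPos_spec hF hV hT p₃ ?_ ?_ hst).mono ?_
  · rw [hf₃.v _ rfl, en₂]
  · rw [hf₃.v _ rfl, es₂]
  intro s₄ hf₄ ⟨P₄, ht₄⟩
  have epar₄ : s₄.a .par = s₂.a .par := by rw [hf₄.a _ rfl, hf₃.a _ rfl]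
  have ez : ∀ q ∈ [Arr.mark, .len, .disp1, .disp2, .key], ∀ x, s₄.a q x = 0 := by
    intro q hq x
    rw [hf₄.a, hf₃.a, ea₂, h0] <;> fin_cases hq <;> rfl
  refine wp_loop (fun B s' => (∀ b < B, IsDict P (s'.a .ps) b (b * 2 ^ P.m) (s'.a .disp1) (s'.a .disp2)
      (s'.a .key) (s'.a .val)) ∧ (∀ x, s'.a .mark x ≤ B * 2 ^ P.u) ∧
      (∀ x ≥ B * 2 ^ P.m, s'.a .len x = 0 ∧ s'.a .disp1 x = 0 ∧ s'.a .disp2 x = 0 ∧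
        s'.a .key x = 0) ∧
      s'.t ≤ s₄.t + 10 + B * (50 + 3000 * 2 ^ P.m)) (by simp) ?_ ?_ ?_
  · simp [ez]
  · simp only [Ex.eval_var, P₄.par.nb]
    intro b hb s₅ hf₅ ⟨h1, h2, h3, h4⟩
    have P₅ : Prepared P s₅ := P₄.frame hf₅ rfl rfl rfl
    have e1 : (b + 1) * 2 ^ P.m ≤ P.nb * 2 ^ P.m := Nat.mul_le_mul_right _ hb
    have e2 : b * 2 ^ P.u ≤ (P.nb + 1) * 2 ^ P.u := Nat.mul_le_mul_right _ (by omega)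
    have e3 : (b + 1) * 2 ^ P.m = b * 2 ^ P.m + 2 ^ P.m := by ring
    simp only [wp_seq, wp_set]
    refine ⟨by simp [P₅.par.u]; omega, by simp [P₅.par.m]; omega, ?_⟩
    refine (buildDict_spec hF hV (b := b) (base := b * 2 ^ P.m) ?_ hb ?_ ?_ (by omega) ?_ ?_).mono ?_
    · exact ((((P₅.set .b _ (by decide)).tick _).set .tb _ (by decide)).tick _).set .base _ (by decide)
        |>.tick _
    · simp [P₅.par.u]
    · simp [P₅.par.m]
    · intro x hx _
      exact h3 x hx
    · exact h2
    intro s' hf ⟨g1, g2, g3, g4⟩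
    simp at g1 g3 g4
    have eps : s'.a .ps = s₅.a .ps := by rw [hf.a _ rfl]; simp
    refine ⟨fun b' hb' => ?_, g2, fun x hx => ?_, by rw [Nat.add_mul]; omega⟩
    · rcases Nat.lt_succ_iff_lt_or_eq.1 hb' with h | rfl
      · rw [eps]
        refine (h1 b' h).congr P₅.pos hV fun x hx hx' => ?_
        have e4 : (b' + 1) * 2 ^ P.m ≤ b * 2 ^ P.m := Nat.mul_le_mul_right _ h
        rw [Nat.add_mul, one_mul] at e4
        exact (g3 x (Or.inl (by omega))).2
      · rw [eps]; exact g1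
    · obtain ⟨i1, i2, i3, i4, -⟩ := g3 x (Or.inr (by omega))
      obtain ⟨j1, j2, j3, j4⟩ := h3 x (by omega)
      exact ⟨i1.trans j1, i2.trans j2, i3.trans j3, i4.trans j4⟩
  · simp only [Ex.eval_var, P₄.par.nb]
    intro s' hf ⟨h1, h2, h3, h4⟩
    have P' : Prepared P s' := P₄.frame hf rfl rfl rfl
    refine ⟨⟨?_, P'.pos, P'.first, h1⟩, ?_⟩
    · rw [hf.a _ rfl, epar₄]; exact hpar
    · have hsu := hV.sig_le_pow
      have hn' := P.n_lt_blocks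
      have hum : 2 ^ P.u ≤ 2 ^ P.m := by have := P.pow_m_ge; omega
      have hx1 : P.nb * 2 ^ P.u ≤ P.nb * 2 ^ P.m := Nat.mul_le_mul_left _ hum
      have hnb1 : 1 ≤ P.nb := Nat.succ_pos _
      have hx2 : 1 * 2 ^ P.m ≤ P.nb * 2 ^ P.m := Nat.mul_le_mul_right _ hnb1
      have hx3 : P.nb * 1 ≤ P.nb * 2 ^ P.m := Nat.mul_le_mul_left _ hx6
      have hx4 : (P.nb + 1) * (50 + 150 * 2 ^ P.u) =
        50 * P.nb + 50 + 150 * (P.nb * 2 ^ P.u) + 150 * 2 ^ P.u := by ring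
      have hx5 : P.nb * (50 + 3000 * 2 ^ P.m) = 50 * P.nb + 3000 * (P.nb * 2 ^ P.m) := by ring
      omega

end

end WordRAM

namespace WordRAM

open Var in
/-- Test whether the interval of level `i` is a key, and keep its value in `l` if so. -/
def testLevel : Stmt :=
  .set i ((il + ih : Ex) / 2) ;; .set col (.shr vv (g * i)) ;;
  .set y (.xor col (.get .disp1 (base + c))) ;; .set z (.xor c (.get .disp2 (base + y))) ;;
  .ite .eq (.get .key (base + z)) ((.shl c m + y : Ex) + 1)
    (.set ih i ;; .set l (.get .val (base + z))) (.set il (i + 1))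

open Var in
/-- Binary search for the smallest level whose interval is a key. -/
def searchLevel : Stmt :=
  .set il 0 ;; .set ih lv ;; .loop r kap (.ite .lt il ih testLevel .skip)

open Var in
/-- Move behind the next occurrence of `c`. -/
def nextOcc : Stmt :=
  .set b (.shr pos u) ;; .set tb (.shl b u) ;; .set lo (.get .first (tb + c)) ;;
  .set hi (.get .first ((tb + bu) + c)) ;; .set base (.shl b m) ;; .set vv ((bu + pos) - tb) ;;
  .set l lo ;; .set h hi ;; searchLevel ;;
  .ite .lt ih lv (.set h (l + .shl 1 kap) ;; .ite .lt hi h (.set h hi) .skip) .skip ;;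
  .set tau (pos + bu) ;; bsearch (kap + 1) ;;
  .ite .lt l (.get .first (.shl nb u + c)) (.set pos (.get .ps l + 1)) (.set ok 0)

section
variable {P : Inst} {E : Env}

theorem Inst.IsKey.succ {A : ℕ → ℕ} {b c p i : ℕ} (h : P.IsKey A b c i (P.qcode b p i))
    (hi : i + 1 < P.lv) : P.IsKey A b c (i + 1) (P.qcode b p (i + 1)) := by
  obtain ⟨-, r, hr, he⟩ := h
  refine ⟨hi, r, hr, ?_⟩
  rw [Inst.qcode_parent] at he ⊢
  have h1 : P.g * (i + 1 + 1) = P.g * (i + 1) + P.g := by ring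
  rw [h1, pow_add, ← Nat.div_div_eq_div_mul, ← Nat.div_div_eq_div_mul, he]

theorem Inst.IsKey.mono {A : ℕ → ℕ} {b c p i j : ℕ} (h : P.IsKey A b c i (P.qcode b p i))
    (hij : i ≤ j) (hj : j < P.lv) : P.IsKey A b c j (P.qcode b p j) := by
  induction j, hij using Nat.le_induction with
  | base => exact h
  | succ j _ ih => exact (ih (by omega)).succ hj

theorem searchLevel_spec (hF : P.Fits E) (hV : P.Valid) {s : St} (hp : P.HasPar s)
    (hI : IsIndex P s.a) {b c p : ℕ} (hb : b < P.nb) (hc : s.v .c = c) (hc' : c < P.sig)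
    (hbp : b * 2 ^ P.u ≤ p) (hpb : p < (b + 1) * 2 ^ P.u) (hbase : s.v .base = b * 2 ^ P.m)
    (hvv : s.v .vv = 2 ^ P.u + (p - b * 2 ^ P.u)) :
    wp E searchLevel s fun s' =>
      (∀ i < s'.v .ih, ¬ P.IsKey (s.a .ps) b c i (P.qcode b p i)) ∧
      (s'.v .ih = P.lv ∧ s'.v .l = s.v .l ∨ s'.v .ih < P.lv ∧
        s'.v .l = P.keyVal b c (s'.v .ih) (P.qcode b p (s'.v .ih))) ∧
      s'.t ≤ s.t + 40 + 130 * P.kap := by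
  obtain ⟨w1, w2, w3⟩ := hF.wide
  have f1 := hF.tree_le
  have f2 := hF.sq_lt
  have f5 := hF.cells_le
  have hsq : 2 ^ (2 * P.m + 4) = 16 * (2 ^ P.m * 2 ^ P.m) := by ring
  have hpow : 2 ^ (P.m + 1) = 2 * 2 ^ P.m := by ring
  have hpos : 0 < 2 ^ P.m := by positivity
  have hg0 : 0 < 2 ^ P.g := by positivity
  have hsq2 : 2 ^ P.m * 1 ≤ 2 ^ P.m * 2 ^ P.m := Nat.mul_le_mul_left _ hpos
  have hub := P.pow_m_ge
  have hbb : (b + 1) * 2 ^ P.m ≤ P.nb * 2 ^ P.m := Nat.mul_le_mul_right _ hb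
  rw [Nat.add_mul, one_mul] at hbb
  have hcm := hV.lt_pow_m hc'
  have hcr : (c + 1) * 2 ^ P.m ≤ 2 ^ P.m * 2 ^ P.m := Nat.mul_le_mul_right _ hcm
  rw [Nat.add_mul, one_mul] at hcr
  have hm0 : P.m < 2 ^ P.m := Nat.lt_two_pow_self
  have hgm : P.u + P.g ≤ P.m := by unfold Inst.m; omega
  have hlv := P.lv_le
  have hkap : 2 ^ (P.k + 2) < 2 ^ P.kap :=
    Nat.pow_lt_pow_right (by norm_num) (by unfold Inst.kap; omega)
  have hlvu : P.lv ≤ P.u + 1 := Nat.succ_le_succ (Nat.div_le_self _ _)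
  have hD := hI.dict b hb
  have hpu : p - b * 2 ^ P.u < 2 ^ P.u := by rw [Nat.add_mul] at hpb; omega
  unfold searchLevel
  simp only [wp_seq, wp_set]
  refine ⟨by simp, by simp, ?_⟩
  refine wp_loop (fun j s' => s'.v .il ≤ s'.v .ih ∧ s'.v .ih ≤ P.lv ∧
    (∀ i < s'.v .il, ¬ P.IsKey (s.a .ps) b c i (P.qcode b p i)) ∧
    (s'.v .ih = P.lv ∧ s'.v .l = s.v .l ∨ s'.v .ih < P.lv ∧
      s'.v .l = P.keyVal b c (s'.v .ih) (P.qcode b p (s'.v .ih))) ∧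
    s'.v .ih < s'.v .il + 2 ^ (P.kap - j) ∧ s'.t ≤ s.t + 20 + j * 130) (by simp) ?_ ?_ ?_
  · simp [hp.lv]
    omega
  · simp only [Ex.eval_var, St.tick_v, St.set_v, reduceCtorEq, if_false, hp.kap]
    intro j hj s₁ hf ⟨h1, h2, h3, h4, h5, h6⟩
    have hpw : 2 ^ (P.kap - j) = 2 * 2 ^ (P.kap - (j + 1)) := by
      rw [← pow_succ']; congr 1; omega
    have hpw0 : 0 < 2 ^ (P.kap - (j + 1)) := by positivity
    refine wp_ite (by simp) (by simp) (fun h => ?_) (fun h => ?_)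
    · simp at h
      have eg : s₁.v .g = P.g := by rw [hf.v _ rfl]; simp [hp.g]
      have em : s₁.v .m = P.m := by rw [hf.v _ rfl]; simp [hp.m]
      have ebase : s₁.v .base = b * 2 ^ P.m := by rw [hf.v _ rfl]; simp [hbase]
      have ec : s₁.v .c = c := by rw [hf.v _ rfl]; simp [hc]
      have evv : s₁.v .vv = 2 ^ P.u + (p - b * 2 ^ P.u) := by rw [hf.v _ rfl]; simp [hvv]
      have ea : s₁.a = s.a := by
        ext q : 1; rw [hf.a q]; · rfl
        simp [Stmt.stores, testLevel]
      set i := (s₁.v .il + s₁.v .ih) / 2 with hi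
      have hgi : P.g * i ≤ P.g * P.lv := Nat.mul_le_mul_left _ (by omega)
      have hgl := P.g_mul_lv_le
      have hcol : (2 ^ P.u + (p - b * 2 ^ P.u)) / 2 ^ (P.g * i) = P.qcode b p i := rfl
      have hcolm : P.qcode b p i < 2 ^ P.m := (Nat.div_le_self _ _).trans_lt (by omega)
      set y := P.qcode b p i ^^^ s.a .disp1 (b * 2 ^ P.m + c) with hy
      have hym : y < 2 ^ P.m := Nat.xor_lt_two_pow hcolm (hD.d1_lt c hcm)
      set z := c ^^^ s.a .disp2 (b * 2 ^ P.m + y) with hz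
      have hzm : z < 2 ^ P.m := Nat.xor_lt_two_pow hcm (hD.d2_lt y hym)
      unfold testLevel
      simp only [wp_seq, wp_set]
      simp only [Ex.eval_add, Ex.eval_div, Ex.eval_var, Ex.eval_ofNat, Ex.eval_shr, Ex.eval_mul,
        Ex.eval_xor, Ex.eval_get, Ex.ok_add, Ex.ok_div, Ex.ok_var, Ex.ok_ofNat, Ex.ok_shr, Ex.ok_mul,
        Ex.ok_xor, Ex.ok_get, St.tick_v, St.set_v, St.tick_a, St.set_a, reduceCtorEq, if_false, if_true,
        eg, ebase, ec, evv, ea, ← hi, hcol, ← hy, ← hz, true_and, and_true]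
      refine ⟨by omega, by omega, by omega, by omega, wp_ite ?_ ?_ (fun hk => ?_) (fun hk => ?_)⟩
      · simp [ebase]; omega
      · simp [ec, em]; omega
      · simp only [Cmp.nat, Ex.eval_add, Ex.eval_var, Ex.eval_ofNat, Ex.eval_shl, 
          Ex.eval_get, St.tick_v, St.set_v, St.tick_a, St.set_a, reduceCtorEq, if_false, if_true,
          ebase, ec, em, ea] at hk
        obtain ⟨i', k1, k2⟩ := hD.sound c hc' _ y z rfl hym rfl hk
        have : i' = i := Inst.IsKey.level_eq hI.pos (by omega) hbp hpb k1
        subst this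
        simp [ebase, ea, k2]
        refine ⟨by omega, by omega, by omega, h3, Or.inr (by omega), by omega, by omega⟩
      · have hnk : ¬ P.IsKey (s.a .ps) b c i (P.qcode b p i) := fun hk' => by
          refine hk ?_
          simp only [Cmp.nat, Ex.eval_add, Ex.eval_var, Ex.eval_ofNat, Ex.eval_shl, 
            Ex.eval_get, St.tick_v, St.set_v, St.tick_a, St.set_a, reduceCtorEq, if_false, if_true,
            ebase, ec, em, ea]
          exact hD.complete c hc' i _ y z rfl rfl hk'
        simp
        refine ⟨by omega, by omega, h2, fun x hx hk' => ?_, h4, by omega, by omega⟩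
        exact hnk (hk'.mono (by omega) (by omega))
    · simp at h
      simp only [wp_skip, St.tick_v, St.set_v, reduceCtorEq, if_false, St.tick_t, St.set_t]
      exact ⟨h1, h2, h3, h4, by omega, by simp; omega⟩
  · simp only [Ex.eval_var, St.tick_v, St.set_v, reduceCtorEq, if_false, hp.kap]
    intro s' hf ⟨h1, h2, h3, h4, h5, h6⟩
    simp at h5
    refine ⟨fun i hi => h3 i (by omega), h4, by omega⟩

theorem nextOcc_spec (hF : P.Fits E) (hV : P.Valid) {s : St} (hp : P.HasPar s)
    (hI : IsIndex P s.a) (hc : s.v .c < P.sig) (hpos : s.v .pos ≤ P.n) :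
    wp E nextOcc s fun s' =>
      ((∃ p', s.v .pos ≤ p' ∧ p' < P.n ∧ P.T p' = s.v .c ∧
          (∀ x, s.v .pos ≤ x → x < p' → P.T x ≠ s.v .c) ∧ s'.v .ok = s.v .ok ∧ s'.v .pos = p' + 1) ∨
        (∀ x, s.v .pos ≤ x → x < P.n → P.T x ≠ s.v .c) ∧ s'.v .ok = 0) ∧
      s'.t ≤ s.t + 500 + 200 * P.kap := by
  obtain ⟨w1, w2, w3⟩ := hF.wide
  have f1 := hF.n_lt
  have f2 := hF.blocks_le
  have f4 := hF.kap_lt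
  have f5 := hF.cells_le
  have hsu := hV.sig_le_pow
  have hu0 : 0 < 2 ^ P.u := by positivity
  have hm0 : 0 < 2 ^ P.m := by positivity
  set c := s.v .c with hcdef
  set p := s.v .pos with hpdef
  set b := p / 2 ^ P.u with hbdef
  have hb : b < P.nb := Nat.lt_succ_of_le (Nat.div_le_div_right hpos)
  have hbp : b * 2 ^ P.u ≤ p := Nat.div_mul_le_self _ _
  have hpb : p < (b + 1) * 2 ^ P.u := by rw [mul_comm]; exact Nat.lt_mul_div_succ _ hu0
  have e1 : (b + 1) * 2 ^ P.u ≤ P.nb * 2 ^ P.u := Nat.mul_le_mul_right _ hb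
  have e2 : (b + 1) * 2 ^ P.m ≤ P.nb * 2 ^ P.m := Nat.mul_le_mul_right _ hb
  have e3 : (b + 1) * 2 ^ P.u = b * 2 ^ P.u + 2 ^ P.u := by ring
  have e4 : (P.nb + 1) * 2 ^ P.u = P.nb * 2 ^ P.u + 2 ^ P.u := by ring
  rw [Nat.add_mul, one_mul] at e2
  have hlo := hI.first b hb.le c hc
  have hhi := hI.first (b + 1) hb c hc
  rw [e3] at hhi
  have hend := hI.first P.nb le_rfl c hc
  have hkk : P.kap < 2 ^ P.kap := Nat.lt_two_pow_self
  set A := s.a .ps with hA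
  set ρ := P.S c + P.R c p with hρ
  have hρ1 : P.lo b c ≤ ρ := Nat.add_le_add_left (Inst.R_mono c hbp) _
  have hρ2 : ρ ≤ P.lo (b + 1) c := Nat.add_le_add_left (Inst.R_mono c hpb.le) _
  have hhn := Inst.lo_le_n (P := P) (b + 1) c
  have hln := Inst.lo_le_n (P := P) P.nb c
  unfold nextOcc
  simp only [wp_seq, wp_set]
  refine ⟨by simp, by simp [hp.u, ← hpdef, ← hbdef]; omega,
    by simp [hp.u, ← hpdef, ← hbdef, ← hcdef]; omega,
    by simp [hp.u, hp.bu, ← hpdef, ← hbdef, ← hcdef]; omega,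
    by simp [hp.u, hp.m, ← hpdef, ← hbdef]; omega,
    by simp [hp.u, hp.bu, ← hpdef, ← hbdef]; omega, by simp, by simp, ?_⟩
  refine (searchLevel_spec hF hV (b := b) (c := c) (p := p) ?_ ?_ hb ?_ hc hbp hpb ?_ ?_).mono ?_
  · exact hp.congr fun x hx => by
      simp only [Inst.parVars, List.mem_cons, List.not_mem_nil, or_false] at hx
      rcases hx with rfl | rfl | rfl | rfl | rfl | rfl | rfl | rfl | rfl <;> simp
  · exact hI
  · simp [← hcdef]
  · simp [hp.u, hp.m, ← hpdef, ← hbdef]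
  · simp [hp.u, hp.bu, ← hpdef, ← hbdef]; omega
  intro s₁ hf₁ ⟨h1, h2, h3⟩
  simp [hp.u, ← hpdef, ← hbdef, ← hcdef, hlo] at h2
  simp at h3
  have ea₁ : s₁.a = s.a := by
    ext q : 1; rw [hf₁.a q]; · rfl
    simp [Stmt.stores, searchLevel, testLevel]
  have ehi₁ : s₁.v .hi = P.lo (b + 1) c := by
    rw [hf₁.v _ rfl]; simp [hp.u, hp.bu, ← hpdef, ← hbdef, ← hcdef, hhi]
  have eh₁ : s₁.v .h = P.lo (b + 1) c := by
    rw [hf₁.v _ rfl]; simp [hp.u, hp.bu, ← hpdef, ← hbdef, ← hcdef, hhi]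
  have elv₁ : s₁.v .lv = P.lv := by rw [hf₁.v _ rfl]; simp [hp.lv]
  have ekap₁ : s₁.v .kap = P.kap := by rw [hf₁.v _ rfl]; simp [hp.kap]
  have ebu₁ : s₁.v .bu = 2 ^ P.u := by rw [hf₁.v _ rfl]; simp [hp.bu]
  have eu₁ : s₁.v .u = P.u := by rw [hf₁.v _ rfl]; simp [hp.u]
  have enb₁ : s₁.v .nb = P.nb := by rw [hf₁.v _ rfl]; simp [hp.nb]
  have epos₁ : s₁.v .pos = p := by rw [hf₁.v _ rfl]; simp [← hpdef]
  have ec₁ : s₁.v .c = c := by rw [hf₁.v _ rfl]; simp [← hcdef]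
  have eok₁ : s₁.v .ok = s.v .ok := by rw [hf₁.v _ rfl]; simp
  have hkap2 : 2 ^ (P.kap + 1) = 2 * 2 ^ P.kap := by ring
  have hkap0 : 0 < 2 ^ P.kap := by positivity
  refine wp.mono (Q := fun s' => P.lo b c ≤ s'.v .l ∧ s'.v .l ≤ ρ ∧ ρ ≤ s'.v .h ∧
    s'.v .h ≤ P.lo (b + 1) c ∧ s'.v .h < s'.v .l + 2 ^ (P.kap + 1) ∧ s'.t ≤ s₁.t + 40) ?_ ?_
  · refine wp_ite (by simp) (by simp) (fun h => ?_) (fun h => ?_)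
    · simp [elv₁] at h
      obtain ⟨-, h2⟩ := h2.resolve_left (by omega)
      have hkb := Inst.keyVal_bounds hI.pos hbp hpb (i := s₁.v .ih) (c := c) (by
        rcases Nat.eq_zero_or_pos (s₁.v .ih) with h0 | h0
        · exact Or.inl h0
        · exact Or.inr (h1 _ (by omega))) h
      rw [← h2] at hkb
      have hlol : P.lo b c ≤ s₁.v .l := by rw [h2]; exact Inst.le_cut _ _ _
      simp only [wp_seq, wp_set]
      refine ⟨by simp [ekap₁]; omega, wp_ite (by simp) (by simp) (fun h => ?_) (fun h => ?_)⟩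
      · simp [ehi₁, ekap₁] at h ⊢
        omega
      · simp [ehi₁, ekap₁] at h ⊢
        omega
    · simp [elv₁] at h
      obtain ⟨h4, h5⟩ := h2.resolve_right (by omega)
      have hlv : 0 < P.lv := Nat.succ_pos _
      have := Inst.few_of_not_isKey hI.pos hpb (h1 (P.lv - 1) (by omega))
      simp [eh₁, h5]
      omega
  intro s₂ hf₂ ⟨g1, g2, g3, g4, g5, g6⟩
  have ea₂ : s₂.a = s.a := by
    ext q : 1; rw [hf₂.a q rfl, ea₁]
  have ekap₂ : s₂.v .kap = P.kap := by rw [hf₂.v _ rfl, ekap₁]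
  have ebu₂ : s₂.v .bu = 2 ^ P.u := by rw [hf₂.v _ rfl, ebu₁]
  have eu₂ : s₂.v .u = P.u := by rw [hf₂.v _ rfl, eu₁]
  have enb₂ : s₂.v .nb = P.nb := by rw [hf₂.v _ rfl, enb₁]
  have epos₂ : s₂.v .pos = p := by rw [hf₂.v _ rfl, epos₁]
  have ec₂ : s₂.v .c = c := by rw [hf₂.v _ rfl, ec₁]
  have eok₂ : s₂.v .ok = s.v .ok := by rw [hf₂.v _ rfl, eok₁]
  refine ⟨by simp [epos₂, ebu₂]; omega, ?_⟩
  refine (bsearch_spec ρ ?_ hF.wide ?_ ?_ ?_ ?_ ?_ ?_).mono ?_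
  · simp [ekap₂]; omega
  · simpa using g2
  · simpa using g3
  · simp [ea₂, ebu₂, epos₂]
    intro i h4 h5
    exact hI.pos.block_lt_iff (g1.trans h4) (h5.trans_le g4) p
  · simpa [ekap₂] using g5
  · simp; omega
  · simp [ea₂, ebu₂]
    intro i h4 h5
    have := (hI.pos.block_mem (g1.trans h4) (h5.trans_le g4)).2.2
    omega
  intro s₃ hf₃ ⟨el, ht₃⟩
  simp [ekap₂] at ht₃
  have ea₃ : s₃.a = s.a := by
    ext q : 1; rw [hf₃.a q rfl]; simp [ea₂]
  have eu₃ : s₃.v .u = P.u := by rw [hf₃.v _ rfl]; simp [eu₂]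
  have enb₃ : s₃.v .nb = P.nb := by rw [hf₃.v _ rfl]; simp [enb₂]
  have ec₃ : s₃.v .c = c := by rw [hf₃.v _ rfl]; simp [ec₂]
  have eok₃ : s₃.v .ok = s.v .ok := by rw [hf₃.v _ rfl]; simp [eok₂]
  have hlonb : P.lo P.nb c = P.S c + P.R c P.n := by
    have h4 := Inst.R_le (P := P) c (P.nb * 2 ^ P.u)
    have h5 := Inst.R_mono (P := P) c P.n_lt_blocks.le
    unfold Inst.lo
    omega
  refine wp_ite (by simp) (by simp [enb₃, eu₃, ec₃]; omega) (fun h => ?_) (fun h => ?_)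
  · simp [enb₃, eu₃, ec₃, ea₃, el, hend, hlonb] at h
    have hR : P.R c p < P.R c P.n := by omega
    obtain ⟨p', -, q1, q2, q3⟩ := Inst.exists_occ hR
    have hAp := hI.pos p' q1
    rw [q2, q3] at hAp
    have hpos' : s.a .ps ρ = p' := hAp
    simp [el, ea₃, hpos', eok₃]
    refine ⟨⟨by omega, by omega⟩, ⟨Or.inl ⟨?_, q1, q2, fun x hx hxp hT => ?_⟩, by omega⟩⟩
    · by_contra hlt
      have h4 := Inst.R_mono (P := P) c (Nat.succ_le_of_lt (not_le.1 hlt))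
      rw [Nat.succ_eq_add_one, Inst.R_succ, if_pos ⟨q1, q2⟩] at h4
      omega
    · have h4 := Inst.R_mono (P := P) c (Nat.succ_le_of_lt hxp)
      have h5 := Inst.R_mono (P := P) c hx
      rw [Nat.succ_eq_add_one, Inst.R_succ, if_pos ⟨hxp.trans q1, hT⟩] at h4
      omega
  · simp [enb₃, eu₃, ec₃, ea₃, el, hend, hlonb] at h
    simp
    refine ⟨Or.inr fun x hx hxn hT => ?_, by omega⟩
    have h4 := Inst.R_mono (P := P) c (Nat.succ_le_of_lt hxn)
    have h5 := Inst.R_mono (P := P) c hx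
    rw [Nat.succ_eq_add_one, Inst.R_succ, if_pos ⟨hxn, hT⟩] at h4
    omega

end

end WordRAM

namespace WordRAM

section
variable {α : Type*} {a : α} {l T : List α}

theorem cons_sublist_drop_iff {p p' : ℕ} (h : p ≤ p') (hp : p' < T.length) (ha : T[p'] = a)
    (hne : ∀ x (hx : x < T.length), p ≤ x → x < p' → T[x] ≠ a) :
    (a :: l).Sublist (T.drop p) ↔ l.Sublist (T.drop (p' + 1)) := by
  induction h using Nat.decreasingInduction with
  | self => rw [List.drop_eq_getElem_cons hp, ha, List.cons_sublist_cons]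
  | of_succ k hk ih =>
    have hk' : k < T.length := by omega
    rw [← ih fun x hx h1 h2 => hne x hx (by omega) h2, List.drop_eq_getElem_cons hk']
    constructor
    · intro h
      cases h with
      | cons _ h => exact h
      | cons_cons _ h => exact absurd rfl (hne k hk' le_rfl hk)
    · exact List.Sublist.cons _

theorem not_cons_sublist_drop {p : ℕ} (hne : ∀ x (hx : x < T.length), p ≤ x → T[x] ≠ a) :
    ¬ (a :: l).Sublist (T.drop p) := by
  intro h
  have := h.subset List.mem_cons_self
  obtain ⟨i, hi, he⟩ := List.getElem_of_mem this
  rw [List.length_drop] at hi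
  rw [List.getElem_drop] at he
  exact hne (p + i) (by omega) (by omega) he

end

open Var in
/-- Decide whether the input is a subsequence of the text. -/
def searchSubseq : Stmt :=
  loadPar ;; .set pos 0 ;; .set ok 1 ;;
  .loop q n (.ite .eq ok 1 (.set c (.inp q) ;; nextOcc) .skip) ;; .set n ok

theorem searchSubseq_spec {P : Inst} {E : Env} (hF : P.Fits E) (hV : P.Valid) {s : St}
    (ha : 8 < E.amax) (hI : IsIndex P s.a) {T Q : List (Fin P.sig)} (hn : T.length = P.n)
    (hT : ∀ p (h : p < T.length), P.T p = T[p]) (hQ : ∀ i (h : i < Q.length), E.inp i = Q[i])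
    (hm : s.v .n = Q.length) :
    wp E searchSubseq s fun s' => s'.v .n = (if Q.Sublist T then 1 else 0) ∧
      s'.t ≤ s.t + 200 + Q.length * (600 + 200 * P.kap) := by
  obtain ⟨w1, w2, w3⟩ := hF.wide
  unfold searchSubseq
  simp only [wp_seq]
  refine (loadPar_spec hF ha hI.par).mono ?_
  intro s₁ hf₁ ⟨p₁, ht₁⟩
  have ea₁ : s₁.a = s.a := by ext q : 1; rw [hf₁.a q rfl]
  have en₁ : s₁.v .n = Q.length := by rw [hf₁.v _ rfl, hm]
  simp only [wp_set]
  refine ⟨by simp, by simp; omega, ?_⟩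
  refine wp_loop (fun q s' => (s'.v .ok = 1 ∧ s'.v .pos ≤ P.n ∧
      ((Q.drop q).Sublist (T.drop (s'.v .pos)) ↔ Q.Sublist T) ∨ s'.v .ok = 0 ∧ ¬ Q.Sublist T) ∧
      s'.t ≤ s₁.t + 20 + q * (600 + 200 * P.kap)) (by simp) ?_ ?_ ?_
  · simp
  · simp only [Ex.eval_var, St.tick_v, St.set_v, reduceCtorEq, if_false, en₁]
    intro q hq s₂ hf₂ ⟨h1, h2⟩
    have p₂ : P.HasPar s₂ := by
      refine Inst.HasPar.frame ?_ hf₂ rfl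
      exact ((p₁.set .pos _ (by decide)).congr fun _ _ => rfl).set .ok _ (by decide) |>.congr
        fun _ _ => rfl
    have ea₂ : s₂.a = s.a := by
      ext q : 1; rw [hf₂.a q]; · simp [ea₁]
      simp [Stmt.stores, nextOcc, searchLevel, testLevel, bsearch]
    refine wp_ite (by simp) (by simp; omega) (fun h => ?_) (fun h => ?_)
    · simp at h
      obtain ⟨-, hpos, hiff⟩ := h1.resolve_right (by omega)
      rw [List.drop_eq_getElem_cons hq] at hiff
      simp only [wp_seq, wp_set]
      refine ⟨by simp, ?_⟩
      refine (nextOcc_spec hF hV ?_ ?_ ?_ ?_).mono ?_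
      · exact ((p₂.set .q _ (by decide)).congr fun _ _ => rfl).set .c _ (by decide) |>.congr
          fun _ _ => rfl
      · simpa [ea₂] using hI
      · simp [hQ q hq]
      · simpa using hpos
      intro s' hf ⟨g1, g2⟩
      simp [hQ q hq] at g1 g2
      refine ⟨?_, by rw [Nat.add_mul]; omega⟩
      rcases g1 with ⟨p', k1, k2, k3, k4, k5, k6⟩ | ⟨k1, k2⟩
      · refine Or.inl ⟨by omega, by omega, ?_⟩
        rw [← hiff, k6]
        refine (cons_sublist_drop_iff k1 (by omega) (Fin.ext ?_) fun x hx hx1 hx2 he => ?_).symm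
        · rw [← hT, k3]
        · exact k4 x hx1 hx2 (by rw [hT x hx, he])
      · refine Or.inr ⟨k2, fun hs => ?_⟩
        refine not_cons_sublist_drop (fun x hx hx1 he => ?_) (hiff.2 hs)
        exact k1 x hx1 (by omega) (by rw [hT x hx, he])
    · simp at h
      have h3 := h1.resolve_left fun h4 => h h4.1
      simp [h3]
      rw [Nat.add_mul]; omega
  · simp only [Ex.eval_var, St.tick_v, St.set_v, reduceCtorEq, if_false, en₁]
    intro s₂ hf₂ ⟨h1, h2⟩
    simp
    refine ⟨?_, by omega⟩
    rcases h1 with ⟨h3, -, h4⟩ | ⟨h3, h4⟩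
    · simp at h4
      rw [h3, if_pos h4]
    · rw [h3, if_neg h4]

end WordRAM

namespace WordRAM

/-! ### Bounds for the parameters -/

/-- Indices of arrays stay below this number. -/
def Inst.bound (P : Inst) : ℕ := P.nb * 2 ^ (P.m + 1)

section
variable {P : Inst}

theorem Inst.bound_eq : P.bound = 2 * (P.nb * 2 ^ P.m) := by unfold bound; ring

theorem Inst.Valid.one_le_u (h : P.Valid) : 1 ≤ P.u := Nat.clog_pos (by norm_num) h.two_le

theorem Inst.Valid.pow_u_lt (h : P.Valid) : 2 ^ P.u < 2 * P.sig := by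
  have h1 := Nat.pow_pred_clog_lt_self (b := 2) (x := P.sig) (by norm_num) h.two_le
  have h2 := h.one_le_u
  have h3 : 2 ^ P.u = 2 * 2 ^ (P.u - 1) := by rw [← pow_succ']; congr 1; omega
  change 2 ^ (P.u - 1) < _ at h1
  omega

theorem Inst.Valid.lt_bound (h : P.Valid) : 8 < P.bound := by
  have h1 := h.one_le_u
  have h2 := P.one_le_g
  have h3 : 2 ^ 4 ≤ 2 ^ (P.m + 1) := Nat.pow_le_pow_right (by norm_num) (by unfold m; omega)
  have h4 : 1 * 2 ^ (P.m + 1) ≤ P.bound := Nat.mul_le_mul_right _ (Nat.succ_pos _)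
  omega

theorem Inst.Valid.fits (h : P.Valid) (hk : 2 ^ P.k ≤ 2 * P.u) {E : Env} (ha : E.amax = P.bound)
    (hw : P.n ^ 24 ≤ 2 ^ E.w) : P.Fits E := by
  have hn : 2 ≤ P.n := h.two_le.trans h.sig_le
  have hp : ∀ i, 2 ^ i ≤ P.n ^ i := fun i => Nat.pow_le_pow_left hn i
  have hu : 2 ^ P.u ≤ P.n ^ 2 := by
    have h1 := h.pow_u_lt
    have h2 := h.sig_le
    nlinarith
  have hm : 2 ^ P.m ≤ P.n ^ 8 := by
    have h1 : P.u / 2 ^ (P.k + 2) ≤ P.u := Nat.div_le_self _ _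
    calc 2 ^ P.m ≤ 2 ^ (P.u * 3 + 2) :=
          Nat.pow_le_pow_right (by norm_num) (by unfold m g; omega)
      _ = (2 ^ P.u) ^ 3 * 2 ^ 2 := by rw [pow_add, pow_mul]
      _ ≤ (P.n ^ 2) ^ 3 * P.n ^ 2 := Nat.mul_le_mul (Nat.pow_le_pow_left hu 3) (hp 2)
      _ = P.n ^ 8 := by ring
  have hnb : P.nb ≤ P.n ^ 2 := by
    have h1 : P.n / 2 ^ P.u ≤ P.n := Nat.div_le_self _ _
    unfold nb
    nlinarith
  have hkap : 2 ^ P.kap ≤ P.n ^ 10 := by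
    have h1 : P.u < 2 ^ P.u := Nat.lt_two_pow_self
    have h2 : 2 ^ P.k ≤ P.n ^ 2 := by
      have h3 : P.u ≤ P.sig := Nat.clog_le_of_le_pow Nat.lt_two_pow_self.le
      have := h.sig_le
      nlinarith
    calc 2 ^ P.kap = (2 ^ P.k) ^ 2 * 2 ^ 6 := by unfold kap; ring
      _ ≤ (P.n ^ 2) ^ 2 * P.n ^ 6 := Nat.mul_le_mul (Nat.pow_le_pow_left h2 2) (hp 6)
      _ = _ := by ring
  have hmono : ∀ i ≤ 24, P.n ^ i ≤ 2 ^ E.w := fun i hi =>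
    (Nat.pow_le_pow_right (by omega) hi).trans hw
  have hlt : ∀ i < 24, P.n ^ i < 2 ^ E.w := fun i hi =>
    (Nat.pow_lt_pow_right (by omega) hi).trans_le hw
  have hpow : 2 ^ 8 ≤ 2 ^ E.w := (hp 8).trans (hmono 8 (by norm_num))
  have hb : 32 * E.amax < 2 ^ E.w := by
    rw [ha, bound_eq]
    calc 32 * (2 * (P.nb * 2 ^ P.m)) = 2 ^ 6 * (P.nb * 2 ^ P.m) := by ring
      _ ≤ P.n ^ 6 * (P.n ^ 2 * P.n ^ 8) := Nat.mul_le_mul (hp 6) (Nat.mul_le_mul hnb hm)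
      _ = P.n ^ 16 := by ring
      _ < _ := hlt 16 (by norm_num)
  have hum : 2 ^ P.u ≤ 2 ^ P.m := Nat.pow_le_pow_right (by norm_num) (by unfold m; omega)
  have hnb1 : 1 ≤ P.nb := Nat.succ_pos _
  have hx1 : P.nb * 2 ^ P.u ≤ P.nb * 2 ^ P.m := Nat.mul_le_mul_left _ hum
  have hx2 : 1 * 2 ^ P.m ≤ P.nb * 2 ^ P.m := Nat.mul_le_mul_right _ hnb1
  have hnlt := P.n_lt_blocks
  have ha' := ha.trans bound_eq
  refine ⟨⟨(Nat.pow_le_pow_iff_right (by norm_num)).1 hpow, hpow, hb⟩, ?_, ?_, ?_, ?_, ?_, ?_⟩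
  · omega
  · rw [Nat.add_mul]; omega
  · omega
  · rw [pow_succ]; omega
  · calc 2 ^ (2 * P.m + 4) = (2 ^ P.m) ^ 2 * 2 ^ 4 := by ring
      _ ≤ (P.n ^ 8) ^ 2 * P.n ^ 4 := Nat.mul_le_mul (Nat.pow_le_pow_left hm 2) (hp 4)
      _ = P.n ^ 20 := by ring
      _ ≤ _ := hmono 20 (by norm_num)
  · calc P.n + 2 ^ P.kap ≤ P.n ^ 10 + P.n ^ 10 :=
          Nat.add_le_add (Nat.le_self_pow (by norm_num) _) hkap
      _ ≤ P.n * P.n ^ 10 := by rw [← two_mul]; exact Nat.mul_le_mul_right _ hn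
      _ = P.n ^ 11 := by ring
      _ < _ := hlt 11 (by norm_num)

theorem Inst.Valid.two_pow_k_le (h : P.Valid) {ℓ : ℝ} (h0 : 0 ≤ ℓ)
    (hℓ : ℓ ≤ Real.logb 2 (Real.logb 2 (P.sig : ℝ))) (hk : P.k = ⌈ℓ⌉₊) : 2 ^ P.k ≤ 2 * P.u := by
  have h1 : (P.k : ℝ) < ℓ + 1 := hk ▸ Nat.ceil_lt_add_one h0
  have h2 : (2 : ℝ) ≤ P.sig := by exact_mod_cast h.two_le
  have h3 : 0 < Real.logb 2 (P.sig : ℝ) := Real.logb_pos (by norm_num) (by linarith)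
  have h4 : (2 : ℝ) ^ ℓ ≤ Real.logb 2 (P.sig : ℝ) := (Real.le_logb_iff_rpow_le (by norm_num) h3).1 hℓ
  have h5 : Real.logb 2 (P.sig : ℝ) ≤ P.u := by
    rw [Real.logb_le_iff_le_rpow (by norm_num) (by linarith), Real.rpow_natCast]
    exact_mod_cast h.sig_le_pow
  have h6 : (2 : ℝ) ^ (P.k : ℝ) ≤ 2 ^ (ℓ + 1) := Real.rpow_le_rpow_of_exponent_le (by norm_num) h1.le
  rw [Real.rpow_add (by norm_num), Real.rpow_one, Real.rpow_natCast] at h6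
  have : (2 : ℝ) ^ P.k ≤ 2 * P.u := by linarith
  exact_mod_cast this

theorem Inst.Valid.cells_le (h : P.Valid) {ℓ : ℝ} (hk : P.k = ⌈ℓ⌉₊) :
    ((P.nb * 2 ^ P.m : ℕ) : ℝ) ≤ 24 * ((P.n : ℝ) * (P.sig : ℝ) ^ ((1 : ℝ) / (2 : ℝ) ^ ℓ)) := by
  have hσ : (2 : ℝ) ≤ P.sig := by exact_mod_cast h.two_le
  have hu := h.pow_u_lt
  have h1 : P.nb * 2 ^ P.u ≤ 3 * P.n := by
    have h2 : P.n / 2 ^ P.u * 2 ^ P.u ≤ P.n := Nat.div_mul_le_self _ _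
    have h3 := h.sig_le
    unfold nb
    rw [Nat.add_mul]
    omega
  have h2 : P.nb * 2 ^ P.m = P.nb * 2 ^ P.u * (4 * 2 ^ (2 * (P.u / 2 ^ (P.k + 2)))) := by
    unfold m g
    ring
  set e : ℝ := (1 : ℝ) / 2 ^ (P.k + 1) with he
  have he0 : 0 ≤ e := by positivity
  have he1 : e ≤ 1 := by
    rw [he, div_le_one (by positivity)]
    exact_mod_cast Nat.one_le_two_pow
  have h3 : ((2 * (P.u / 2 ^ (P.k + 2)) : ℕ) : ℝ) ≤ P.u * e := by
    rw [he, mul_one_div, le_div_iff₀ (by positivity)]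
    have : 2 * (P.u / 2 ^ (P.k + 2)) * 2 ^ (P.k + 1) ≤ P.u := by
      calc 2 * (P.u / 2 ^ (P.k + 2)) * 2 ^ (P.k + 1) = P.u / 2 ^ (P.k + 2) * 2 ^ (P.k + 2) := by ring
        _ ≤ _ := Nat.div_mul_le_self _ _
    exact_mod_cast this
  have h4 : (2 : ℝ) ^ (2 * (P.u / 2 ^ (P.k + 2))) ≤ 2 * (P.sig : ℝ) ^ ((1 : ℝ) / (2 : ℝ) ^ ℓ) := by
    calc (2 : ℝ) ^ (2 * (P.u / 2 ^ (P.k + 2)))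
        = (2 : ℝ) ^ ((2 * (P.u / 2 ^ (P.k + 2)) : ℕ) : ℝ) := (Real.rpow_natCast _ _).symm
      _ ≤ 2 ^ (P.u * e) := Real.rpow_le_rpow_of_exponent_le (by norm_num) h3
      _ = ((2 : ℝ) ^ P.u) ^ e := by rw [Real.rpow_mul (by norm_num), Real.rpow_natCast]
      _ ≤ (2 * P.sig : ℝ) ^ e := Real.rpow_le_rpow (by positivity) (by exact_mod_cast hu.le) he0
      _ = (2 : ℝ) ^ e * (P.sig : ℝ) ^ e := Real.mul_rpow (by norm_num) (by positivity)
      _ ≤ (2 : ℝ) ^ (1 : ℝ) * (P.sig : ℝ) ^ ((1 : ℝ) / (2 : ℝ) ^ ℓ) := by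
        refine mul_le_mul (Real.rpow_le_rpow_of_exponent_le (by norm_num) he1)
          (Real.rpow_le_rpow_of_exponent_le (by linarith) ?_) (by positivity) (by positivity)
        rw [he]
        refine one_div_le_one_div_of_le (by positivity) ?_
        rw [← Real.rpow_natCast]
        refine Real.rpow_le_rpow_of_exponent_le (by norm_num) ?_
        have := Nat.le_ceil ℓ
        rw [← hk] at this
        push_cast
        linarith
      _ = _ := by rw [Real.rpow_one]
  have h5 : ((P.nb * 2 ^ P.u : ℕ) : ℝ) ≤ 3 * P.n := by exact_mod_cast h1
  rw [h2, Nat.cast_mul]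
  calc ((P.nb * 2 ^ P.u : ℕ) : ℝ) * ((4 * 2 ^ (2 * (P.u / 2 ^ (P.k + 2))) : ℕ) : ℝ)
      ≤ 3 * P.n * (4 * (2 * (P.sig : ℝ) ^ ((1 : ℝ) / (2 : ℝ) ^ ℓ))) := by
        push_cast at h5 ⊢
        gcongr
    _ = _ := by ring

end

/-! ### The programs -/

/-- The preprocessing program. -/
def buildProg : Prog :=
  .seq (.move (vreg .sig) 1) (.seq (.move (vreg .k) 2) (buildIndex.comp 0))

/-- The query program. -/
def queryProg : Prog := searchSubseq.comp 0

/-- The instance of the indexing problem for a text. -/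
def textInst {σ : ℕ} (T : List (Fin σ)) (k : ℕ) : Inst where
  n := T.length
  sig := σ
  k := k
  T p := if h : p < T.length then T[p] else 0

/-- The environment with the given word size and string. -/
def strEnv (w amax : ℕ) {σ : ℕ} (Q : List (Fin σ)) : Env where
  w := w
  amax := amax
  inp i := ((encode w Q).getD i 0).toNat

theorem encode_eq_map (w : ℕ) {σ : ℕ} (Q : List (Fin σ)) :
    encode w Q = Q.map fun x => BitVec.ofNat w x.val := by
  change List.map _ (List.flatMap (fun a => [a.val]) Q) = _
  rw [← List.map_eq_flatMap, List.map_map]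
  rfl

theorem strEnv_inp {w amax σ : ℕ} (Q : List (Fin σ)) (hσ : σ ≤ 2 ^ w) (i : ℕ) (hi : i < Q.length) :
    (strEnv w amax Q).inp i = Q[i] := by
  have h : (Q[i] : ℕ) < 2 ^ w := Q[i].isLt.trans_le hσ
  simp only [strEnv, encode_eq_map, List.getD_eq_getElem?_getD, List.getElem?_map,
    List.getElem?_eq_getElem hi, Option.map_some, Option.getD_some, BitVec.toNat_ofNat]
  exact Nat.mod_eq_of_lt h

theorem vreg_inj {x y : Var} : vreg x = vreg y ↔ x = y := by
  refine ⟨fun h => Var.code_injective ?_, fun h => h ▸ rfl⟩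
  unfold vreg at h
  omega

theorem start_regs_vreg {w : ℕ} {l : List ℕ} {mem : BitVec w → BitVec w} {x : Var} (hx : x ≠ .n)
    (hl : l.length ≤ 3) : (State.start l mem).regs (vreg x) = 0 := by
  have h : x.code ≠ 0 := fun h => hx (Var.code_injective h)
  simp only [State.start]
  rw [List.getD_eq_getElem?_getD, List.getElem?_eq_none (by unfold vreg; omega)]
  simp

end WordRAM

open WordRAM in
theorem indexesSubsequences {σ : ℕ} (T : List (Fin σ)) {ℓ : ℝ} {w : ℕ} (hσ : 2 ≤ σ)
    (hn : σ ≤ T.length) (h0 : 0 ≤ ℓ) (hℓ : ℓ ≤ Real.logb 2 (Real.logb 2 (σ : ℝ)))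
    (hw : T.length ^ 24 ≤ 2 ^ w) :
    IndexesSubsequences buildProg queryProg w T ⌈ℓ⌉₊
      (130000 * ((T.length : ℝ) * (σ : ℝ) ^ ((1 : ℝ) / (2 : ℝ) ^ ℓ)))
      (fun m => 130000 * ((m : ℝ) * (ℓ + 1) + 1)) := by
  set P : Inst := textInst T ⌈ℓ⌉₊ with hP
  have hV : P.Valid := by
    refine ⟨hσ, hn, fun p hp => ?_⟩
    have hp : p < T.length := hp
    change (if h : p < T.length then (T[p] : ℕ) else 0) < σ
    rw [dif_pos hp]
    exact T[p].isLt
  have hTP : ∀ p (h : p < T.length), P.T p = T[p] := fun p hp => dif_pos hp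
  have hk := hV.two_pow_k_le h0 hℓ rfl
  have hcells := hV.cells_le (ℓ := ℓ) rfl
  have hF : ∀ S : List (Fin σ), P.Fits (strEnv w P.bound S) := fun S => hV.fits hk rfl hw
  have hE : ∀ S : List (Fin σ), (strEnv w P.bound S).Fits (encode w S) := fun S =>
    ⟨(hF S).wide.amax, fun _ _ => rfl⟩
  have hb := hV.lt_bound
  have hbw : 32 * P.bound < 2 ^ w := (hF T).wide.amax
  have hnb : T.length < P.bound := (hF T).n_lt
  have hkw : ⌈ℓ⌉₊ < 2 ^ w := by
    have h1 : ⌈ℓ⌉₊ < 2 ^ ⌈ℓ⌉₊ := Nat.lt_two_pow_self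
    have h2 : P.u ≤ σ := Nat.clog_le_of_le_pow Nat.lt_two_pow_self.le
    have h3 : 2 ^ ⌈ℓ⌉₊ ≤ 2 * P.u := hk
    omega
  set σ₀ : State w := State.start [T.length, σ, ⌈ℓ⌉₊] fun _ => 0 with hσ₀
  set σ₁ : State w := (σ₀.setReg (vreg .sig) (σ₀.regs 1)).setReg (vreg .k)
    ((σ₀.setReg (vreg .sig) (σ₀.regs 1)).regs 2) with hσ₁
  set s₁ : St := ⟨fun x => if x = .n then T.length else if x = .sig then σ else if x = .k then ⌈ℓ⌉₊ else 0,
    fun _ _ => 0, 0⟩ with hs₁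
  have hregs : ∀ x, (σ₁.regs (vreg x)).toNat = s₁.v x := by
    intro x
    have e1 : (σ₀.regs 1).toNat = σ := Nat.mod_eq_of_lt (show σ < 2 ^ w by omega)
    have e2 : (σ₀.regs 2).toNat = ⌈ℓ⌉₊ := Nat.mod_eq_of_lt hkw
    simp only [hσ₁, State.setReg_regs, vreg_inj]
    by_cases hxk : x = .k
    · subst hxk
      exact e2
    · rw [if_neg hxk]
      by_cases hxs : x = .sig
      · subst hxs
        exact e1
      · rw [if_neg hxs]
        by_cases hxn : x = .n
        · subst hxn
          exact Nat.mod_eq_of_lt (show T.length < 2 ^ w by omega)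
        · rw [hσ₀, start_regs_vreg hxn (by simp)]
          simp [hs₁, hxn, hxs, hxk]
  have hrep : Rep (strEnv w P.bound T) s₁ σ₁ := ⟨hregs, fun _ _ _ => rfl⟩
  obtain ⟨hok, hidx, htime⟩ := buildIndex_spec (hF T) hV (fun p hp => by
    rw [hTP p hp]; exact strEnv_inp T (by omega) p hp) (s := s₁) hb rfl rfl rfl (fun _ _ => rfl)
  obtain ⟨σ₂, t, a, hexec, ha, hrep₂, ht, -⟩ := buildIndex.exec_comp (hE T) 0 s₁ σ₁ hrep hok
  have htime' : t ≤ 5000 * (P.nb * 2 ^ P.m) := by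
    have : s₁.t = 0 := rfl
    omega
  have hbound : P.bound = 2 * (P.nb * 2 ^ P.m) := Inst.bound_eq
  have ha' : a ≤ 64 * (P.nb * 2 ^ P.m) := by
    have : a ≤ 32 * P.bound := ha
    omega
  have hX : 1 ≤ P.nb * 2 ^ P.m := by omega
  set X := P.nb * 2 ^ P.m with hXdef
  have hX' : (1 : ℝ) ≤ X := by exact_mod_cast hX
  have hspace : ∀ x : ℕ, x ≤ 5002 * X →
      (x : ℝ) ≤ 130000 * ((T.length : ℝ) * (σ : ℝ) ^ ((1 : ℝ) / (2 : ℝ) ^ ℓ)) := by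
    intro x hx
    have h1 : (x : ℝ) ≤ 5002 * X := by exact_mod_cast hx
    have h2 : (X : ℝ) ≤ 24 * ((T.length : ℝ) * (σ : ℝ) ^ ((1 : ℝ) / (2 : ℝ) ^ ℓ)) := hcells
    linarith
  refine ⟨σ₂, 1 + (1 + t), max 0 (max 0 a), (Exec.move _ _ _).seq ((Exec.move _ _ _).seq hexec),
    hspace _ (by omega), hspace _ (by omega), fun Q hQ => ?_⟩
  set s₃ : St := ⟨fun x => if x = .n then Q.length else 0, (buildIndex.run (strEnv w P.bound T) s₁).a, 0⟩
    with hs₃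
  have hregs₃ : ∀ x, ((State.start [Q.length] σ₂.mem : State w).regs (vreg x)).toNat = s₃.v x := by
    intro x
    by_cases hxn : x = .n
    · subst hxn
      exact Nat.mod_eq_of_lt hQ
    · refine (congrArg BitVec.toNat (start_regs_vreg (w := w) hxn (by simp))).trans ?_
      simp [hs₃, hxn]
  have hrep₃ : Rep (strEnv w P.bound Q) s₃ (State.start [Q.length] σ₂.mem) :=
    ⟨hregs₃, fun q i hi => hrep₂.a q i hi⟩
  obtain ⟨hok₃, hres, htime₃⟩ := searchSubseq_spec (hF Q) hV (s := s₃) hb hidx (T := T) (Q := Q) rfl hTP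
    (fun i hi => strEnv_inp Q (by omega) i hi) rfl
  obtain ⟨σ₄, t', a', hexec', hl, hrep₄, ht', hkeep⟩ :=
    searchSubseq.exec_comp (hE Q) 0 s₃ _ hrep₃ hok₃
  have hl' : a' ≤ 64 * X := by
    have : a' ≤ 32 * P.bound := hl
    omega
  refine ⟨σ₄, t', a', hexec', ?_, hkeep.mem fun q => by cases q <;> rfl, ?_, hspace _ (by omega)⟩
  · apply BitVec.eq_of_toNat_eq
    have h1 := hrep₄.v .n
    rw [hres] at h1
    have h2 : 1 < 2 ^ w := by omega
    refine h1.trans ?_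
    by_cases hs : Q.Sublist T
    · rw [if_pos hs]
      exact (if_pos hs).trans (Nat.mod_eq_of_lt h2).symm
    · rw [if_neg hs]
      exact (if_neg hs).trans (Nat.zero_mod _).symm
  · have h1 : t' ≤ 200 + Q.length * (600 + 200 * P.kap) := by
      have h0 : s₃.t = 0 := rfl
      rw [ht', h0, Nat.zero_add, Nat.zero_add] at htime₃
      exact htime₃
    have h2 : (t' : ℝ) ≤ 200 + Q.length * (600 + 200 * (2 * ⌈ℓ⌉₊ + 6)) := by exact_mod_cast h1
    have h3 : (⌈ℓ⌉₊ : ℝ) < ℓ + 1 := Nat.ceil_lt_add_one h0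
    have h4 : (Q.length : ℝ) * (600 + 200 * (2 * ⌈ℓ⌉₊ + 6)) ≤ Q.length * (2200 * (ℓ + 1)) := by
      gcongr
      linarith
    have h5 : (0 : ℝ) ≤ Q.length * (ℓ + 1) := by positivity
    calc (t' : ℝ) ≤ 200 + Q.length * (2200 * (ℓ + 1)) := by linarith
      _ = 200 + 2200 * (Q.length * (ℓ + 1)) := by ring
      _ ≤ _ := by linarith

theorem theorem4 :
    ∃ (build query : WordRAM.Prog) (c : ℕ) (C : ℝ),
      ∀ (σ : ℕ) (T : List (Fin σ)) (ℓ : ℝ) (w : ℕ),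
        2 ≤ σ → σ ≤ T.length →
        0 ≤ ℓ → ℓ ≤ Real.logb 2 (Real.logb 2 (σ : ℝ)) →
        T.length ^ c ≤ 2 ^ w →
        IndexesSubsequences build query w T ⌈ℓ⌉₊
          (C * ((T.length : ℝ) * (σ : ℝ) ^ ((1 : ℝ) / (2 : ℝ) ^ ℓ)))
          (fun m => C * ((m : ℝ) * (ℓ + 1) + 1)) :=
  ⟨WordRAM.buildProg, WordRAM.queryProg, 24, 130000, fun _ T _ _ h1 h2 h3 h4 h5 =>
    indexesSubsequences T h1 h2 h3 h4 h5⟩
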